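/- Let $k\ge 1$, $T>0$, $\Omega=[0,2\pi]$, and consider $$u_t+(\alpha u)_x=g(x,t)\ \text{ in } \Omega\times[0,T],\qquad u(x,0)=u_0(x),\qquad u(0,t)=u(2\pi,t),$$ where $\alpha\in C^\infty(\Omega)$ satisfies $\alpha(0)=\alpha(2\pi)$ and may vanish and change sign, and $g\in C^\infty(\Omega\times[0,T])$. **Mesh.** Let $0=x_{1/2}<x_{3/2}<\dots<x_{N+1/2}=2\pi$ with $N\geq 1$, $V_i=[x_{i-1/2},x_{i+1/2}]$, $h_i=x_{i+1/2}-x_{i-1/2}$, $h=\max_i h_i$, and assume the mesh is shape-regular: $h\le\sigma h_i$ for all $i$; otherwise it is arbitrary. Element indices are understood modulo $N$. For reference points $-1=s_0<s_1<\dots<s_{k+1}=1$ (which may depend on $i$) put $x_{i,j}=\frac{h_i}{2}s_j+\frac12(x_{i-1/2}+x_{i+1/2})$. With $L_n$ the Legendre polynomial of degree $n$: * *LSV method*: $s_1,\dots,s_k$ are the zeros of $L_k$ in every element. * *RSV method*: if $\alpha(x_{i-1/2})>0$ and $\alpha(x_{i+1/2})>0$, then $s_1,\dots,s_{k+1}$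 are the zeros of $L_{k+1}-L_k$ (right Radau points); if $\alpha(x_{i-1/2})<0$ and $\alpha(x_{i+1/2})<0$, then $s_0,\dots,s_k$ are the zeros of $L_{k+1}+L_k$ (left Radau points); in all other elements either choice is allowed. **Scheme.** For each $t\in[0,T]$, $u_h(\cdot,t)$ is a polynomial of degree at most $k$ on every $V_i$, it is differentiable in $t$, and for all $i$ and $0\le j\le k$ $$\int_{x_{i,j}}^{x_{i,j+1}}(u_h)_t\,dx+\alpha\hat u_h|_{x_{i,j+1}}-\alpha\hat u_h|_{x_{i,j}}=\int_{x_{i,j}}^{x_{i,j+1}}g\,dx .$$ Here $\hat u_h=u_h$ at the points inside an element, and at $x_{i+1/2}$ the upwind value $\hat u_h$ is the left limit of $u_h$ if $\alpha(x_{i+1/2})>0$ and the right limit if $\alpha(x_{i+1/2})\le0$, limits at $0$ and $2\pi$ being taken periodically. **Interpolation.** On $V_i$, $I_h\phi$ is the Lagrange interpolant of $\phi$ of degree at most $k$ at $k+1$ of the $k+2$ points $x_{i,0},\dots,x_{i,k+1}$: all except $x_{i,0}$ if $\alpha(x_{i-1/2})\ge0$ and $\alpha(x_{i+1/2})>0$;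 all except $x_{i,k+1}$ if $\alpha(x_{i-1/2})\le0$ and $\alpha(x_{i+1/2})<0$; all except $x_{i,k}$ otherwise. **Theorem 4.1.** Let $u$ be a classical solution of the problem with $u(\cdot,t)\in H^{k+2}(\Omega)$ for every $t\in[0,T]$, and let $u_h$ be the solution of the RSV or of the LSV scheme with $u_h(\cdot,0)=I_hu_0$. Then, for every $t\in[0,T]$, $$\|(u-u_h)(\cdot,t)\|_0\le C\,h^{k+1}\sup_{\tau\in[0,t]}\|u(\cdot,\tau)\|_{k+2},$$ where $C$ may depend on $\alpha,g,k,\sigma,T,t$, but neither on the mesh (beyond $\sigma$), nor on the method, nor on $u_0$, $u$ and $u_h$. Moreover, there is a constant $C$ depending only on $\alpha,k,\sigma,T$ such that, for all $g$ as above and all $t\in[0,T]$, $$\|(u-u_h)(\cdot,t)\|_0\le C\,h^{k+1}\Big(\sup_{\tau\in[0,t]}\|u(\cdot,\tau)\|_{k+2}+\sup_{\tau\in[0,t]}\|g(\cdot,\tau)\|_{k+1}\Big);$$ in particular, for $g=0$ the constant in the first estimate is uniform in $t\in[0,T]$. Here $\|\cdot\|_m$ is the norm of $H^m(\Omega)$,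 $\|\cdot\|_0$ that of $L^2(\Omega)$. -/

import Mathlib

open Set MeasureTheory
open scoped ENNReal ContDiff Polynomial

noncomputable section

namespace SpectralVolume

/-! ### Sobolev spaces on `Ω = (0, 2π)` -/

/-- The spatial domain `Ω = [0, 2π]`. -/
def Ω : Set ℝ := Icc 0 (2 * Real.pi)

/-- Lebesgue measure on `Ω`. -/
def μΩ : Measure ℝ := volume.restrict Ω

/-- `v ∈ L²(Ω)` is the `j`-th weak derivative of `f` on the open interval `(0, 2π)`. -/
structure IsWeakDeriv (j : ℕ) (f v : ℝ → ℝ) : Prop where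
  locallyIntegrable : LocallyIntegrableOn f (interior Ω)
  memLp : MemLp v 2 μΩ
  integral_eq : ∀ φ : ℝ → ℝ, ContDiff ℝ ∞ φ → HasCompactSupport φ → tsupport φ ⊆ interior Ω →
    ∫ x in Ω, f x * iteratedDeriv j φ x = (-1) ^ j * ∫ x in Ω, v x * φ x

/-- Membership in the Sobolev space `H^m(Ω)`. -/
def MemSobolev (m : ℕ) (f : ℝ → ℝ) : Prop :=
  ∀ j ≤ m, ∃ v, IsWeakDeriv j f v

/-- The `L²(Ω)` norm of the `j`-th weak derivative of `f`. Weak derivatives being unique up to null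
sets, the infimum runs over at most one value; it is `∞` if there is no weak derivative in `L²`. -/
def weakDerivNorm (j : ℕ) (f : ℝ → ℝ) : ℝ≥0∞ :=
  ⨅ (v : ℝ → ℝ) (_ : IsWeakDeriv j f v), eLpNorm v 2 μΩ

/-- The norm `‖f‖_m = (∑_{j ≤ m} ‖f^{(j)}‖²)^{1/2}` of `H^m(Ω)`, which is `∞` off `H^m(Ω)`. -/
def sobolevNorm (m : ℕ) (f : ℝ → ℝ) : ℝ≥0∞ :=
  (∑ j ∈ Finset.range (m + 1), weakDerivNorm j f ^ 2) ^ (1 / 2 : ℝ)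

/-! ### The continuous problem -/

/-- `u` is a (classical) solution of `u_t + (α u)_x = g` in `[0, 2π] × [0, T]` with `u(·, 0) = u₀`
and the periodic boundary condition. The value `u(x, t)` is written `u t x`, and similarly for
`g`. -/
structure IsSolution (T : ℝ) (α : ℝ → ℝ) (g : ℝ → ℝ → ℝ) (u₀ : ℝ → ℝ) (u : ℝ → ℝ → ℝ) : Prop where
  differentiable_space : ∀ t ∈ Icc 0 T, DifferentiableOn ℝ (u t) Ω
  differentiable_time : ∀ x ∈ Ω, DifferentiableOn ℝ (fun t => u t x) (Icc 0 T)
  equation : ∀ t ∈ Icc 0 T, ∀ x ∈ Ω,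
    derivWithin (fun s => u s x) (Icc 0 T) t + derivWithin (fun y => α y * u t y) Ω x = g t x
  periodic : ∀ t ∈ Icc 0 T, u t 0 = u t (2 * Real.pi)
  initial : ∀ x ∈ Ω, u 0 x = u₀ x

/-! ### Legendre polynomials and partitions of the reference element -/

/-- The Legendre polynomial `L_n`, by Rodrigues' formula (so `L_n(1) = 1`). -/
def legendre (n : ℕ) : ℝ[X] :=
  Polynomial.C ((2 ^ n * n.factorial : ℝ)⁻¹) *
    Polynomial.derivative^[n] ((Polynomial.X ^ 2 - 1) ^ n)

/-- `-1 = s_0 < s_1 < ⋯ < s_{k+1} = 1`. -/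
structure IsPartition {k : ℕ} (s : Fin (k + 2) → ℝ) : Prop where
  strictMono : StrictMono s
  first : s 0 = -1
  last : s (Fin.last (k + 1)) = 1

/-- `s_1, …, s_k` are the Gauss-Legendre points. -/
def IsGauss {k : ℕ} (s : Fin (k + 2) → ℝ) : Prop :=
  ∀ j, j ≠ 0 → j ≠ Fin.last (k + 1) → (legendre k).IsRoot (s j)

/-- `s_1, …, s_{k+1}` are the right Radau points. -/
def IsRightRadau {k : ℕ} (s : Fin (k + 2) → ℝ) : Prop :=
  ∀ j, j ≠ 0 → (legendre (k + 1) - legendre k).IsRoot (s j)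

/-- `s_0, …, s_k` are the left Radau points. -/
def IsLeftRadau {k : ℕ} (s : Fin (k + 2) → ℝ) : Prop :=
  ∀ j, j ≠ Fin.last (k + 1) → (legendre (k + 1) + legendre k).IsRoot (s j)

/-! ### Meshes and piecewise polynomials -/

/-- A mesh of `[0, 2π]` with `N` elements, numbered `0, …, N - 1`; arithmetic of the numbers is
modulo `N`, so that `i - 1` and `i + 1` are the neighbours of `i` under periodicity. -/
structure Mesh (N : ℕ) where
  node : Fin (N + 1) → ℝ
  strictMono : StrictMono node
  first : node 0 = 0
  last : node (Fin.last N) = 2 * Real.pi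

namespace Mesh

variable {N : ℕ} (M : Mesh N)

/-- The left end of the element `i`. -/
def left (i : Fin N) : ℝ := M.node i.castSucc

/-- The right end of the element `i`. -/
def right (i : Fin N) : ℝ := M.node i.succ

/-- The length `h_i` of the element `i`. -/
def length (i : Fin N) : ℝ := M.right i - M.left i

/-- The mesh size `h = max_i h_i`. -/
def h : ℝ := ⨆ i, M.length i

/-- Shape regularity with constant `σ`: `h ≤ σ h_i` for all `i`. -/
def ShapeRegular (σ : ℝ) : Prop := ∀ i, M.h ≤ σ * M.length i

/-- The point of the element `i` that corresponds to `s ∈ [-1, 1]`. -/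
def point (i : Fin N) (s : ℝ) : ℝ := M.length i / 2 * s + (M.left i + M.right i) / 2

/-- The function on `Ω` given by a family of polynomials, one for each element. -/
def toFun (v : Fin N → ℝ[X]) (x : ℝ) : ℝ :=
  ∑ i, (Ico (M.left i) (M.right i)).indicator (fun y => (v i).eval y) x

end Mesh

/-! ### The two spectral volume methods -/

/-- The Gauss-Legendre (`lsv`) and the Radau (`rsv`) spectral volume method. -/
inductive Method
  | lsv
  | rsv

/-- The reference partition `s i` of each element `i` is one that the method prescribes. -/
def Admissible {N k : ℕ} (α : ℝ → ℝ) (M : Mesh N) (s : Fin N → Fin (k + 2) → ℝ) : Method → Prop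
  | .lsv => ∀ i, IsPartition (s i) ∧ IsGauss (s i)
  | .rsv => ∀ i, IsPartition (s i) ∧
      (0 < α (M.left i) → 0 < α (M.right i) → IsRightRadau (s i)) ∧
      (α (M.left i) < 0 → α (M.right i) < 0 → IsLeftRadau (s i)) ∧
      (IsRightRadau (s i) ∨ IsLeftRadau (s i))

section Scheme

variable {N k : ℕ} [NeZero N] (α : ℝ → ℝ) (M : Mesh N) (s : Fin N → Fin (k + 2) → ℝ)

/-- The upwind value `v̂` at the left end of the element `i`. -/
def upwindLeft (v : Fin N → ℝ[X]) (i : Fin N) : ℝ :=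
  if 0 < α (M.left i) then (v (i - 1)).eval (M.right (i - 1)) else (v i).eval (M.left i)

/-- The upwind value `v̂` at the right end of the element `i`. -/
def upwindRight (v : Fin N → ℝ[X]) (i : Fin N) : ℝ :=
  if 0 < α (M.right i) then (v i).eval (M.right i) else (v (i + 1)).eval (M.left (i + 1))

/-- The numerical flux `α v̂` at the point `x_{i,j}`. -/
def flux (v : Fin N → ℝ[X]) (i : Fin N) (j : Fin (k + 2)) : ℝ :=
  α (M.point i (s i j)) *
    if j = 0 then upwindLeft α M v i
    else if j = Fin.last (k + 1) then upwindRight α M v i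
    else (v i).eval (M.point i (s i j))

/-- `uh t`, given by its polynomial on each element, is for `t ∈ [0, T]` the solution of the
spectral volume scheme (local conservation on each control volume `[x_{i,j}, x_{i,j+1}]`). -/
structure IsSVSolution (T : ℝ) (g : ℝ → ℝ → ℝ) (uh : ℝ → Fin N → ℝ[X]) : Prop where
  natDegree_le : ∀ t ∈ Icc 0 T, ∀ i, (uh t i).natDegree ≤ k
  differentiable : ∀ i x, DifferentiableOn ℝ (fun t => (uh t i).eval x) (Icc 0 T)
  scheme : ∀ t ∈ Icc 0 T, ∀ (i : Fin N) (j : Fin (k + 1)),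
    (∫ x in M.point i (s i j.castSucc)..M.point i (s i j.succ),
        derivWithin (fun τ => (uh τ i).eval x) (Icc 0 T) t)
      + flux α M s (uh t) i j.succ - flux α M s (uh t) i j.castSucc
      = ∫ x in M.point i (s i j.castSucc)..M.point i (s i j.succ), g t x

/-- Among the `k + 2` points `x_{i,0}, …, x_{i,k+1}` of the element `i`, the one at which the
interpolation `I_h` does not interpolate: `x_{i,0}` for `I_h⁻`, `x_{i,k+1}` for `I_h⁺`, and
`x_{i,k}` for the third operator, which uses both ends of the element. -/
def omitted (k : ℕ) (i : Fin N) : Fin (k + 2) :=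
  if 0 ≤ α (M.left i) ∧ 0 < α (M.right i) then 0
  else if α (M.left i) ≤ 0 ∧ α (M.right i) < 0 then Fin.last (k + 1)
  else (Fin.last k).castSucc

/-- The special Lagrange interpolation `I_h φ`, of degree at most `k` on each element. -/
def interpolant (φ : ℝ → ℝ) (i : Fin N) : ℝ[X] :=
  Lagrange.interpolate (Finset.univ.erase (omitted α M k i))
    (fun j => M.point i (s i j)) (fun j => φ (M.point i (s i j)))

end Scheme

/-- The estimate `‖(u - u_h)(·, t)‖₀ ≤ C h^{k+1} (sup_{0 ≤ τ ≤ t} ‖u(·, τ)‖_{k+2} + G)` at the time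
`t`, for either method on every mesh with shape regularity constant `σ`, for every exact solution
with `u(·, τ) ∈ H^{k+2}` and the numerical solution that starts from `I_h u₀`. -/
def ErrorBound (k : ℕ) (T σ : ℝ) (α : ℝ → ℝ) (g : ℝ → ℝ → ℝ) (t C : ℝ) (G : ℝ≥0∞) : Prop :=
  ∀ (method : Method) (N : ℕ) [NeZero N] (M : Mesh N) (s : Fin N → Fin (k + 2) → ℝ)
    (u₀ : ℝ → ℝ) (u : ℝ → ℝ → ℝ) (uh : ℝ → Fin N → ℝ[X]),
    M.ShapeRegular σ →
    Admissible α M s method →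
    IsSolution T α g u₀ u →
    (∀ τ ∈ Icc 0 T, MemSobolev (k + 2) (u τ)) →
    IsSVSolution α M s T g uh →
    uh 0 = interpolant α M s u₀ →
    eLpNorm (fun x => u t x - M.toFun (uh t) x) 2 μΩ ≤
      ENNReal.ofReal (C * M.h ^ (k + 1)) * ((⨆ τ ∈ Icc 0 t, sobolevNorm (k + 2) (u τ)) + G)

end SpectralVolume

end

open Set MeasureTheory
open scoped ENNReal ContDiff Polynomial
noncomputable section
namespace SpectralVolume

/-! The scheme is a Petrov–Galerkin method in disguise. On the reference element, a polynomial v of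
degree at most k is paired with the step function V on the control volumes that starts from v(-1)
and jumps by A_j v'(s_j) at s_j, where A are the Gauss or Radau quadrature weights. Exactness of the
quadrature for v' makes V end at v(1). Multiply the conservation laws by V and sum by parts. The
mass term becomes ∫ w v plus a nonnegative multiple of the product of the coefficients of degree k
(`refMass`, `IsQuadrature.sum_integral_eq_refMass`), since the quadrature error in degree 2k has a
sign for Gauss and vanishes for Radau. The flux term becomes the quadrature of α v v' plus end terms
(`IsQuadrature.flux_lower_bound`). Freezing α on an element costs O(h), the frozen quadrature is
exact, and over the whole mesh the upwind end terms dissipate (`sum_interface_le`). A Radau weight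
at an end of an element is harmless: either the flux there is upwinded from inside, or α = O(h) on
the element.

The optimal order comes from the choice of I_h. At the ends of an element either α vanishes or the
upwind element interpolates u there, so the interpolation error produces no flux. If an inner node
is omitted, α has a zero in that element, and the factor |α| ≤ L h makes up for the power of h that
is lost by taking a flux difference instead of an integral (`abs_flux_sub_le`). The other residual
is the interpolation error of u_t = g - (α u)_x, which has k+1 space derivatives because u has k+2.
Hence the energy E of u_h - I_h u satisfies E' ≤ a E + C h^(2k+2) (...) with E(0) = 0, and
Gronwall's inequality concludes (`exists_error_bound`). The constants depend on the nodes only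
through finitely many reference partitions.

This argument leaves a norm of g on the right. For fixed g and t it is absorbed into the constant:
if g does not vanish before t, the equation forces u to have a norm bounded below on [0, t]
(`exists_pos_le_of_source_ne_zero`). -/

/-! ### Orthogonality of the Legendre polynomials -/

open Polynomial in
/-- The integral of a polynomial over the reference element `[-1, 1]`. -/
def refIntegral : ℝ[X] →ₗ[ℝ] ℝ where
  toFun p := ∫ x in (-1 : ℝ)..1, p.eval x
  map_add' p q := by
    simp only [eval_add]
    exact intervalIntegral.integral_add (p.continuous.intervalIntegrable _ _)
      (q.continuous.intervalIntegrable _ _)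
  map_smul' c p := by
    simp [eval_smul]

lemma refIntegral_apply (p : ℝ[X]) : refIntegral p = ∫ x in (-1 : ℝ)..1, p.eval x := rfl

open Polynomial in
lemma integral_eval_derivative (p : ℝ[X]) (a b : ℝ) :
    ∫ x in a..b, (derivative p).eval x = p.eval b - p.eval a :=
  intervalIntegral.integral_eq_sub_of_hasDerivAt (fun x _ => p.hasDerivAt x)
    ((derivative p).continuous.intervalIntegrable _ _)

open Polynomial in
lemma refIntegral_derivative (p : ℝ[X]) :
    refIntegral (derivative p) = p.eval 1 - p.eval (-1) :=
  integral_eval_derivative p _ _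

lemma refIntegral_sq_nonneg (p : ℝ[X]) : 0 ≤ refIntegral (p * p) := by
  rw [refIntegral_apply]
  refine intervalIntegral.integral_nonneg (by norm_num) fun x _ => ?_
  rw [Polynomial.eval_mul]
  exact mul_self_nonneg _

-- Repeated integration by parts: the boundary terms vanish, and each step lowers the degree of `r`
-- together with the order of differentiation of `f`.
open Polynomial in
lemma refIntegral_iterate_derivative_mul_eq_zero (f : ℝ[X]) (n : ℕ)
    (hf : ∀ j < n, (derivative^[j] f).eval 1 = 0 ∧ (derivative^[j] f).eval (-1) = 0) :
    ∀ j ≤ n, ∀ r : ℝ[X], r.degree < j → refIntegral (derivative^[j] f * r) = 0 := by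
  intro j
  induction j with
  | zero =>
    intro _ r hr
    have : r = 0 := by
      rw [← Polynomial.degree_eq_bot]
      simpa using hr
    simp [this]
  | succ j ih =>
    intro hj r hr
    have h1 := refIntegral_derivative (derivative^[j] f * r)
    rw [derivative_mul, map_add, eval_mul, eval_mul, (hf j (by omega)).1, (hf j (by omega)).2,
      ← Function.iterate_succ_apply' derivative] at h1
    have h2 : refIntegral (derivative^[j] f * derivative r) = 0 := by
      apply ih (by omega)
      by_cases h0 : r = 0
      · subst h0
        simp
      · by_cases hd : r.natDegree = 0
        · rw [Polynomial.natDegree_eq_zero] at hd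
          obtain ⟨c, rfl⟩ := hd
          simp
        · rw [Polynomial.degree_eq_natDegree h0] at hr
          have := Polynomial.natDegree_derivative_lt hd
          refine lt_of_le_of_lt Polynomial.degree_le_natDegree ?_
          have hr' : r.natDegree < j + 1 := by exact_mod_cast hr
          exact_mod_cast (by omega : (derivative r).natDegree < j)
    rw [h2] at h1
    simpa using h1

open Polynomial in
lemma refIntegral_legendre_mul_eq_zero (n : ℕ) (r : ℝ[X]) (hr : r.degree < n) :
    refIntegral (legendre n * r) = 0 := by
  -- Each of ±1 is a zero of order n of (x² - 1)^n, so all derivatives of order below n vanish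
  -- there.
  have key := refIntegral_iterate_derivative_mul_eq_zero ((X ^ 2 - 1 : ℝ[X]) ^ n) n (by
    intro j hj
    have hfac : (X ^ 2 - 1 : ℝ[X]) ^ n = (X - C 1) ^ n * (X - C (-1)) ^ n := by
      rw [← mul_pow]
      congr 1
      simp
      ring
    have hz : ∀ a : ℝ, (X - C a) ^ n ∣ (X ^ 2 - 1 : ℝ[X]) ^ n →
        (derivative^[j] ((X ^ 2 - 1 : ℝ[X]) ^ n)).eval a = 0 := by
      intro a ha
      have h1 := pow_sub_dvd_iterate_derivative_of_pow_dvd j ha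
      have h2 : (X - C a) ∣ derivative^[j] ((X ^ 2 - 1 : ℝ[X]) ^ n) :=
        (dvd_pow_self _ (by omega)).trans h1
      exact dvd_iff_isRoot.1 h2
    exact ⟨hz 1 ⟨_, hfac⟩, hz (-1) ⟨_, hfac.trans (mul_comm _ _)⟩⟩) n le_rfl r hr
  rw [legendre, mul_assoc, ← Polynomial.smul_eq_C_mul, map_smul, key, smul_zero]

open Polynomial in
lemma natDegree_legendre_le (n : ℕ) : (legendre n).natDegree ≤ n := by
  rw [legendre]
  refine (natDegree_C_mul_le _ _).trans ((natDegree_iterate_derivative _ _).trans ?_)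
  have : ((X ^ 2 - 1 : ℝ[X]) ^ n).natDegree ≤ 2 * n := by
    refine natDegree_pow_le.trans ?_
    have : (X ^ 2 - 1 : ℝ[X]).natDegree ≤ 2 := by compute_degree
    nlinarith
  omega

open Polynomial in
lemma coeff_legendre_ne_zero (n : ℕ) : (legendre n).coeff n ≠ 0 := by
  have hm : ((X ^ 2 - 1 : ℝ[X]) ^ n).Monic := by
    apply Monic.pow
    have := monic_X_pow_sub_C (1 : ℝ) (n := 2) (by norm_num)
    simpa using this
  have hd : ((X ^ 2 - 1 : ℝ[X]) ^ n).natDegree = n + n := by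
    have h2 : (X ^ 2 - 1 : ℝ[X]).natDegree = 2 := by
      have := natDegree_X_pow_sub_C (n := 2) (r := (1 : ℝ))
      simpa using this
    rw [natDegree_pow, h2]
    ring
  have hc : ((X ^ 2 - 1 : ℝ[X]) ^ n).coeff (n + n) = 1 := by
    rw [← hd]
    exact hm
  rw [legendre, coeff_C_mul, coeff_iterate_derivative, hc]
  have : (n + n).descFactorial n ≠ 0 := by
    rw [Ne, Nat.descFactorial_eq_zero_iff_lt]
    omega
  have h3 : ((n + n).descFactorial n : ℝ) ≠ 0 := by exact_mod_cast this
  have h4 : (2 ^ n * n.factorial : ℝ) ≠ 0 := by positivity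
  simp only [nsmul_eq_mul, mul_one]
  exact mul_ne_zero (inv_ne_zero h4) h3

/-! ### Gauss and Radau quadrature -/

/-- A quadrature formula on the nodes `s` with weights `A` that is exact in degree `< 2k`, and whose
error in degree `2k` is nonnegative. -/
structure IsQuadrature {k : ℕ} (s A : Fin (k + 2) → ℝ) (c : ℝ) : Prop where
  nonneg : 0 ≤ c
  error_eq : ∀ p : ℝ[X], p.natDegree ≤ 2 * k →
    refIntegral p - ∑ j, A j * p.eval (s j) = c * p.coeff (2 * k)

/-- The weights of the interpolatory quadrature formula on the nodes with index in `S`. -/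
def weights {k : ℕ} (s : Fin (k + 2) → ℝ) (S : Finset (Fin (k + 2))) (j : Fin (k + 2)) : ℝ :=
  if j ∈ S then refIntegral (Lagrange.basis S s j) else 0

-- Division by the nodal polynomial leaves the interpolant as remainder and a quotient which
-- orthogonality annihilates, as long as its degree is below k. With k nodes (Gauss) this is
-- exactness below degree 2k, with k+1 nodes (Radau) up to degree 2k, so that c = 0 there.
open Polynomial in
lemma exists_isQuadrature {k : ℕ} (hk : 1 ≤ k) {s : Fin (k + 2) → ℝ} (hs : Function.Injective s)
    (S : Finset (Fin (k + 2))) (hS : S.card = k ∨ S.card = k + 1)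
    (horth : ∀ r : ℝ[X], r.degree < k → refIntegral (Lagrange.nodal S s * r) = 0) :
    ∃ c, IsQuadrature s (weights s S) c := by
  have hsum : ∀ p : ℝ[X], ∑ j, weights s S j * p.eval (s j) =
      refIntegral (Lagrange.interpolate S s fun j => p.eval (s j)) := by
    intro p
    rw [Lagrange.interpolate_apply, map_sum]
    simp only [weights, ite_mul, zero_mul, Finset.sum_ite_mem, Finset.univ_inter]
    refine Finset.sum_congr rfl fun j _ => ?_
    rw [← smul_eq_C_mul, map_smul, smul_eq_mul, mul_comm]
  have hexact : ∀ p : ℝ[X], p.natDegree < S.card + k →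
      refIntegral p - ∑ j, weights s S j * p.eval (s j) = 0 := by
    intro p hp
    have hmon : (Lagrange.nodal S s).Monic := Lagrange.nodal_monic
    have hdiv := modByMonic_add_div p (Lagrange.nodal S s)
    have hinterp : (Lagrange.interpolate S s fun j => p.eval (s j)) =
        p %ₘ Lagrange.nodal S s := by
      symm
      apply Lagrange.eq_interpolate_of_eval_eq _ hs.injOn
      · have := degree_modByMonic_lt p hmon
        rwa [Lagrange.degree_nodal] at this
      · intro i hi
        conv_rhs => rw [← hdiv]
        simp [Lagrange.eval_nodal_at_node hi]
    rw [hsum, hinterp]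
    conv_lhs => rw [← hdiv]
    rw [map_add, hdiv]
    have hq : (p /ₘ Lagrange.nodal S s).degree < k := by
      by_cases h0 : p /ₘ Lagrange.nodal S s = 0
      · rw [h0, degree_zero]
        exact WithBot.bot_lt_coe _
      · rw [degree_eq_natDegree h0, natDegree_divByMonic p hmon, Lagrange.natDegree_nodal]
        exact_mod_cast (by omega : p.natDegree - S.card < k)
    rw [horth _ hq]
    ring
  rcases hS with hS | hS
  -- The square of the nodal polynomial is monic of degree 2k and vanishes at the nodes, so its
  -- integral is the error constant; subtracting the right multiple of it from p reduces to the
  -- exact case.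
  · refine ⟨refIntegral (Lagrange.nodal S s * Lagrange.nodal S s), refIntegral_sq_nonneg _, ?_⟩
    intro p hp
    set l := Lagrange.nodal S s
    have hl : (l * l).natDegree = 2 * k := by
      rw [natDegree_mul Lagrange.nodal_ne_zero Lagrange.nodal_ne_zero, Lagrange.natDegree_nodal, hS]
      ring
    have hlc : (l * l).coeff (2 * k) = 1 := by
      rw [← hl]
      exact (Lagrange.nodal_monic.mul Lagrange.nodal_monic)
    have hlow : (p - C (p.coeff (2 * k)) * (l * l)).natDegree < S.card + k := by
      have h1 : (p - C (p.coeff (2 * k)) * (l * l)).natDegree ≤ 2 * k := by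
        simpa using natDegree_sub_le_of_le hp ((natDegree_C_mul_le (p.coeff (2 * k)) _).trans hl.le)
      have h2 : (p - C (p.coeff (2 * k)) * (l * l)).coeff (2 * k) = 0 := by
        simp [hlc]
      rw [hS]
      have : (p - C (p.coeff (2 * k)) * (l * l)).natDegree ≤ 2 * k - 1 := by
        rw [natDegree_le_iff_coeff_eq_zero]
        intro N hN
        rcases eq_or_lt_of_le (show 2 * k ≤ N by omega) with rfl | h
        · exact h2
        · exact coeff_eq_zero_of_natDegree_lt (by omega)
      omega
    have := hexact _ hlow
    have hz : ∑ j, weights s S j * (p - C (p.coeff (2 * k)) * (l * l)).eval (s j) =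
        ∑ j, weights s S j * p.eval (s j) := by
      refine Finset.sum_congr rfl fun j _ => ?_
      by_cases hj : j ∈ S
      · simp [l, Lagrange.eval_nodal_at_node hj]
      · simp [weights, hj]
    rw [hz, map_sub, ← smul_eq_C_mul, map_smul, smul_eq_mul] at this
    linarith
  · refine ⟨0, le_rfl, fun p hp => ?_⟩
    rw [zero_mul]
    exact hexact p (by omega)

-- Transfers orthogonality from a combination of Legendre polynomials, given by its roots, to the
-- monic nodal polynomial.
open Polynomial in
lemma eq_C_mul_nodal {ι : Type*} {s : ι → ℝ} (hs : Function.Injective s) (S : Finset ι)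
    (R : ℝ[X]) (hR : R.natDegree ≤ S.card) (hroot : ∀ j ∈ S, R.IsRoot (s j)) :
    R = C (R.coeff S.card) * Lagrange.nodal S s := by
  apply Polynomial.eq_of_degree_sub_lt_of_eval_index_eq S hs.injOn
  · rw [Polynomial.degree_lt_iff_coeff_zero]
    intro m hm
    rcases eq_or_lt_of_le hm with rfl | h
    · have h1 : (Lagrange.nodal S s).coeff S.card = 1 := by
        have h2 : (Lagrange.nodal S s).natDegree = S.card := Lagrange.natDegree_nodal
        conv_lhs => rw [← h2]
        exact Lagrange.nodal_monic
      simp [h1]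
    · rw [coeff_sub, coeff_C_mul, coeff_eq_zero_of_natDegree_lt (p := R) (by omega),
        coeff_eq_zero_of_natDegree_lt (p := Lagrange.nodal S s) (by rw [Lagrange.natDegree_nodal]; omega)]
      simp
  · intro j hj
    rw [hroot j hj]
    simp [Lagrange.eval_nodal_at_node hj]

open Polynomial in
lemma refIntegral_nodal_mul_eq_zero {ι : Type*} {s : ι → ℝ} (hs : Function.Injective s)
    (S : Finset ι) (R : ℝ[X]) (hR : R.natDegree ≤ S.card) (hR0 : R.coeff S.card ≠ 0)
    (hroot : ∀ j ∈ S, R.IsRoot (s j)) (r : ℝ[X]) (hr : refIntegral (R * r) = 0) :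
    refIntegral (Lagrange.nodal S s * r) = 0 := by
  rw [eq_C_mul_nodal hs S R hR hroot, mul_assoc, ← smul_eq_C_mul, map_smul, smul_eq_mul] at hr
  exact (mul_eq_zero.1 hr).resolve_left hR0

lemma IsGauss.exists_isQuadrature {k : ℕ} (hk : 1 ≤ k) {s : Fin (k + 2) → ℝ} (hs : IsPartition s)
    (hg : IsGauss s) :
    ∃ c, IsQuadrature s (weights s ((Finset.univ.erase 0).erase (Fin.last (k + 1)))) c := by
  have hcard : ((Finset.univ.erase (0 : Fin (k + 2))).erase (Fin.last (k + 1))).card = k := by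
    rw [Finset.card_erase_of_mem (by simp), Finset.card_erase_of_mem (by simp)]
    simp
  refine SpectralVolume.exists_isQuadrature hk hs.strictMono.injective _ (Or.inl hcard)
    fun r hr => ?_
  refine refIntegral_nodal_mul_eq_zero hs.strictMono.injective _ (legendre k) ?_ ?_ ?_ r
    (refIntegral_legendre_mul_eq_zero k r hr)
  · rw [hcard]
    exact natDegree_legendre_le k
  · rw [hcard]
    exact coeff_legendre_ne_zero k
  · intro j hj
    simp only [Finset.mem_erase, Finset.mem_univ, and_true] at hj
    exact hg j hj.2 hj.1

/-- Covers both Radau families: b = -1 with the left end omitted, b = 1 with the right end omitted.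
Orthogonality holds in degree below k only, because of the summand `legendre k`. -/
lemma exists_isQuadrature_of_radau {k : ℕ} (hk : 1 ≤ k) {s : Fin (k + 2) → ℝ} (hs : IsPartition s)
    (o : Fin (k + 2)) (b : ℝ)
    (hr : ∀ j, j ≠ o → (legendre (k + 1) + Polynomial.C b * legendre k).IsRoot (s j)) :
    ∃ c, IsQuadrature s (weights s (Finset.univ.erase o)) c := by
  have hcard : (Finset.univ.erase o).card = k + 1 := by
    rw [Finset.card_erase_of_mem (by simp)]
    simp
  refine exists_isQuadrature hk hs.strictMono.injective _ (Or.inr hcard) fun r hd => ?_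
  refine refIntegral_nodal_mul_eq_zero hs.strictMono.injective _
    (legendre (k + 1) + Polynomial.C b * legendre k) ?_ ?_ ?_ r ?_
  · rw [hcard]
    exact Polynomial.natDegree_add_le_of_degree_le (natDegree_legendre_le _)
      ((Polynomial.natDegree_C_mul_le _ _).trans ((natDegree_legendre_le k).trans (by omega)))
  · rw [hcard, Polynomial.coeff_add, Polynomial.coeff_C_mul,
      Polynomial.coeff_eq_zero_of_natDegree_lt (p := legendre k)
        (lt_of_le_of_lt (natDegree_legendre_le k) (by omega))]
    simpa using coeff_legendre_ne_zero (k + 1)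
  · intro j hj
    exact hr j (Finset.ne_of_mem_erase hj)
  · rw [add_mul, mul_assoc, map_add, ← Polynomial.smul_eq_C_mul, map_smul,
      refIntegral_legendre_mul_eq_zero k r hd,
      refIntegral_legendre_mul_eq_zero (k + 1) r (hd.trans (by exact_mod_cast Nat.lt_succ_self k))]
    simp

lemma IsRightRadau.exists_isQuadrature {k : ℕ} (hk : 1 ≤ k) {s : Fin (k + 2) → ℝ}
    (hs : IsPartition s) (hr : IsRightRadau s) :
    ∃ c, IsQuadrature s (weights s (Finset.univ.erase 0)) c := by
  refine exists_isQuadrature_of_radau hk hs 0 (-1) fun j hj => ?_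
  have := hr j hj
  simpa [sub_eq_add_neg] using this

lemma IsLeftRadau.exists_isQuadrature {k : ℕ} (hk : 1 ≤ k) {s : Fin (k + 2) → ℝ}
    (hs : IsPartition s) (hr : IsLeftRadau s) :
    ∃ c, IsQuadrature s (weights s (Finset.univ.erase (Fin.last (k + 1)))) c := by
  refine exists_isQuadrature_of_radau hk hs _ 1 fun j hj => ?_
  have := hr j hj
  simpa using this

/-! ### The reference element -/

open Polynomial in
lemma refIntegral_mul_self_pos {p : ℝ[X]} (hp : p ≠ 0) : 0 < refIntegral (p * p) := by
  rw [refIntegral_apply]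
  obtain ⟨x, hx, hx0⟩ : ∃ x ∈ Icc (-1 : ℝ) 1, p.eval x ≠ 0 := by
    by_contra! h
    refine hp (Polynomial.eq_zero_of_infinite_isRoot p ?_)
    exact (Icc_infinite (by norm_num : (-1 : ℝ) < 1)).mono fun x hx => h x hx
  refine intervalIntegral.integral_pos (by norm_num) (p * p).continuous.continuousOn ?_ ⟨x, hx, ?_⟩
  · intro y _
    rw [eval_mul]
    exact mul_self_nonneg _
  · rw [eval_mul]
    exact mul_self_pos.2 hx0

/-- `K` bounds the values and the derivatives of polynomials of degree `≤ k` on `[-1, 1]` in terms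
of their `L²` norms. -/
def IsInverseBound (k : ℕ) (K : ℝ) : Prop :=
  1 ≤ K ∧ ∀ p : ℝ[X], p.natDegree ≤ k → ∀ x ∈ Icc (-1 : ℝ) 1,
    p.eval x ^ 2 ≤ K * refIntegral (p * p) ∧
      (Polynomial.derivative p).eval x ^ 2 ≤ K * refIntegral (p * p)

lemma IsInverseBound.mono {k : ℕ} {K K' : ℝ} (h : IsInverseBound k K) (hK : K ≤ K') :
    IsInverseBound k K' :=
  ⟨h.1.trans hK, fun p hp x hx =>
    ⟨((h.2 p hp x hx).1).trans (mul_le_mul_of_nonneg_right hK (refIntegral_sq_nonneg p)),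
      ((h.2 p hp x hx).2).trans (mul_le_mul_of_nonneg_right hK (refIntegral_sq_nonneg p))⟩⟩

-- The squared L² norm is a positive definite quadratic form in the coefficients, hence bounded
-- below on their unit sphere by compactness, while values and derivatives on [-1, 1] are bounded by
-- the coefficients.
open Polynomial in
lemma exists_isInverseBound (k : ℕ) : ∃ K, IsInverseBound k K := by
  let P : (Fin (k + 1) → ℝ) → ℝ[X] := fun c => ∑ i, C (c i) * X ^ (i : ℕ)
  have hcoeff : ∀ c (i : Fin (k + 1)), (P c).coeff i = c i := by
    intro c i
    simp only [P, finsetSum_coeff, coeff_C_mul, coeff_X_pow]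
    rw [Finset.sum_eq_single i]
    · simp
    · intro b _ hb
      rw [if_neg (fun h => hb (Fin.ext h.symm)), mul_zero]
    · simp
  let f : (Fin (k + 1) → ℝ) → ℝ := fun c => refIntegral (P c * P c)
  have hf : f = fun c => ∑ i : Fin (k + 1), ∑ j : Fin (k + 1),
      c i * c j * refIntegral (X ^ (i : ℕ) * X ^ (j : ℕ)) := by
    funext c
    simp only [f, P, Finset.sum_mul_sum, map_sum]
    refine Finset.sum_congr rfl fun i _ => Finset.sum_congr rfl fun j _ => ?_
    rw [show C (c i) * X ^ (i : ℕ) * (C (c j) * X ^ (j : ℕ)) =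
      (c i * c j) • (X ^ (i : ℕ) * X ^ (j : ℕ)) by rw [smul_eq_C_mul, C_mul]; ring, map_smul,
      smul_eq_mul]
  have hcont : Continuous f := by
    rw [hf]
    fun_prop
  have hne : (Metric.sphere (0 : Fin (k + 1) → ℝ) 1).Nonempty :=
    NormedSpace.sphere_nonempty.2 zero_le_one
  obtain ⟨c₀, hc₀, hmin⟩ := (isCompact_sphere (0 : Fin (k + 1) → ℝ) 1).exists_isMinOn hne
    hcont.continuousOn
  have hpos : 0 < f c₀ := by
    apply refIntegral_mul_self_pos
    intro h0
    have : c₀ = 0 := by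
      funext i
      rw [← hcoeff c₀ i, h0]
      simp
    rw [this] at hc₀
    simp at hc₀
  have hbound : ∀ c, f c₀ * ‖c‖ ^ 2 ≤ f c := by
    intro c
    by_cases h0 : c = 0
    · subst h0
      simp only [norm_zero]
      have := refIntegral_sq_nonneg (P 0)
      simpa using this
    · have hn : ‖c‖ ≠ 0 := norm_ne_zero_iff.2 h0
      have h1 : f c₀ ≤ f (‖c‖⁻¹ • c) := hmin (by
        rw [mem_sphere_zero_iff_norm, norm_smul, norm_inv, norm_norm, inv_mul_cancel₀ hn])
      have h2 : f (‖c‖⁻¹ • c) = (‖c‖ ^ 2)⁻¹ * f c := by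
        rw [hf]
        simp only [Pi.smul_apply, smul_eq_mul, Finset.mul_sum]
        refine Finset.sum_congr rfl fun i _ => Finset.sum_congr rfl fun j _ => ?_
        field_simp
      rw [h2] at h1
      have h3 : 0 < ‖c‖ ^ 2 := by positivity
      calc f c₀ * ‖c‖ ^ 2 ≤ (‖c‖ ^ 2)⁻¹ * f c * ‖c‖ ^ 2 :=
            mul_le_mul_of_nonneg_right h1 h3.le
        _ = f c := by field_simp
  -- The power 4 comes from squaring the bound (k+1)² ‖c‖ for the derivative, which also covers the
  -- values.
  refine ⟨max 1 ((k + 1 : ℝ) ^ 4 / f c₀), le_max_left _ _, fun p hp x hx => ?_⟩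
  set c : Fin (k + 1) → ℝ := fun i => p.coeff i
  have hpP : p = P c := by
    simp only [P, c]
    rw [Fin.sum_univ_eq_sum_range (fun i => C (p.coeff i) * X ^ i) (k + 1)]
    exact p.as_sum_range_C_mul_X_pow' (by omega)
  have hx1 : |x| ≤ 1 := abs_le.2 hx
  have hk1 : (1 : ℝ) ≤ k + 1 := by
    have : (0 : ℝ) ≤ k := Nat.cast_nonneg k
    linarith
  have hv : |p.eval x| ≤ (k + 1) * ‖c‖ := by
    rw [hpP]
    simp only [P, eval_finsetSum, eval_mul, eval_C, eval_pow, eval_X]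
    refine (Finset.abs_sum_le_sum_abs _ _).trans ?_
    refine (Finset.sum_le_card_nsmul _ _ ‖c‖ fun i _ => ?_).trans (by simp)
    rw [abs_mul, abs_pow]
    calc |c i| * |x| ^ (i : ℕ) ≤ ‖c‖ * 1 :=
          mul_le_mul (norm_le_pi_norm c i) (pow_le_one₀ (abs_nonneg _) hx1) (by positivity)
            (norm_nonneg _)
      _ = ‖c‖ := mul_one _
  have hd : |(derivative p).eval x| ≤ (k + 1) ^ 2 * ‖c‖ := by
    rw [hpP]
    simp only [P, derivative_sum, derivative_C_mul, derivative_X_pow, eval_finsetSum, eval_mul,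
      eval_C, eval_pow, eval_X]
    refine (Finset.abs_sum_le_sum_abs _ _).trans ?_
    refine (Finset.sum_le_card_nsmul _ _ ((k + 1) * ‖c‖) fun i _ => ?_).trans ?_
    · rw [abs_mul, abs_mul, abs_pow, Nat.abs_cast]
      have hi : ((i : ℕ) : ℝ) ≤ k + 1 := by
        exact_mod_cast i.2.le
      calc |c i| * (((i : ℕ) : ℝ) * |x| ^ ((i : ℕ) - 1)) ≤ ‖c‖ * ((k + 1) * 1) := by
            refine mul_le_mul (norm_le_pi_norm c i) ?_ (by positivity) (norm_nonneg _)
            exact mul_le_mul hi (pow_le_one₀ (abs_nonneg _) hx1) (by positivity) (by positivity)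
        _ = (k + 1) * ‖c‖ := by ring
    · simp only [Finset.card_univ, Fintype.card_fin, nsmul_eq_mul, Nat.cast_add, Nat.cast_one]
      exact le_of_eq (by ring)
  have hmain : ((k + 1) ^ 2 * ‖c‖) ^ 2 ≤ max 1 ((k + 1 : ℝ) ^ 4 / f c₀) * refIntegral (p * p) := by
    have h1 : ‖c‖ ^ 2 ≤ refIntegral (p * p) / f c₀ := by
      rw [le_div_iff₀ hpos, mul_comm]
      have := hbound c
      simp only [f] at this
      rwa [← hpP] at this
    calc ((k + 1) ^ 2 * ‖c‖) ^ 2 = (k + 1) ^ 4 * ‖c‖ ^ 2 := by ring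
      _ ≤ (k + 1) ^ 4 * (refIntegral (p * p) / f c₀) := by gcongr
      _ = (k + 1) ^ 4 / f c₀ * refIntegral (p * p) := by ring
      _ ≤ _ := mul_le_mul_of_nonneg_right (le_max_right _ _) (refIntegral_sq_nonneg p)
  have hv' : |p.eval x| ≤ (k + 1) ^ 2 * ‖c‖ := hv.trans (by
    refine mul_le_mul_of_nonneg_right ?_ (norm_nonneg _)
    nlinarith)
  exact ⟨(sq_le_sq' (abs_le.1 hv').1 (abs_le.1 hv').2).trans hmain,
    (sq_le_sq' (abs_le.1 hd).1 (abs_le.1 hd).2).trans hmain⟩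

/-! ### Step functions as test functions, and the induced inner product -/

/-- Summation by parts against a step function with prescribed jumps. -/
lemma exists_summation_by_parts (n : ℕ) (D : Fin (n + 1) → ℝ) (v₀ : ℝ) :
    ∃ V : Fin n → ℝ,
      (∀ F : Fin (n + 1) → ℝ, ∑ j, V j * (F j.succ - F j.castSucc) =
        (v₀ + ∑ j, D j) * F (Fin.last n) - v₀ * F 0 - ∑ j, D j * F j) ∧
      ∀ j, |V j| ≤ |v₀| + ∑ j, |D j| := by
  induction n with
  | zero =>
    refine ⟨fun _ => 0, fun F => ?_, fun j => j.elim0⟩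
    simp
    ring
  | succ n ih =>
    obtain ⟨V, hV, hb⟩ := ih fun j => D j.castSucc
    -- V_j = v₀ + D_0 + ... + D_j: the jump at the first node is taken before V_0, the one at the
    -- last node after the final value.
    refine ⟨Fin.snoc V (v₀ + ∑ j : Fin (n + 1), D j.castSucc), fun F => ?_, fun j => ?_⟩
    · have h1 := hV fun j => F j.castSucc
      rw [Fin.sum_univ_castSucc]
      simp only [Fin.snoc_castSucc, Fin.snoc_last, Fin.succ_last]
      simp only [Fin.castSucc_zero] at h1
      have h2 : ∑ j : Fin n, V j * (F j.castSucc.succ - F j.castSucc.castSucc) =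
          ∑ j : Fin n, V j * (F j.succ.castSucc - F j.castSucc.castSucc) := by
        simp only [Fin.succ_castSucc]
      rw [h2, h1, Fin.sum_univ_castSucc (f := D), Fin.sum_univ_castSucc (f := fun j => D j * F j)]
      ring
    · have hsum := Fin.sum_univ_castSucc (fun j => |D j|)
      refine Fin.lastCases ?_ (fun j => ?_) j
      · rw [Fin.snoc_last, hsum]
        have h1 := abs_add_le v₀ (∑ j : Fin (n + 1), D j.castSucc)
        have h2 := Finset.abs_sum_le_sum_abs (fun j : Fin (n + 1) => D j.castSucc) Finset.univ
        have h3 := abs_nonneg (D (Fin.last (n + 1)))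
        linarith
      · rw [Fin.snoc_castSucc, hsum]
        have h3 := abs_nonneg (D (Fin.last (n + 1)))
        linarith [hb j]

-- The top coefficient is recorded because it determines the quadrature error of v' W in degree 2k.
open Polynomial in
lemma exists_antiderivative (k : ℕ) (w : ℝ[X]) (hw : w.natDegree ≤ k) :
    ∃ W : ℝ[X], derivative W = w ∧ W.natDegree ≤ k + 1 ∧
      W.coeff (k + 1) = w.coeff k / (k + 1) := by
  refine ⟨∑ n ∈ Finset.range (k + 1), monomial (n + 1) (w.coeff n / (n + 1)), ?_, ?_, ?_⟩
  · rw [derivative_sum]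
    conv_rhs => rw [w.as_sum_range' (k + 1) (by omega)]
    refine Finset.sum_congr rfl fun n _ => ?_
    rw [derivative_monomial]
    have : ((n : ℝ) + 1) ≠ 0 := by positivity
    simp [this]
  · refine natDegree_sum_le_of_forall_le _ _ fun n hn => ?_
    refine (natDegree_monomial_le _).trans ?_
    have := Finset.mem_range.1 hn
    omega
  · rw [finsetSum_coeff, Finset.sum_eq_single k]
    · rw [coeff_monomial, if_pos rfl]
    · intro b _ hb
      rw [coeff_monomial, if_neg (by omega)]
    · simp

/-- The inner product on polynomials of degree `≤ k` that is induced by the control volumes. -/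
def refMass (k : ℕ) (c : ℝ) (w v : ℝ[X]) : ℝ :=
  refIntegral (w * v) + c * (k / (k + 1)) * w.coeff k * v.coeff k

lemma refMass_comm (k : ℕ) (c : ℝ) (w v : ℝ[X]) : refMass k c w v = refMass k c v w := by
  rw [refMass, refMass, mul_comm w v]
  ring

/-- Coercivity of the induced inner product; this is where the sign of the quadrature error matters.
-/
lemma refIntegral_le_refMass (k : ℕ) {c : ℝ} (hc : 0 ≤ c) (v : ℝ[X]) :
    refIntegral (v * v) ≤ refMass k c v v := by
  rw [refMass]
  have h1 : 0 ≤ c * (k / (k + 1) : ℝ) := by positivity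
  have h2 := mul_nonneg h1 (mul_self_nonneg (v.coeff k))
  linarith

namespace IsQuadrature

variable {k : ℕ} {s A : Fin (k + 2) → ℝ} {c : ℝ}

open Polynomial

lemma sum_eq (hq : IsQuadrature s A c) {p : ℝ[X]} (hp : p.natDegree < 2 * k) :
    ∑ j, A j * p.eval (s j) = refIntegral p := by
  have := hq.error_eq p hp.le
  rw [coeff_eq_zero_of_natDegree_lt hp] at this
  linarith

/-- The step function that starts from v(-1) with jumps A_j v'(s_j) ends at v(1), as v is continuous
from end to end. -/
lemma sum_weight_mul_derivative (hq : IsQuadrature s A c) (hk : 1 ≤ k) {v : ℝ[X]}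
    (hv : v.natDegree ≤ k) :
    v.eval (-1) + ∑ j, A j * (derivative v).eval (s j) = v.eval 1 := by
  have := natDegree_derivative_le v
  rw [hq.sum_eq (by omega), refIntegral_derivative]
  ring

/-- The degree of v' v is at most 2k - 1, so both quadratures are exact on it. For constant velocity
this makes the inner flux terms telescope. -/
lemma sum_weight_mul_derivative_mul_self (hq : IsQuadrature s A c) (hk : 1 ≤ k) {v : ℝ[X]}
    (hv : v.natDegree ≤ k) :
    ∑ j, A j * (derivative v).eval (s j) * v.eval (s j) =
      (v.eval 1 ^ 2 - v.eval (-1) ^ 2) / 2 := by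
  have h1 := natDegree_derivative_le v
  have h2 : (derivative v * v).natDegree < 2 * k := by
    refine lt_of_le_of_lt natDegree_mul_le ?_
    omega
  have h3 := hq.sum_eq h2
  simp only [eval_mul, ← mul_assoc] at h3
  rw [h3]
  have h4 := refIntegral_derivative (v * v)
  rw [derivative_mul, map_add, mul_comm v, eval_mul, eval_mul] at h4
  linarith

/-- With W a primitive of w, summation by parts gives the boundary terms of v W minus the quadrature
of v' W. That product has degree at most 2k, so replacing the quadrature by ∫ v' W costs exactly one
term, symmetric in w and v, and integration by parts gives ∫ w v. -/
lemma sum_integral_eq_refMass (hq : IsQuadrature s A c) (hk : 1 ≤ k) (hs : IsPartition s)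
    {w v : ℝ[X]} (hw : w.natDegree ≤ k) (hv : v.natDegree ≤ k) {V : Fin (k + 1) → ℝ}
    (hV : ∀ F : Fin (k + 2) → ℝ, ∑ j, V j * (F j.succ - F j.castSucc) =
      v.eval 1 * F (Fin.last (k + 1)) - v.eval (-1) * F 0 -
        ∑ j, A j * (derivative v).eval (s j) * F j) :
    ∑ j, V j * ∫ x in s j.castSucc..s j.succ, w.eval x = refMass k c w v := by
  obtain ⟨W, hW, hWd, hWc⟩ := exists_antiderivative k w hw
  have h1 := hV fun j => W.eval (s j)
  have h2 : ∀ j : Fin (k + 1), ∫ x in s j.castSucc..s j.succ, w.eval x =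
      W.eval (s j.succ) - W.eval (s j.castSucc) := by
    intro j
    rw [← hW, integral_eval_derivative]
  simp only [h2]
  rw [h1, hs.first, hs.last]
  have hvd := natDegree_derivative_le v
  have hdeg : (derivative v * W).natDegree ≤ 2 * k := natDegree_mul_le.trans (by omega)
  have h3 := hq.error_eq _ hdeg
  simp only [eval_mul, ← mul_assoc] at h3
  -- Product of the top coefficients: k v_k in degree k - 1 and w_k / (k+1) in degree k + 1.
  have hco : (derivative v * W).coeff (2 * k) = v.coeff k * k * (w.coeff k / (k + 1)) := by
    rw [show 2 * k = (k - 1) + (k + 1) by omega,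
      coeff_mul_add_eq_of_natDegree_le (by omega) hWd, hWc, coeff_derivative,
      Nat.sub_add_cancel hk]
    congr 2
    rw [Nat.cast_sub hk]
    ring
  have h4 := refIntegral_derivative (v * W)
  rw [derivative_mul, map_add, hW, eval_mul, eval_mul] at h4
  rw [hco] at h3
  rw [refMass, mul_comm w v]
  have h5 : c * (v.coeff k * k * (w.coeff k / (k + 1))) =
      c * (k / (k + 1)) * w.coeff k * v.coeff k := by ring
  linarith

end IsQuadrature

lemma abs_mul_le_of_sq_le {a b c : ℝ} (ha : a ^ 2 ≤ c) (hb : b ^ 2 ≤ c) : |a * b| ≤ c := by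
  rw [abs_le]
  constructor <;> nlinarith [sq_nonneg (a + b), sq_nonneg (a - b)]

lemma IsPartition.mem_Icc {k : ℕ} {s : Fin (k + 2) → ℝ} (hs : IsPartition s) (j : Fin (k + 2)) :
    s j ∈ Icc (-1 : ℝ) 1 := by
  rw [← hs.first, ← hs.last]
  exact ⟨hs.strictMono.monotone (Fin.zero_le _), hs.strictMono.monotone (Fin.le_last _)⟩

namespace IsQuadrature

variable {k : ℕ} {s A : Fin (k + 2) → ℝ} {c : ℝ}

open Polynomial

/-- Stability of the upwind flux on one element. -/
lemma flux_lower_bound (hq : IsQuadrature s A c) (hk : 1 ≤ k) (hs : IsPartition s) {K : ℝ}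
    (hK : IsInverseBound k K) (hA : ∀ j, |A j| ≤ K) {v : ℝ[X]} (hv : v.natDegree ≤ k)
    (a : Fin (k + 2) → ℝ) (uL uR l : ℝ) (hl : ∀ i j, |a i - a j| ≤ l)
    (h0 : A 0 = 0 ∨ a 0 * (uL - v.eval (-1)) = 0 ∨ |a 0| ≤ l)
    (h1 : A (Fin.last (k + 1)) = 0 ∨ a (Fin.last (k + 1)) * (uR - v.eval 1) = 0 ∨
      |a (Fin.last (k + 1))| ≤ l)
    (F : Fin (k + 2) → ℝ)
    (hF : ∀ j, F j = a j * if j = 0 then uL else if j = Fin.last (k + 1) then uR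
      else v.eval (s j)) :
    a (Fin.last (k + 1)) * (uR * v.eval 1 - v.eval 1 ^ 2 / 2) -
        a 0 * (uL * v.eval (-1) - v.eval (-1) ^ 2 / 2) -
        (k + 7) * K ^ 2 * l * (refIntegral (v * v) + uL ^ 2 + uR ^ 2) ≤
      v.eval 1 * F (Fin.last (k + 1)) - v.eval (-1) * F 0 -
        ∑ j, A j * (derivative v).eval (s j) * F j := by
  set z := Fin.last (k + 1)
  set D : Fin (k + 2) → ℝ := fun j => A j * (derivative v).eval (s j) with hD
  set n := refIntegral (v * v)
  have hn : 0 ≤ n := refIntegral_sq_nonneg v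
  have hz0 : z ≠ 0 := Fin.last_pos.ne'
  have hl0 : 0 ≤ l := (abs_nonneg _).trans (hl 0 0)
  have hK1 := hK.1
  have hs0 : s 0 = -1 := hs.first
  have hsz : s z = 1 := hs.last
  have hF0 : F 0 = a 0 * uL := by rw [hF, if_pos rfl]
  have hFz : F z = a z * uR := by rw [hF, if_neg hz0, if_pos rfl]
  -- The end fluxes carry the upwind traces `uL`, `uR` in place of v(-1), v(1); the two differences
  -- are split off and are controlled by the hypotheses `h0`, `h1`.
  have hsplit : ∑ j, D j * F j = ∑ j, D j * (a j * v.eval (s j)) +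
      D 0 * (a 0 * (uL - v.eval (-1))) + D z * (a z * (uR - v.eval 1)) := by
    have : ∀ j, D j * F j = D j * (a j * v.eval (s j)) +
        (if j = 0 then D 0 * (a 0 * (uL - v.eval (-1))) else 0) +
        (if j = z then D z * (a z * (uR - v.eval 1)) else 0) := by
      intro j
      by_cases hj0 : j = 0
      · subst hj0
        rw [if_pos rfl, if_neg hz0.symm, hF0, hs0]
        ring
      · by_cases hjz : j = z
        · rw [hjz, if_pos rfl, if_neg hz0, hFz, hsz]
          ring
        · rw [hF, if_neg hj0, if_neg hjz, if_neg hj0, if_neg hjz]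
          ring
    simp only [this, Finset.sum_add_distrib, Finset.sum_ite_eq', Finset.mem_univ, if_true]
  -- The velocity is frozen at the left end of the element, where the exact identity applies; the
  -- remainder carries a_j - a_0.
  have hmain : ∑ j, D j * (a j * v.eval (s j)) =
      a 0 * ((v.eval 1 ^ 2 - v.eval (-1) ^ 2) / 2) +
        ∑ j, D j * ((a j - a 0) * v.eval (s j)) := by
    rw [← hq.sum_weight_mul_derivative_mul_self hk hv, Finset.mul_sum, ← Finset.sum_add_distrib]
    refine Finset.sum_congr rfl fun j _ => ?_
    simp only [hD]
    ring
  have hbv : ∀ x ∈ Icc (-1 : ℝ) 1, v.eval x ^ 2 ≤ K * n := fun x hx => (hK.2 v hv x hx).1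
  have hbd : ∀ x ∈ Icc (-1 : ℝ) 1, (derivative v).eval x ^ 2 ≤ K * n :=
    fun x hx => (hK.2 v hv x hx).2
  have m0 : (-1 : ℝ) ∈ Icc (-1 : ℝ) 1 := by norm_num
  have m1 : (1 : ℝ) ∈ Icc (-1 : ℝ) 1 := by norm_num
  have herr : |∑ j, D j * ((a j - a 0) * v.eval (s j))| ≤ (k + 2) * (K ^ 2 * l * n) := by
    refine (Finset.abs_sum_le_sum_abs _ _).trans ?_
    refine (Finset.sum_le_card_nsmul _ _ (K ^ 2 * l * n) fun j _ => ?_).trans (by simp)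
    have e1 : |(derivative v).eval (s j) * v.eval (s j)| ≤ K * n :=
      abs_mul_le_of_sq_le (hbd _ (hs.mem_Icc j)) (hbv _ (hs.mem_Icc j))
    calc |D j * ((a j - a 0) * v.eval (s j))|
        = |A j| * |a j - a 0| * |(derivative v).eval (s j) * v.eval (s j)| := by
          rw [← abs_mul, ← abs_mul]
          congr 1
          simp only [hD]
          ring
      _ ≤ K * l * (K * n) := by
          refine mul_le_mul (mul_le_mul (hA j) (hl j 0) (abs_nonneg _) (by linarith)) e1
            (abs_nonneg _) (by positivity)
      _ = K ^ 2 * l * n := by ring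
  have hend : ∀ (j : Fin (k + 2)) (u w : ℝ), w ^ 2 ≤ K * n →
      (A j = 0 ∨ a j * (u - w) = 0 ∨ |a j| ≤ l) →
      |D j * (a j * (u - w))| ≤ K ^ 2 * l * (2 * n + u ^ 2) := by
    intro j u w hw h
    have hr : 0 ≤ K ^ 2 * l * (2 * n + u ^ 2) := by positivity
    rcases h with h | h | h
    · simp [hD, h, hr]
    · simp [h, hr]
    · have e1 : |(derivative v).eval (s j) * (u - w)| ≤ K * (2 * n + u ^ 2) := by
        have e2 := hbd _ (hs.mem_Icc j)
        have e3 : u ^ 2 ≤ K * u ^ 2 := by nlinarith [sq_nonneg u]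
        rw [abs_le]
        constructor <;>
          nlinarith [sq_nonneg ((derivative v).eval (s j) + (u - w)),
            sq_nonneg ((derivative v).eval (s j) - (u - w)), sq_nonneg (u + w)]
      calc |D j * (a j * (u - w))| = |A j| * |a j| * |(derivative v).eval (s j) * (u - w)| := by
            rw [← abs_mul, ← abs_mul]
            congr 1
            simp only [hD]
            ring
        _ ≤ K * l * (K * (2 * n + u ^ 2)) := by
            refine mul_le_mul (mul_le_mul (hA j) h (abs_nonneg _) (by linarith)) e1
              (abs_nonneg _) (by positivity)
        _ = K ^ 2 * l * (2 * n + u ^ 2) := by ring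
  have he0 := hend 0 uL _ (hbv _ m0) h0
  have hez := hend z uR _ (hbv _ m1) h1
  have hlast : |(a z - a 0) * (v.eval 1 ^ 2 / 2)| ≤ K ^ 2 * l * n := by
    rw [abs_mul, abs_of_nonneg (by positivity : 0 ≤ v.eval 1 ^ 2 / 2)]
    calc |a z - a 0| * (v.eval 1 ^ 2 / 2) ≤ l * (K * n) :=
          mul_le_mul (hl z 0) (by nlinarith [hbv _ m1, sq_nonneg (v.eval 1)]) (by positivity) hl0
      _ ≤ K ^ 2 * l * n := by
          have : 0 ≤ l * n * K * (K - 1) :=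
            mul_nonneg (by positivity) (by linarith)
          nlinarith
  -- The constant k + 7 adds up as k + 2 from freezing the velocity at each node, 2 from each end,
  -- and 1 from replacing a_0 by the velocity at the right end in the term v(1)²/2.
  rw [hF0, hFz, hsplit, hmain]
  have hpos : 0 ≤ K ^ 2 * l * (uL ^ 2 + uR ^ 2) := by positivity
  have hkk : 0 ≤ (k : ℝ) := Nat.cast_nonneg k
  have hpos2 := mul_nonneg hkk hpos
  have b1 := (abs_le.1 herr).2
  have b2 := (abs_le.1 he0).2
  have b3 := (abs_le.1 hez).2
  have b4 := (abs_le.1 hlast).1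
  nlinarith [b1, b2, b3, b4, hpos, hpos2]

/-- The energy estimate for one element. -/
lemma energy_le (hq : IsQuadrature s A c) (hk : 1 ≤ k) (hs : IsPartition s) {K : ℝ}
    (hK : IsInverseBound k K) (hA : ∀ j, |A j| ≤ K) {v w : ℝ[X]} (hv : v.natDegree ≤ k)
    (hw : w.natDegree ≤ k) (a : Fin (k + 2) → ℝ) (uL uR l : ℝ) (hl : ∀ i j, |a i - a j| ≤ l)
    (h0 : A 0 = 0 ∨ a 0 * (uL - v.eval (-1)) = 0 ∨ |a 0| ≤ l)
    (h1 : A (Fin.last (k + 1)) = 0 ∨ a (Fin.last (k + 1)) * (uR - v.eval 1) = 0 ∨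
      |a (Fin.last (k + 1))| ≤ l)
    (F : Fin (k + 2) → ℝ)
    (hF : ∀ j, F j = a j * if j = 0 then uL else if j = Fin.last (k + 1) then uR
      else v.eval (s j)) {h R : ℝ} (hh : 0 ≤ h) (r : Fin (k + 1) → ℝ) (hr : ∀ j, |r j| ≤ h * R)
    (heq : ∀ j : Fin (k + 1), h / 2 * (∫ x in s j.castSucc..s j.succ, w.eval x) +
      F j.succ - F j.castSucc = r j) :
    h / 2 * refMass k c w v ≤
      a 0 * (uL * v.eval (-1) - v.eval (-1) ^ 2 / 2) -
        a (Fin.last (k + 1)) * (uR * v.eval 1 - v.eval 1 ^ 2 / 2) +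
        (k + 7) * K ^ 2 * l * (refIntegral (v * v) + uL ^ 2 + uR ^ 2) +
        (k + 1) * (1 + (k + 2) * K) ^ 2 * K * h * (refIntegral (v * v) + R ^ 2) := by
  have hstab := hq.flux_lower_bound hk hs hK hA hv a uL uR l hl h0 h1 F hF
  obtain ⟨V, hV, hVb⟩ := exists_summation_by_parts (k + 1)
    (fun j => A j * (derivative v).eval (s j)) (v.eval (-1))
  simp only [hq.sum_weight_mul_derivative hk hv] at hV
  have hmass := hq.sum_integral_eq_refMass hk hs hw hv hV
  rw [← hV F] at hstab
  set n := refIntegral (v * v)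
  have hn : 0 ≤ n := refIntegral_sq_nonneg v
  have hK1 := hK.1
  set B := (1 + (k + 2) * K) ^ 2 * K with hB
  have hB1 : 1 ≤ B := by
    have e1 : 1 ≤ 1 + (k + 2) * K := by
      have : 0 ≤ (k + 2) * K := by positivity
      linarith
    have e2 : 1 ≤ (1 + (k + 2) * K) ^ 2 := one_le_pow₀ e1
    calc (1 : ℝ) = 1 * 1 := by ring
      _ ≤ _ := mul_le_mul e2 hK1 zero_le_one (by positivity)
  -- Each V_j is v(-1) plus at most k + 2 jumps A_j v'(s_j), and values and derivatives of v are at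
  -- most √(K n).
  have hVsq : ∀ j, V j ^ 2 ≤ B * n := by
    intro j
    set q := Real.sqrt (K * n)
    have hq0 : 0 ≤ q := Real.sqrt_nonneg _
    have hqq : q ^ 2 = K * n := Real.sq_sqrt (by positivity)
    have e1 : |v.eval (-1)| ≤ q := Real.abs_le_sqrt (hK.2 v hv _ (by norm_num)).1
    have e2 : ∑ j, |A j * (derivative v).eval (s j)| ≤ (k + 2) * (K * q) := by
      refine (Finset.sum_le_card_nsmul _ _ (K * q) fun j _ => ?_).trans (by simp)
      rw [abs_mul]
      exact mul_le_mul (hA j) (Real.abs_le_sqrt (hK.2 v hv _ (hs.mem_Icc j)).2) (abs_nonneg _)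
        (by linarith)
    have e3 : |V j| ≤ (1 + (k + 2) * K) * q := by
      have := hVb j
      nlinarith
    calc V j ^ 2 = |V j| ^ 2 := (sq_abs _).symm
      _ ≤ ((1 + (k + 2) * K) * q) ^ 2 := pow_le_pow_left₀ (abs_nonneg _) e3 2
      _ = B * n := by
        rw [mul_pow, hqq, hB]
        ring
  have hsum : ∑ j, V j * r j ≤ (k + 1) * (h * (B * (n + R ^ 2))) := by
    refine (Finset.sum_le_card_nsmul _ _ (h * (B * (n + R ^ 2))) fun j _ => ?_).trans (by simp)
    have e1 : V j * r j ≤ |V j| * (h * R) :=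
      (le_abs_self _).trans (by
        rw [abs_mul]
        exact mul_le_mul_of_nonneg_left (hr j) (abs_nonneg _))
    have e2 : |V j| * R ≤ B * (n + R ^ 2) := by
      have := hVsq j
      rw [← sq_abs] at this
      nlinarith [sq_nonneg (|V j| - R), sq_nonneg R]
    nlinarith
  -- The conservation law of each control volume, multiplied by V_j and summed over the element.
  have htot : h / 2 * refMass k c w v + ∑ j, V j * (F j.succ - F j.castSucc) = ∑ j, V j * r j := by
    rw [← hmass, Finset.mul_sum, ← Finset.sum_add_distrib]
    refine Finset.sum_congr rfl fun j _ => ?_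
    rw [← heq j]
    ring
  have : (k + 1) * (1 + (k + 2) * K) ^ 2 * K * h * (n + R ^ 2) =
      (k + 1) * (h * (B * (n + R ^ 2))) := by
    rw [hB]
    ring
  linarith

end IsQuadrature

/-! ### Constants uniform over the reference partitions -/

/-- The reference partitions that occur in the two methods. -/
def IsReference {k : ℕ} (s : Fin (k + 2) → ℝ) : Prop :=
  IsPartition s ∧ (IsGauss s ∨ IsRightRadau s ∨ IsLeftRadau s)

lemma legendre_succ_add_C_mul_ne_zero (k : ℕ) (b : ℝ) :
    legendre (k + 1) + Polynomial.C b * legendre k ≠ 0 := by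
  intro h
  have h1 : (legendre (k + 1) + Polynomial.C b * legendre k).coeff (k + 1) = 0 := by
    rw [h]
    simp
  rw [Polynomial.coeff_add, Polynomial.coeff_C_mul,
    Polynomial.coeff_eq_zero_of_natDegree_lt (p := legendre k)
      (lt_of_le_of_lt (natDegree_legendre_le k) (by omega)), mul_zero, add_zero] at h1
  exact coeff_legendre_ne_zero (k + 1) h1

/-- Every node is ±1 or a root of one of three fixed nonzero polynomials. Finiteness makes all
constants of the reference element depend on k alone, although the partition may change between
elements. -/
lemma finite_setOf_isReference (k : ℕ) :
    {s : Fin (k + 2) → ℝ | IsReference s}.Finite := by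
  have e0 : legendre k ≠ 0 := fun h => coeff_legendre_ne_zero k (by rw [h]; simp)
  have e1 : legendre (k + 1) - legendre k ≠ 0 := by
    simpa [sub_eq_add_neg] using legendre_succ_add_C_mul_ne_zero k (-1)
  have e2 : legendre (k + 1) + legendre k ≠ 0 := by
    simpa using legendre_succ_add_C_mul_ne_zero k 1
  have hfin : ({-1, 1} ∪ {x | (legendre k).IsRoot x} ∪
      {x | (legendre (k + 1) - legendre k).IsRoot x} ∪
      {x | (legendre (k + 1) + legendre k).IsRoot x}).Finite := by
    refine ((Set.Finite.union (Set.toFinite _) ?_).union ?_).union ?_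
    · exact Polynomial.finite_setOfPred_isRoot e0
    · exact Polynomial.finite_setOfPred_isRoot e1
    · exact Polynomial.finite_setOfPred_isRoot e2
  refine (Set.Finite.pi' fun _ : Fin (k + 2) => hfin).subset ?_
  rintro s ⟨hs, h⟩ j
  by_cases h0 : j = 0
  · subst h0
    simp [hs.first]
  by_cases h1 : j = Fin.last (k + 1)
  · subst h1
    simp [hs.last]
  rcases h with h | h | h
  · exact Or.inl (Or.inl (Or.inr (h j h0 h1)))
  · exact Or.inl (Or.inr (h j h0))
  · exact Or.inr (h j h1)

lemma exists_forall_isReference_le {k : ℕ} {ι : Type*} [Finite ι] (f : (Fin (k + 2) → ℝ) → ι → ℝ) :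
    ∃ K, ∀ s, IsReference s → ∀ i, f s i ≤ K := by
  have hfin : (⋃ i, (fun s => f s i) '' {s : Fin (k + 2) → ℝ | IsReference s}).Finite :=
    Set.finite_iUnion fun i => (finite_setOf_isReference k).image _
  obtain ⟨K, hK⟩ := hfin.bddAbove
  exact ⟨K, fun s hs i => hK (mem_iUnion.2 ⟨i, s, hs, rfl⟩)⟩

open Polynomial in
lemma abs_eval_le_sum_abs_coeff (p : ℝ[X]) {x : ℝ} (hx : x ∈ Icc (-1 : ℝ) 1) :
    |p.eval x| ≤ ∑ n ∈ Finset.range (p.natDegree + 1), |p.coeff n| := by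
  rw [eval_eq_sum_range]
  refine (Finset.abs_sum_le_sum_abs _ _).trans (Finset.sum_le_sum fun n _ => ?_)
  rw [abs_mul, abs_pow]
  exact mul_le_of_le_one_right (abs_nonneg _) (pow_le_one₀ (abs_nonneg _) (abs_le.2 hx))

/-- `K` bounds the constants of the reference element: inverse inequality, quadrature weights, and
interpolation operators. -/
structure IsReferenceBound (k : ℕ) (K : ℝ) : Prop where
  inverse : IsInverseBound k K
  weights_le : ∀ s : Fin (k + 2) → ℝ, IsReference s → ∀ S j, |weights s S j| ≤ K
  interpolate_le : ∀ s : Fin (k + 2) → ℝ, IsReference s → ∀ o, ∀ (d : Fin (k + 2) → ℝ) (B : ℝ),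
    0 ≤ B → (∀ j, j ≠ o → |d j| ≤ B) → ∀ x ∈ Icc (-1 : ℝ) 1,
      |(Lagrange.interpolate (Finset.univ.erase o) s d).eval x| ≤ K * B

open Polynomial in
lemma exists_isReferenceBound (k : ℕ) : ∃ K, IsReferenceBound k K := by
  obtain ⟨K₁, h₁⟩ := exists_isInverseBound k
  obtain ⟨K₂, h₂⟩ := exists_forall_isReference_le (k := k)
    (fun s (i : Finset (Fin (k + 2)) × Fin (k + 2)) => |weights s i.1 i.2|)
  obtain ⟨K₃, h₃⟩ := exists_forall_isReference_le (k := k)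
    (fun s (o : Fin (k + 2)) => ∑ j ∈ Finset.univ.erase o,
      ∑ n ∈ Finset.range ((Lagrange.basis (Finset.univ.erase o) s j).natDegree + 1),
        |(Lagrange.basis (Finset.univ.erase o) s j).coeff n|)
  refine ⟨max K₁ (max K₂ K₃), h₁.mono (le_max_left _ _), fun s hs S j => ?_,
    fun s hs o d B hB hd x hx => ?_⟩
  · exact (h₂ s hs (S, j)).trans ((le_max_left _ _).trans (le_max_right _ _))
  · rw [Lagrange.interpolate_apply, eval_finsetSum]
    calc |∑ j ∈ Finset.univ.erase o,
          (C (d j) * Lagrange.basis (Finset.univ.erase o) s j).eval x|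
        ≤ ∑ j ∈ Finset.univ.erase o,
          (∑ n ∈ Finset.range ((Lagrange.basis (Finset.univ.erase o) s j).natDegree + 1),
            |(Lagrange.basis (Finset.univ.erase o) s j).coeff n|) * B := by
          refine (Finset.abs_sum_le_sum_abs _ _).trans (Finset.sum_le_sum fun j hj => ?_)
          rw [eval_mul, eval_C, abs_mul, mul_comm]
          exact mul_le_mul (abs_eval_le_sum_abs_coeff _ hx) (hd j (Finset.ne_of_mem_erase hj))
            (abs_nonneg _) (Finset.sum_nonneg fun _ _ => abs_nonneg _)
      _ = (∑ j ∈ Finset.univ.erase o,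
          ∑ n ∈ Finset.range ((Lagrange.basis (Finset.univ.erase o) s j).natDegree + 1),
            |(Lagrange.basis (Finset.univ.erase o) s j).coeff n|) * B := by
          rw [Finset.sum_mul]
      _ ≤ max K₁ (max K₂ K₃) * B :=
          mul_le_mul_of_nonneg_right
            ((h₃ s hs o).trans ((le_max_right _ _).trans (le_max_right _ _))) hB

/-- Quadrature weights for one element of a method; they vanish at an end of the element
unless the flux there is upwinded from inside or the velocity is small. -/
lemma exists_isQuadrature_of_reference {k : ℕ} (hk : 1 ≤ k) {s : Fin (k + 2) → ℝ} {K : ℝ}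
    (hK : IsReferenceBound k K) (hs : IsPartition s) (P Q : Prop)
    (h : IsGauss s ∨ (IsRightRadau s ∧ Q) ∨ (IsLeftRadau s ∧ P)) :
    ∃ (A : Fin (k + 2) → ℝ) (c : ℝ), IsQuadrature s A c ∧ (∀ j, |A j| ≤ K) ∧
      (A 0 = 0 ∨ P) ∧ (A (Fin.last (k + 1)) = 0 ∨ Q) := by
  rcases h with h | ⟨h, hQ⟩ | ⟨h, hP⟩
  · obtain ⟨c, hc⟩ := h.exists_isQuadrature hk hs
    exact ⟨_, c, hc, hK.weights_le s ⟨hs, Or.inl h⟩ _, Or.inl (by simp [weights]),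
      Or.inl (by simp [weights])⟩
  · obtain ⟨c, hc⟩ := h.exists_isQuadrature hk hs
    exact ⟨_, c, hc, hK.weights_le s ⟨hs, Or.inr (Or.inl h)⟩ _, Or.inl (by simp [weights]),
      Or.inr hQ⟩
  · obtain ⟨c, hc⟩ := h.exists_isQuadrature hk hs
    exact ⟨_, c, hc, hK.weights_le s ⟨hs, Or.inr (Or.inr h)⟩ _, Or.inr hP,
      Or.inl (by simp [weights])⟩

/-! ### Absolutely continuous functions and weak derivatives -/

lemma two_pi_nonneg : (0 : ℝ) ≤ 2 * Real.pi := by positivity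

lemma zero_mem_Ω : (0 : ℝ) ∈ Ω := ⟨le_rfl, two_pi_nonneg⟩

lemma two_pi_mem_Ω : 2 * Real.pi ∈ Ω := ⟨two_pi_nonneg, le_rfl⟩

lemma isCompact_Ω : IsCompact Ω := isCompact_Icc

lemma uniqueDiffOn_Ω : UniqueDiffOn ℝ Ω := uniqueDiffOn_Icc (by positivity)

lemma interior_Ω : interior Ω = Ioo 0 (2 * Real.pi) := interior_Icc

lemma uIcc_subset_Ω {x y : ℝ} (hx : x ∈ Ω) (hy : y ∈ Ω) : uIcc x y ⊆ Ω := by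
  rw [Ω, ← uIcc_of_le two_pi_nonneg] at *
  exact uIcc_subset_uIcc hx hy

instance : IsFiniteMeasure μΩ := by
  rw [μΩ, Ω]
  infer_instance

lemma integral_Ω (f : ℝ → ℝ) : ∫ x in Ω, f x = ∫ x in (0 : ℝ)..2 * Real.pi, f x := by
  rw [Ω, integral_Icc_eq_integral_Ioc, intervalIntegral.integral_of_le two_pi_nonneg]

lemma intervalIntegrable_of_integrable_Ω {f : ℝ → ℝ} (hf : Integrable f μΩ) {x y : ℝ} (hx : x ∈ Ω)
    (hy : y ∈ Ω) : IntervalIntegrable f volume x y := by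
  have : IntegrableOn f (uIcc x y) := IntegrableOn.mono_set hf (uIcc_subset_Ω hx hy)
  exact this.intervalIntegrable

lemma integrable_of_memLp_two {f : ℝ → ℝ} (hf : MemLp f 2 μΩ) : Integrable f μΩ :=
  hf.integrable (by norm_num)

lemma memLp_of_continuousOn {f : ℝ → ℝ} (hf : ContinuousOn f Ω) : MemLp f 2 μΩ := by
  obtain ⟨C, hC⟩ := isCompact_Ω.exists_bound_of_continuousOn hf
  refine MemLp.of_bound (hf.aestronglyMeasurable measurableSet_Icc) C ?_
  filter_upwards [ae_restrict_mem (measurableSet_Icc : MeasurableSet Ω)] with x hx using hC x hx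

/-- `f` is on `Ω` a primitive of `f'`. -/
def IsPrimitive (f f' : ℝ → ℝ) : Prop :=
  ∀ x ∈ Ω, f x = f 0 + ∫ y in (0 : ℝ)..x, f' y

namespace IsPrimitive

variable {f f' g g' : ℝ → ℝ}

lemma sub_eq (h : IsPrimitive f f') (hf' : Integrable f' μΩ) {x y : ℝ} (hx : x ∈ Ω) (hy : y ∈ Ω) :
    f y - f x = ∫ z in x..y, f' z := by
  rw [h y hy, h x hx, ← intervalIntegral.integral_add_adjacent_intervals
    (intervalIntegrable_of_integrable_Ω hf' zero_mem_Ω hx)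
    (intervalIntegrable_of_integrable_Ω hf' hx hy)]
  ring

lemma continuousOn (h : IsPrimitive f f') (hf' : Integrable f' μΩ) : ContinuousOn f Ω := by
  have h1 : ContinuousOn (fun x => ∫ y in (0 : ℝ)..x, f' y) Ω := by
    have := intervalIntegral.continuousOn_primitive_interval (a := 0) (b := 2 * Real.pi)
      (f := f') (μ := volume) (by rw [uIcc_of_le two_pi_nonneg]; exact hf')
    rwa [uIcc_of_le two_pi_nonneg] at this
  exact (continuousOn_const.add h1).congr h

lemma hasDerivWithinAt (h : IsPrimitive f f') (hf' : ContinuousOn f' Ω) {x : ℝ} (hx : x ∈ Ω) :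
    HasDerivWithinAt f (f' x) Ω x := by
  have hi : Integrable f' μΩ := integrable_of_memLp_two (memLp_of_continuousOn hf')
  have : Fact (x ∈ Icc (0 : ℝ) (2 * Real.pi)) := ⟨hx⟩
  have h1 : HasDerivWithinAt (fun u => ∫ y in (0 : ℝ)..u, f' y) (f' x)
      (Icc (0 : ℝ) (2 * Real.pi)) x :=
    intervalIntegral.integral_hasDerivWithinAt_right
      (intervalIntegrable_of_integrable_Ω hi zero_mem_Ω hx)
      (hf'.stronglyMeasurableAtFilter_nhdsWithin measurableSet_Icc x) (hf' x hx)
  exact (h1.const_add (f 0)).congr h (h x hx)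

lemma of_hasDerivWithinAt (hf : ∀ x ∈ Ω, HasDerivWithinAt f (f' x) Ω x)
    (hf' : ContinuousOn f' Ω) : IsPrimitive f f' := by
  intro x hx
  have hsub := uIcc_subset_Ω zero_mem_Ω hx
  have h1 : ∫ y in (0 : ℝ)..x, f' y = f x - f 0 := by
    refine intervalIntegral.integral_eq_sub_of_hasDeriv_right
      (fun y hy => ((hf y (hsub hy)).continuousWithinAt).mono hsub) (fun y hy => ?_)
      ((hf'.mono hsub).intervalIntegrable)
    have hy2 : y ∈ Ioo (0 : ℝ) x := by
      rwa [min_eq_left hx.1, max_eq_right hx.1] at hy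
    have hmem : Ω ∈ nhds y := Icc_mem_nhds hy2.1 (hy2.2.trans_le hx.2)
    exact ((hf y (mem_of_mem_nhds hmem)).hasDerivAt hmem).hasDerivWithinAt
  rw [h1]
  ring

lemma add (hf : IsPrimitive f f') (hg : IsPrimitive g g') (hf' : Integrable f' μΩ)
    (hg' : Integrable g' μΩ) :
    IsPrimitive (fun x => f x + g x) (fun x => f' x + g' x) := by
  intro x hx
  rw [intervalIntegral.integral_add (intervalIntegrable_of_integrable_Ω hf' zero_mem_Ω hx)
    (intervalIntegrable_of_integrable_Ω hg' zero_mem_Ω hx)]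
  linarith [hf x hx, hg x hx]

lemma const_mul (hf : IsPrimitive f f') (c : ℝ) :
    IsPrimitive (fun x => c * f x) (fun x => c * f' x) := by
  intro x hx
  rw [intervalIntegral.integral_const_mul]
  beta_reduce
  rw [hf x hx]
  ring

/-- The derivatives are merely integrable, so the product rule is integration by parts for
absolutely continuous functions. It is applied to f 0 + ∫ f' and g 0 + ∫ g', as f and g themselves
are known only on `Ω`. -/
lemma mul (hf : IsPrimitive f f') (hg : IsPrimitive g g') (hf' : Integrable f' μΩ)
    (hg' : Integrable g' μΩ) :
    IsPrimitive (fun x => f x * g x) (fun x => f' x * g x + f x * g' x) := by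
  intro x hx
  have hfi := intervalIntegrable_of_integrable_Ω hf' zero_mem_Ω hx
  have hgi := intervalIntegrable_of_integrable_Ω hg' zero_mem_Ω hx
  have hac : ∀ {u : ℝ → ℝ}, IntervalIntegrable u volume 0 x → ∀ c : ℝ,
      AbsolutelyContinuousOnInterval (fun y => c + ∫ z in (0 : ℝ)..y, u z) 0 x := by
    intro u hu c
    have hc : AbsolutelyContinuousOnInterval (fun _ : ℝ => c) 0 x :=
      (LipschitzWith.const c).lipschitzOnWith.absolutelyContinuousOnInterval
    exact hc.add (hu.absolutelyContinuousOnInterval_intervalIntegral left_mem_uIcc)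
  have key := (hac hfi (f 0)).integral_deriv_mul_eq_sub (hac hgi (g 0))
  have hsub := uIcc_subset_Ω zero_mem_Ω hx
  have hcongr : ∫ y in (0 : ℝ)..x, f' y * g y + f y * g' y =
      ∫ y in (0 : ℝ)..x, deriv (fun y => f 0 + ∫ z in (0 : ℝ)..y, f' z) y *
        (g 0 + ∫ z in (0 : ℝ)..y, g' z) + (f 0 + ∫ z in (0 : ℝ)..y, f' z) *
        deriv (fun y => g 0 + ∫ z in (0 : ℝ)..y, g' z) y := by
    refine intervalIntegral.integral_congr_ae ?_
    filter_upwards [hfi.ae_hasDerivAt_integral, hgi.ae_hasDerivAt_integral] with y h1 h2 hy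
    have hy' : y ∈ uIcc 0 x := uIoc_subset_uIcc hy
    rw [((h1 hy' 0 left_mem_uIcc).const_add (f 0)).deriv,
      ((h2 hy' 0 left_mem_uIcc).const_add (g 0)).deriv, hf y (hsub hy'), hg y (hsub hy')]
  rw [hcongr, key]
  simp only [intervalIntegral.integral_same, add_zero]
  rw [← hf x hx, ← hg x hx]
  ring

end IsPrimitive

/-! ### Chains of derivatives and the Leibniz rule -/

/-- `F 0, …, F m` are successive derivatives on `Ω`, all in `L²`. -/
structure IsChain (m : ℕ) (F : ℕ → ℝ → ℝ) : Prop where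
  isPrimitive : ∀ j < m, IsPrimitive (F j) (F (j + 1))
  memLp : ∀ j ≤ m, MemLp (F j) 2 μΩ

namespace IsChain

variable {m : ℕ} {F : ℕ → ℝ → ℝ}

lemma integrable (h : IsChain m F) {j : ℕ} (hj : j ≤ m) : Integrable (F j) μΩ :=
  integrable_of_memLp_two (h.memLp j hj)

lemma continuousOn (h : IsChain m F) {j : ℕ} (hj : j < m) : ContinuousOn (F j) Ω :=
  (h.isPrimitive j hj).continuousOn (h.integrable hj)

lemma hasDerivWithinAt (h : IsChain m F) {j : ℕ} (hj : j + 1 < m) {x : ℝ} (hx : x ∈ Ω) :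
    HasDerivWithinAt (F j) (F (j + 1) x) Ω x :=
  (h.isPrimitive j (by omega)).hasDerivWithinAt (h.continuousOn hj) hx

lemma shift (h : IsChain (m + 1) F) : IsChain m fun j => F (j + 1) :=
  ⟨fun j hj => h.isPrimitive (j + 1) (by omega), fun j hj => h.memLp (j + 1) (by omega)⟩

lemma mono (h : IsChain m F) {n : ℕ} (hn : n ≤ m) : IsChain n F :=
  ⟨fun j hj => h.isPrimitive j (by omega), fun j hj => h.memLp j (by omega)⟩

end IsChain

/-- The `j`-th derivative of a product, in terms of the derivatives of the factors. -/
def leibniz : ℕ → (ℕ → ℝ → ℝ) → (ℕ → ℝ → ℝ) → ℝ → ℝ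
  | 0, A, U => fun x => A 0 x * U 0 x
  | j + 1, A, U => fun x => leibniz j (fun i => A (i + 1)) U x + leibniz j A (fun i => U (i + 1)) x

lemma abs_leibniz_le (j : ℕ) (A U : ℕ → ℝ → ℝ) (x M : ℝ) (hA : ∀ i ≤ j, |A i x| ≤ M) :
    |leibniz j A U x| ≤ 2 ^ j * M * ∑ i ∈ Finset.range (j + 1), |U i x| := by
  induction j generalizing A U with
  | zero =>
    simp only [leibniz, abs_mul, pow_zero, one_mul, zero_add, Finset.sum_range_one]
    exact mul_le_mul_of_nonneg_right (hA 0 le_rfl) (abs_nonneg _)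
  | succ j ih =>
    have hM : 0 ≤ M := (abs_nonneg _).trans (hA 0 (Nat.zero_le _))
    have h1 := ih (fun i => A (i + 1)) U fun i hi => hA (i + 1) (by omega)
    have h2 := ih A (fun i => U (i + 1)) fun i hi => hA i (by omega)
    have h3 : ∑ i ∈ Finset.range (j + 1), |U i x| ≤ ∑ i ∈ Finset.range (j + 1 + 1), |U i x| := by
      rw [Finset.sum_range_succ _ (j + 1)]
      linarith [abs_nonneg (U (j + 1) x)]
    have h4 : ∑ i ∈ Finset.range (j + 1), |U (i + 1) x| ≤
        ∑ i ∈ Finset.range (j + 1 + 1), |U i x| := by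
      rw [Finset.sum_range_succ' _ (j + 1)]
      linarith [abs_nonneg (U 0 x)]
    have hc : 0 ≤ 2 ^ j * M := by positivity
    have h5 := mul_le_mul_of_nonneg_left h3 hc
    have h6 := mul_le_mul_of_nonneg_left h4 hc
    calc |leibniz (j + 1) A U x|
        ≤ |leibniz j (fun i => A (i + 1)) U x| + |leibniz j A (fun i => U (i + 1)) x| :=
          abs_add_le _ _
      _ ≤ 2 ^ (j + 1) * M * ∑ i ∈ Finset.range (j + 1 + 1), |U i x| := by
          rw [pow_succ]
          linarith

/-- All the functions `A j` are continuous on `Ω`, each being the derivative of the previous one. -/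
structure IsSmoothChain (A : ℕ → ℝ → ℝ) : Prop where
  continuousOn : ∀ j, ContinuousOn (A j) Ω
  isPrimitive : ∀ j, IsPrimitive (A j) (A (j + 1))

lemma IsSmoothChain.isChain {A : ℕ → ℝ → ℝ} (h : IsSmoothChain A) (m : ℕ) : IsChain m A :=
  ⟨fun j _ => h.isPrimitive j, fun j _ => memLp_of_continuousOn (h.continuousOn j)⟩

lemma IsSmoothChain.shift {A : ℕ → ℝ → ℝ} (h : IsSmoothChain A) :
    IsSmoothChain fun j => A (j + 1) :=
  ⟨fun j => h.continuousOn (j + 1), fun j => h.isPrimitive (j + 1)⟩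

lemma MemLp.continuousOn_mul {a u : ℝ → ℝ} (ha : ContinuousOn a Ω) (hu : MemLp u 2 μΩ) :
    MemLp (fun x => a x * u x) 2 μΩ := by
  obtain ⟨C, hC⟩ := isCompact_Ω.exists_bound_of_continuousOn ha
  refine (hu.const_mul C).mono ((ha.aestronglyMeasurable measurableSet_Icc).mul hu.1) ?_
  filter_upwards [ae_restrict_mem (measurableSet_Icc : MeasurableSet Ω)] with x hx
  rw [norm_mul, norm_mul]
  exact mul_le_mul_of_nonneg_right ((hC x hx).trans (le_abs_self C)) (norm_nonneg _)

lemma memLp_leibniz {m : ℕ} {A U : ℕ → ℝ → ℝ} (hA : IsSmoothChain A) (hU : IsChain m U) {j : ℕ}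
    (hj : j ≤ m) : MemLp (leibniz j A U) 2 μΩ := by
  induction j generalizing A U m with
  | zero => exact MemLp.continuousOn_mul (hA.continuousOn 0) (hU.memLp 0 (Nat.zero_le _))
  | succ j ih =>
    obtain ⟨n, rfl⟩ : ∃ n, m = n + 1 := ⟨m - 1, by omega⟩
    exact (ih hA.shift hU (by omega)).add (ih hA hU.shift (by omega))

lemma isPrimitive_leibniz {m : ℕ} {A U : ℕ → ℝ → ℝ} (hA : IsSmoothChain A) (hU : IsChain m U)
    {j : ℕ} (hj : j < m) : IsPrimitive (leibniz j A U) (leibniz (j + 1) A U) := by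
  induction j generalizing A U m with
  | zero =>
    exact (hA.isPrimitive 0).mul (hU.isPrimitive 0 hj)
      (integrable_of_memLp_two (memLp_of_continuousOn (hA.continuousOn 1))) (hU.integrable hj)
  | succ j ih =>
    obtain ⟨n, rfl⟩ : ∃ n, m = n + 1 := ⟨m - 1, by omega⟩
    exact (ih hA.shift hU (by omega)).add (ih hA hU.shift (by omega))
      (integrable_of_memLp_two (memLp_leibniz hA.shift hU (by omega)))
      (integrable_of_memLp_two (memLp_leibniz hA hU.shift (by omega)))

lemma IsChain.leibniz {m : ℕ} {A U : ℕ → ℝ → ℝ} (hA : IsSmoothChain A) (hU : IsChain m U) :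
    IsChain m fun j => leibniz j A U :=
  ⟨fun _ hj => isPrimitive_leibniz hA hU hj, fun _ hj => memLp_leibniz hA hU hj⟩

lemma IsChain.sub {m : ℕ} {F G : ℕ → ℝ → ℝ} (hF : IsChain m F) (hG : IsChain m G) :
    IsChain m fun j x => F j x - G j x := by
  refine ⟨fun j hj => ?_, fun j hj => (hF.memLp j hj).sub (hG.memLp j hj)⟩
  have h := (hF.isPrimitive j hj).add ((hG.isPrimitive j hj).const_mul (-1)) (hF.integrable hj)
    ((hG.integrable hj).const_mul (-1))
  simpa only [neg_one_mul, ← sub_eq_add_neg] using h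

/-! ### Test functions, and representatives of weak derivatives -/

/-- The test functions on the open interval `(0, 2π)`. -/
structure IsTest (φ : ℝ → ℝ) : Prop where
  contDiff : ContDiff ℝ ∞ φ
  compact : HasCompactSupport φ
  tsupport_subset : tsupport φ ⊆ interior Ω

namespace IsTest

variable {φ ψ : ℝ → ℝ}

lemma eq_zero (h : IsTest φ) {x : ℝ} (hx : x ∉ Ioo 0 (2 * Real.pi)) : φ x = 0 :=
  image_eq_zero_of_notMem_tsupport fun hmem => hx (interior_Ω ▸ h.tsupport_subset hmem)

lemma continuousOn (h : IsTest φ) : ContinuousOn φ Ω := h.contDiff.continuous.continuousOn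

lemma deriv (h : IsTest φ) : IsTest (deriv φ) :=
  ⟨(contDiff_infty_iff_deriv.1 h.contDiff).2, h.compact.deriv,
    tsupport_deriv_subset.trans h.tsupport_subset⟩

lemma isPrimitive (h : IsTest φ) : IsPrimitive φ (_root_.deriv φ) :=
  .of_hasDerivWithinAt
    (fun x _ => (h.contDiff.differentiable (by simp) x).hasDerivAt.hasDerivWithinAt)
    h.deriv.continuousOn

lemma integrable_mul (h : IsTest φ) {f : ℝ → ℝ} (hf : MemLp f 2 μΩ) :
    Integrable (fun x => f x * φ x) μΩ := by
  have := MemLp.continuousOn_mul h.continuousOn hf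
  simpa only [mul_comm] using integrable_of_memLp_two this

end IsTest

lemma IsPrimitive.integral_mul_deriv {f f' φ : ℝ → ℝ} (hf : IsPrimitive f f')
    (hf' : MemLp f' 2 μΩ) (hφ : IsTest φ) :
    ∫ x in Ω, f x * deriv φ x = -∫ x in Ω, f' x * φ x := by
  have h := hf.mul hφ.isPrimitive (integrable_of_memLp_two hf')
    (integrable_of_memLp_two (memLp_of_continuousOn hφ.deriv.continuousOn)) _ two_pi_mem_Ω
  have hfc : MemLp f 2 μΩ :=
    memLp_of_continuousOn (hf.continuousOn (integrable_of_memLp_two hf'))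
  beta_reduce at h
  rw [hφ.eq_zero (x := 0) (by simp), hφ.eq_zero (x := 2 * Real.pi) (by simp), ← integral_Ω] at h
  have h2 : ∫ x in Ω, (f' x * φ x + f x * deriv φ x) =
      (∫ x in Ω, f' x * φ x) + ∫ x in Ω, f x * deriv φ x :=
    integral_add (hφ.integrable_mul hf') (hφ.deriv.integrable_mul hfc)
  linarith

lemma IsChain.isWeakDeriv {m : ℕ} {F : ℕ → ℝ → ℝ} (h : IsChain m F) {j : ℕ} (hj : j ≤ m) :
    IsWeakDeriv j (F 0) (F j) := by
  refine ⟨?_, h.memLp j hj, fun φ h1 h2 h3 => ?_⟩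
  · have : IntegrableOn (F 0) Ω := h.integrable (Nat.zero_le _)
    exact (this.mono_set interior_subset).locallyIntegrableOn
  have hφ : IsTest φ := ⟨h1, h2, h3⟩
  clear h1 h2 h3
  induction j generalizing φ with
  | zero => simp
  | succ j ih =>
    rw [iteratedDeriv_succ', ih (by omega) _ hφ.deriv,
      (h.isPrimitive j (by omega)).integral_mul_deriv (h.memLp (j + 1) hj) hφ, pow_succ]
    ring

lemma ae_eq_of_integral_mul_eq {f g : ℝ → ℝ} (hf : LocallyIntegrableOn f (interior Ω))
    (hg : LocallyIntegrableOn g (interior Ω))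
    (h : ∀ φ, IsTest φ → ∫ x in Ω, f x * φ x = ∫ x in Ω, g x * φ x) : f =ᵐ[μΩ] g := by
  have hfull : ∀ (φ : ℝ → ℝ), IsTest φ → ∀ u : ℝ → ℝ, ∫ x, u x * φ x = ∫ x in Ω, u x * φ x := by
    intro φ hφ u
    rw [setIntegral_eq_integral_of_forall_compl_eq_zero]
    intro x hx
    rw [hφ.eq_zero fun h => hx (Ioo_subset_Icc_self h), mul_zero]
  have hint : ∀ (φ : ℝ → ℝ), IsTest φ → ∀ u : ℝ → ℝ, LocallyIntegrableOn u (interior Ω) →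
      Integrable fun x => u x * φ x := by
    intro φ hφ u hu
    have h1 : IntegrableOn u (tsupport φ) :=
      hu.integrableOn_compact_subset hφ.tsupport_subset hφ.compact
    have h2 := h1.mul_continuousOn hφ.contDiff.continuous.continuousOn hφ.compact
    refine (integrableOn_iff_integrable_of_support_subset ?_).1 h2
    exact (Function.support_mul_subset_right u φ).trans (subset_tsupport φ)
  have h0 := isOpen_interior.ae_eq_zero_of_integral_contDiff_smul_eq_zero (μ := volume)
    (f := fun x => f x - g x) (U := interior Ω) (hf.sub hg) (by
      intro φ h1 h2 h3
      have hφ : IsTest φ := ⟨h1, h2, h3⟩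
      have : ∀ x, φ x • (f x - g x) = f x * φ x - g x * φ x := fun x => by
        rw [smul_eq_mul]
        ring
      simp only [this]
      rw [integral_sub (hint φ hφ f hf) (hint φ hφ g hg), hfull φ hφ, hfull φ hφ, h φ hφ, sub_self])
  rw [interior_Ω] at h0
  have hμ : μΩ = volume.restrict (Ioo 0 (2 * Real.pi)) := by
    rw [μΩ, Ω]
    exact Measure.restrict_congr_set Ioo_ae_eq_Icc.symm
  rw [hμ]
  filter_upwards [ae_restrict_of_ae h0, ae_restrict_mem measurableSet_Ioo] with x hx hx'
  exact sub_eq_zero.1 (hx hx')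

lemma locallyIntegrableOn_of_memLp {f : ℝ → ℝ} (hf : MemLp f 2 μΩ) :
    LocallyIntegrableOn f (interior Ω) := by
  have : IntegrableOn f Ω := integrable_of_memLp_two hf
  exact (this.mono_set interior_subset).locallyIntegrableOn

lemma IsWeakDeriv.ae_eq {j : ℕ} {f v w : ℝ → ℝ} (hv : IsWeakDeriv j f v) (hw : IsWeakDeriv j f w) :
    v =ᵐ[μΩ] w := by
  refine ae_eq_of_integral_mul_eq (locallyIntegrableOn_of_memLp hv.memLp)
    (locallyIntegrableOn_of_memLp hw.memLp) fun φ hφ => ?_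
  have h1 := hv.integral_eq φ hφ.1 hφ.2 hφ.3
  rw [hw.integral_eq φ hφ.1 hφ.2 hφ.3] at h1
  exact (mul_left_cancel₀ (pow_ne_zero j (by norm_num)) h1).symm

lemma IsWeakDeriv.weakDerivNorm_eq {j : ℕ} {f v : ℝ → ℝ} (hv : IsWeakDeriv j f v) :
    weakDerivNorm j f = eLpNorm v 2 μΩ := by
  refine le_antisymm (iInf₂_le v hv) (le_iInf₂ fun w hw => ?_)
  rw [eLpNorm_congr_ae (hv.ae_eq hw)]

/-- A test function with integral zero is the derivative of a test function. -/
lemma exists_isTest_deriv_eq {ψ : ℝ → ℝ} (h : IsTest ψ) (h0 : ∫ x in Ω, ψ x = 0) :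
    ∃ φ, IsTest φ ∧ deriv φ = ψ := by
  have hcont := h.contDiff.continuous
  have hder : ∀ x, HasDerivAt (fun y => ∫ z in (0 : ℝ)..y, ψ z) (ψ x) x := fun x =>
    intervalIntegral.integral_hasDerivAt_right (hcont.intervalIntegrable _ _)
      hcont.stronglyMeasurable.stronglyMeasurableAtFilter hcont.continuousAt
  have hd : deriv (fun y => ∫ z in (0 : ℝ)..y, ψ z) = ψ := funext fun x => (hder x).deriv
  -- The support stays away from both ends. The primitive vanishes to its left because integration
  -- starts at 0, and to its right because the total integral is zero.
  obtain ⟨a, b, ha, hb, hab⟩ : ∃ a b : ℝ, 0 < a ∧ b < 2 * Real.pi ∧ tsupport ψ ⊆ Icc a b := by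
    rcases (tsupport ψ).eq_empty_or_nonempty with he | hne
    · exact ⟨1, 0, one_pos, by positivity, by rw [he]; exact empty_subset _⟩
    · have hsub : tsupport ψ ⊆ Ioo 0 (2 * Real.pi) := interior_Ω ▸ h.tsupport_subset
      have hK : IsCompact (tsupport ψ) := h.compact
      exact ⟨sInf (tsupport ψ), sSup (tsupport ψ), (hsub (hK.sInf_mem hne)).1,
        (hsub (hK.sSup_mem hne)).2, subset_Icc_csInf_csSup hK.bddBelow hK.bddAbove⟩
  have hz : ∀ x, x ∉ Icc a b → ψ x = 0 := fun x hx =>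
    image_eq_zero_of_notMem_tsupport fun hmem => hx (hab hmem)
  have hzero : ∀ x, x ∉ Icc a b → ∫ z in (0 : ℝ)..x, ψ z = 0 := by
    intro x hx
    rw [mem_Icc, not_and_or, not_le, not_le] at hx
    rcases hx with hx | hx
    · rw [intervalIntegral.integral_congr (g := fun _ => 0)]
      · simp
      · intro z hz'
        refine hz z fun hm => ?_
        have : z ≤ max 0 x := hz'.2
        rcases le_max_iff.1 this with h1 | h1 <;> linarith [hm.1]
    · have h1 : ∫ z in (0 : ℝ)..2 * Real.pi, ψ z = 0 := by rw [← integral_Ω, h0]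
      have h2 : ∫ z in x..2 * Real.pi, ψ z = 0 := by
        rw [intervalIntegral.integral_congr (g := fun _ => 0)]
        · simp
        · intro z hz'
          refine hz z fun hm => ?_
          have : min x (2 * Real.pi) ≤ z := hz'.1
          rcases min_le_iff.1 this with h1 | h1 <;> linarith [hm.2]
      rw [← intervalIntegral.integral_add_adjacent_intervals (hcont.intervalIntegrable 0 x)
        (hcont.intervalIntegrable x (2 * Real.pi)), h2, add_zero] at h1
      exact h1
  have hts : tsupport (fun y => ∫ z in (0 : ℝ)..y, ψ z) ⊆ Icc a b :=
    closure_minimal (fun x hx => by_contra fun hn => hx (hzero x hn)) isClosed_Icc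
  refine ⟨_, ⟨?_, ?_, ?_⟩, hd⟩
  · rw [contDiff_infty_iff_deriv, hd]
    exact ⟨fun x => (hder x).differentiableAt, h.contDiff⟩
  · exact isCompact_Icc.of_isClosed_subset (isClosed_tsupport _) hts
  · rw [interior_Ω]
    exact hts.trans fun x hx => ⟨ha.trans_le hx.1, hx.2.trans_lt hb⟩

lemma exists_isTest_integral_eq_one : ∃ ρ, IsTest ρ ∧ ∫ x in Ω, ρ x = 1 := by
  have hpi := Real.pi_pos
  let f : ContDiffBump Real.pi := ⟨Real.pi / 4, Real.pi / 2, by positivity, by linarith⟩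
  have hts : tsupport (f.normed volume) ⊆ interior Ω := by
    rw [f.tsupport_normed_eq, Real.closedBall_eq_Icc, interior_Ω]
    intro x hx
    have h1 : f.rOut = Real.pi / 2 := rfl
    rw [h1] at hx
    exact ⟨by linarith [hx.1], by linarith [hx.2]⟩
  have hρ : IsTest (f.normed volume) := ⟨f.contDiff_normed, f.hasCompactSupport_normed, hts⟩
  refine ⟨_, hρ, ?_⟩
  rw [setIntegral_eq_integral_of_forall_compl_eq_zero, f.integral_normed]
  exact fun x hx => hρ.eq_zero fun h => hx (Ioo_subset_Icc_self h)

lemma IsTest.sub_const_mul {φ ψ : ℝ → ℝ} (hφ : IsTest φ) (hψ : IsTest ψ) (c : ℝ) :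
    IsTest fun x => φ x - c * ψ x := by
  have hsub : tsupport (fun x => φ x - c * ψ x) ⊆ tsupport φ ∪ tsupport ψ := by
    refine closure_minimal (fun x hx => ?_) ((isClosed_tsupport _).union (isClosed_tsupport _))
    by_contra hn
    rw [mem_union, not_or] at hn
    refine hx ?_
    beta_reduce
    rw [image_eq_zero_of_notMem_tsupport hn.1, image_eq_zero_of_notMem_tsupport hn.2]
    simp
  refine ⟨hφ.contDiff.sub (contDiff_const.mul hψ.contDiff), ?_,
    hsub.trans (union_subset hφ.tsupport_subset hψ.tsupport_subset)⟩
  exact (hφ.compact.isCompact.union hψ.compact.isCompact).of_isClosed_subset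
    (isClosed_tsupport _) hsub

/-- A function with a weak derivative in `L²` is a primitive of it, up to a null set. -/
lemma exists_ae_eq_const_add_integral {f v : ℝ → ℝ} (hf : MemLp f 2 μΩ) (hv : MemLp v 2 μΩ)
    (h : ∀ φ, IsTest φ → ∫ x in Ω, f x * deriv φ x = -∫ x in Ω, v x * φ x) :
    ∃ c : ℝ, f =ᵐ[μΩ] fun x => c + ∫ y in (0 : ℝ)..x, v y := by
  obtain ⟨ρ, hρ, hρ1⟩ := exists_isTest_integral_eq_one
  set W : ℝ → ℝ := fun x => ∫ y in (0 : ℝ)..x, v y with hW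
  have hWp : ∀ c, IsPrimitive (fun x => c + W x) v := fun c x _ => by simp [hW]
  have hW2 : ∀ c, MemLp (fun x => c + W x) 2 μΩ := fun c =>
    memLp_of_continuousOn ((hWp c).continuousOn (integrable_of_memLp_two hv))
  -- The constant is chosen such that f and c + W have the same integral against ρ.
  set c := (∫ x in Ω, f x * ρ x) - ∫ x in Ω, (0 + W x) * ρ x with hc
  refine ⟨c, ae_eq_of_integral_mul_eq (locallyIntegrableOn_of_memLp hf)
    (locallyIntegrableOn_of_memLp (hW2 c)) fun ψ hψ => ?_⟩
  set q := ∫ x in Ω, ψ x with hq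
  have hi : ∀ u : ℝ → ℝ, MemLp u 2 μΩ → ∫ x in Ω, u x * (ψ x - q * ρ x) =
      (∫ x in Ω, u x * ψ x) - q * ∫ x in Ω, u x * ρ x := by
    intro u hu
    rw [← integral_const_mul]
    have e : ∀ x, u x * (ψ x - q * ρ x) = u x * ψ x - q * (u x * ρ x) := fun x => by ring
    simp only [e]
    exact integral_sub (hψ.integrable_mul hu) ((hρ.integrable_mul hu).const_mul q)
  have h0 : ∫ x in Ω, (ψ x - q * ρ x) = 0 := by
    have := hi (fun _ => 1) (memLp_const 1)
    simp only [one_mul] at this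
    rw [this, hρ1, hq]
    ring
  -- Subtracting q ρ gives ψ integral zero, hence a test function as primitive, on which f and W
  -- satisfy the same weak identity.
  obtain ⟨φ, hφ, hφd⟩ := exists_isTest_deriv_eq (hψ.sub_const_mul hρ q) h0
  have e1 := h φ hφ
  have e2 := (hWp 0).integral_mul_deriv hv hφ
  rw [hφd] at e1 e2
  rw [hi f hf] at e1
  rw [hi _ (hW2 0)] at e2
  have e3 : ∫ x in Ω, (c + W x) * ψ x = c * q + ∫ x in Ω, (0 + W x) * ψ x := by
    rw [hq, ← integral_const_mul]
    have hψ1 : Integrable (fun x => c * ψ x) μΩ := by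
      have := (hψ.integrable_mul (memLp_const (1 : ℝ))).const_mul c
      simpa using this
    have := integral_add hψ1 (hψ.integrable_mul (hW2 0))
    rw [μΩ] at this
    rw [← this]
    refine integral_congr_ae (Filter.Eventually.of_forall fun x => ?_)
    beta_reduce
    ring
  rw [e3]
  have e4 : (∫ x in Ω, f x * ρ x) = c + ∫ x in Ω, (0 + W x) * ρ x := by
    rw [hc]
    ring
  rw [e4] at e1
  linarith

/-- The continuous representative of a function in `H^m` and its derivatives. -/
lemma MemSobolev.exists_isChain {m : ℕ} (hm : 1 ≤ m) {f : ℝ → ℝ} (hf : MemSobolev m f)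
    (hfc : ContinuousOn f Ω) : ∃ F, IsChain m F ∧ F 0 = f := by
  choose! v₀ hv₀ using hf
  -- In order 0 the function itself is taken, so that the chain begins with `f` and not with a
  -- function equal to it almost everywhere.
  set v : ℕ → ℝ → ℝ := fun j => if j = 0 then f else v₀ j with hvdef
  have hf2 := memLp_of_continuousOn hfc
  have hv : ∀ j ≤ m, IsWeakDeriv j f (v j) := by
    intro j hj
    by_cases h0 : j = 0
    · subst h0
      exact ⟨locallyIntegrableOn_of_memLp hf2, by simpa [hvdef] using hf2, by simp [hvdef]⟩
    · simpa [hvdef, h0] using hv₀ j hj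
  have hc : ∀ j < m, ∃ c : ℝ, v j =ᵐ[μΩ] fun x => c + ∫ y in (0 : ℝ)..x, v (j + 1) y := by
    intro j hj
    refine exists_ae_eq_const_add_integral (hv j hj.le).memLp (hv (j + 1) hj).memLp fun φ hφ => ?_
    have h1 := (hv j hj.le).integral_eq _ hφ.deriv.1 hφ.deriv.2 hφ.deriv.3
    have h2 := (hv (j + 1) hj).integral_eq _ hφ.1 hφ.2 hφ.3
    rw [iteratedDeriv_succ', h1, pow_succ, mul_assoc] at h2
    have h3 := mul_left_cancel₀ (pow_ne_zero j (by norm_num : (-1 : ℝ) ≠ 0)) h2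
    rw [h3]
    ring
  choose! c hc using hc
  set F : ℕ → ℝ → ℝ := fun j => if j = 0 then f else if j < m then
    fun x => c j + ∫ y in (0 : ℝ)..x, v (j + 1) y else v j with hF
  have hFv : ∀ j ≤ m, F j =ᵐ[μΩ] v j := by
    intro j hj
    by_cases h0 : j = 0
    · simp [hF, hvdef, h0]
    · by_cases hjm : j < m
      · simpa [hF, h0, hjm] using (hc j hjm).symm
      · simp [hF, h0, hjm]
  have hmem : ∀ j ≤ m, MemLp (F j) 2 μΩ := fun j hj =>
    (memLp_congr_ae (hFv j hj)).2 (hv j hj).memLp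
  have hint : ∀ j < m, ∀ x ∈ Ω,
      ∫ y in (0 : ℝ)..x, v (j + 1) y = ∫ y in (0 : ℝ)..x, F (j + 1) y := by
    intro j hj x hx
    refine intervalIntegral.integral_congr_ae ?_
    have h1 : ∀ᵐ y, y ∈ Ω → F (j + 1) y = v (j + 1) y :=
      (ae_restrict_iff' measurableSet_Icc).1 (hFv (j + 1) hj)
    filter_upwards [h1] with y hy hyx
    exact (hy (uIcc_subset_Ω zero_mem_Ω hx (uIoc_subset_uIcc hyx))).symm
  refine ⟨F, ⟨fun j hj => ?_, hmem⟩, by simp [hF]⟩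
  have hp : IsPrimitive (fun x => c j + ∫ y in (0 : ℝ)..x, v (j + 1) y) (F (j + 1)) := by
    intro x hx
    simp only [intervalIntegral.integral_same, add_zero]
    rw [hint j hj x hx]
  by_cases h0 : j = 0
  · subst h0
    have hF0 : F 0 = f := by simp [hF]
    -- Two continuous functions that agree almost everywhere on an interval agree everywhere; this
    -- is where continuity of `f` is needed.
    have heq : EqOn f (fun x => c 0 + ∫ y in (0 : ℝ)..x, v (0 + 1) y) Ω := by
      have h1 := hc 0 hj
      have h2 : v 0 = f := by simp [hvdef]
      rw [h2] at h1
      exact Measure.eqOn_Icc_of_ae_eq volume (by positivity) h1 hfc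
        (hp.continuousOn (integrable_of_memLp_two (hmem 1 hm)))
    intro x hx
    rw [hF0, heq hx, heq zero_mem_Ω]
    exact hp x hx
  · have : F j = fun x => c j + ∫ y in (0 : ℝ)..x, v (j + 1) y := by
      simp [hF, h0, hj]
    rw [this]
    exact hp

/-! ### Norms, Taylor polynomials and smooth data -/

/-- The square of the `L²(Ω)` norm as a real number. -/
def l2sq (f : ℝ → ℝ) : ℝ := ∫ x in Ω, f x ^ 2

lemma l2sq_nonneg (f : ℝ → ℝ) : 0 ≤ l2sq f := integral_nonneg fun _ => sq_nonneg _

lemma eLpNorm_two_eq {f : ℝ → ℝ} (hf : MemLp f 2 μΩ) :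
    eLpNorm f 2 μΩ = ENNReal.ofReal (Real.sqrt (l2sq f)) := by
  rw [hf.eLpNorm_eq_integral_rpow_norm two_ne_zero ENNReal.ofNat_ne_top, l2sq, Real.sqrt_eq_rpow,
    μΩ]
  simp

lemma IsChain.sobolevNorm_eq {m : ℕ} {F : ℕ → ℝ → ℝ} (h : IsChain m F) :
    sobolevNorm m (F 0) =
      ENNReal.ofReal (Real.sqrt (∑ j ∈ Finset.range (m + 1), l2sq (F j))) := by
  have h1 : ∀ j ∈ Finset.range (m + 1), weakDerivNorm j (F 0) ^ 2 = ENNReal.ofReal (l2sq (F j)) := by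
    intro j hj
    have hjm : j ≤ m := by
      have := Finset.mem_range.1 hj
      omega
    rw [(h.isWeakDeriv hjm).weakDerivNorm_eq, eLpNorm_two_eq (h.memLp j hjm),
      ← ENNReal.ofReal_pow (Real.sqrt_nonneg _), Real.sq_sqrt (l2sq_nonneg _)]
  rw [sobolevNorm, Finset.sum_congr rfl h1,
    ← ENNReal.ofReal_sum_of_nonneg fun j _ => l2sq_nonneg (F j),
    ENNReal.ofReal_rpow_of_nonneg (Finset.sum_nonneg fun j _ => l2sq_nonneg (F j)) (by norm_num),
    Real.sqrt_eq_rpow]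

lemma IsChain.sum_l2sq_le {m : ℕ} {F : ℕ → ℝ → ℝ} (h : IsChain m F) {B : ℝ} (hB : 0 ≤ B)
    (hle : sobolevNorm m (F 0) ≤ ENNReal.ofReal B) :
    ∑ j ∈ Finset.range (m + 1), l2sq (F j) ≤ B ^ 2 := by
  rw [h.sobolevNorm_eq, ENNReal.ofReal_le_ofReal_iff hB] at hle
  exact (Real.sqrt_le_left hB).1 hle

lemma IsChain.l2sq_le {m : ℕ} {F : ℕ → ℝ → ℝ} (h : IsChain m F) {B : ℝ} (hB : 0 ≤ B)
    (hle : sobolevNorm m (F 0) ≤ ENNReal.ofReal B) {j : ℕ} (hj : j ≤ m) : l2sq (F j) ≤ B ^ 2 :=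
  (Finset.single_le_sum (fun i _ => l2sq_nonneg (F i))
    (Finset.mem_range.2 (Nat.lt_succ_of_le hj))).trans (h.sum_l2sq_le hB hle)

lemma sq_integral_abs_le {f : ℝ → ℝ} (hf : MemLp f 2 μΩ) {a b : ℝ} (ha : a ∈ Ω) (hb : b ∈ Ω)
    (hab : a ≤ b) : (∫ x in a..b, |f x|) ^ 2 ≤ (b - a) * ∫ x in a..b, f x ^ 2 := by
  rcases hab.eq_or_lt with rfl | hlt
  · simp
  set I := ∫ x in a..b, |f x|
  -- Cauchy–Schwarz from nonnegativity of the variance: c is the mean of |f|.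
  set c := I / (b - a)
  have hba : 0 < b - a := sub_pos.2 hlt
  have h1 := (intervalIntegrable_of_integrable_Ω (integrable_of_memLp_two hf) ha hb).abs
  have h2 := intervalIntegrable_of_integrable_Ω hf.integrable_sq ha hb
  have h3 : ∫ x in a..b, (|f x| - c) ^ 2 = (∫ x in a..b, f x ^ 2) - 2 * c * I + c ^ 2 * (b - a) := by
    have e : ∀ x, (|f x| - c) ^ 2 = (f x ^ 2 - 2 * c * |f x|) + c ^ 2 := fun x => by
      rw [sub_sq, sq_abs]
      ring
    simp only [e]
    rw [intervalIntegral.integral_add (h2.sub (h1.const_mul _)) intervalIntegrable_const,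
      intervalIntegral.integral_sub h2 (h1.const_mul _), intervalIntegral.integral_const_mul,
      intervalIntegral.integral_const, smul_eq_mul]
    ring
  have h4 : 0 ≤ ∫ x in a..b, (|f x| - c) ^ 2 :=
    intervalIntegral.integral_nonneg hab fun _ _ => sq_nonneg _
  have h5 : c * (b - a) = I := div_mul_cancel₀ _ hba.ne'
  rw [h3] at h4
  nlinarith

lemma Icc_subset_Ω {a b : ℝ} (ha : a ∈ Ω) (hb : b ∈ Ω) : Icc a b ⊆ Ω :=
  Icc_subset_Icc ha.1 hb.2

-- By induction: integrate an approximation of the derivative and match the value at a. The L¹ norm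
-- is kept on the right so that Cauchy–Schwarz can be applied element by element later.
open Polynomial in
lemma IsChain.exists_taylor {m : ℕ} {F : ℕ → ℝ → ℝ} (h : IsChain (m + 1) F) {a b : ℝ} (ha : a ∈ Ω)
    (hb : b ∈ Ω) (hab : a ≤ b) : ∃ P : ℝ[X], P.natDegree ≤ m ∧ ∀ x ∈ Icc a b,
      |F 0 x - P.eval x| ≤ (b - a) ^ m * ∫ y in a..b, |F (m + 1) y| := by
  induction m generalizing F with
  | zero =>
    refine ⟨C (F 0 a), by simp, fun x hx => ?_⟩
    have hxΩ := Icc_subset_Ω ha hb hx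
    rw [eval_C, (h.isPrimitive 0 one_pos).sub_eq (h.integrable le_rfl) ha hxΩ, pow_zero, one_mul]
    have hi := (intervalIntegrable_of_integrable_Ω (h.integrable le_rfl) ha hb).abs
    refine (intervalIntegral.abs_integral_le_integral_abs hx.1).trans ?_
    exact intervalIntegral.integral_mono_interval le_rfl hx.1 hx.2
      (Filter.Eventually.of_forall fun _ => abs_nonneg _) hi
  | succ m ih =>
    obtain ⟨P, hP, hbound⟩ := ih h.shift
    obtain ⟨Q, hQ, hQd, -⟩ := exists_antiderivative m P hP
    refine ⟨Q + C (F 0 a - Q.eval a), ?_, fun x hx => ?_⟩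
    · rw [natDegree_add_C]
      exact hQd
    have hxΩ := Icc_subset_Ω ha hb hx
    have h1 : F 0 x - (Q + C (F 0 a - Q.eval a)).eval x = ∫ y in a..x, (F 1 y - P.eval y) := by
      rw [intervalIntegral.integral_sub
        (intervalIntegrable_of_integrable_Ω (h.integrable (by omega)) ha hxΩ)
        (P.continuous.intervalIntegrable _ _), ← hQ, integral_eval_derivative,
        ← (h.isPrimitive 0 (by omega)).sub_eq (h.integrable (by omega)) ha hxΩ]
      simp only [eval_add, eval_C]
      ring
    have hI : 0 ≤ ∫ y in a..b, |F (m + 1 + 1) y| :=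
      intervalIntegral.integral_nonneg hab fun _ _ => abs_nonneg _
    have hba : 0 ≤ b - a := sub_nonneg.2 hab
    rw [h1, ← Real.norm_eq_abs]
    refine (intervalIntegral.norm_integral_le_of_norm_le_const
      (C := (b - a) ^ m * ∫ y in a..b, |F (m + 1 + 1) y|) fun y hy => ?_).trans ?_
    · rw [uIoc_of_le hx.1] at hy
      exact hbound y ⟨hy.1.le, hy.2.trans hx.2⟩
    · rw [abs_of_nonneg (sub_nonneg.2 hx.1), pow_succ]
      have h2 : x - a ≤ b - a := by linarith [hx.2]
      have h3 : 0 ≤ (b - a) ^ m * ∫ y in a..b, |F (m + 1 + 1) y| := by positivity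
      nlinarith

/-- The embedding of H¹ into bounded functions: f(x) is compared with f(y), and the inequality is
averaged over y. -/
lemma IsPrimitive.sq_le {f f' : ℝ → ℝ} (h : IsPrimitive f f') (hf : MemLp f 2 μΩ)
    (hf' : MemLp f' 2 μΩ) {x : ℝ} (hx : x ∈ Ω) :
    f x ^ 2 ≤ 4 * Real.pi * l2sq f' + l2sq f := by
  have hpi := Real.pi_gt_three
  have h1 : ∀ y ∈ Ω, f x ^ 2 - 4 * Real.pi * l2sq f' ≤ 2 * f y ^ 2 := by
    intro y hy
    have e1 : |f x - f y| ≤ ∫ z in (0 : ℝ)..2 * Real.pi, |f' z| := by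
      rw [h.sub_eq (integrable_of_memLp_two hf') hy hx]
      have e0 := intervalIntegral.norm_integral_le_abs_integral_norm (f := f') (a := y) (b := x)
        (μ := volume)
      simp only [Real.norm_eq_abs] at e0
      refine e0.trans ?_
      have hi : Integrable (fun z => |f' z|) μΩ := (integrable_of_memLp_two hf').abs
      rcases le_total y x with hyx | hyx
      · rw [abs_of_nonneg (intervalIntegral.integral_nonneg hyx fun _ _ => abs_nonneg _)]
        exact intervalIntegral.integral_mono_interval hy.1 hyx hx.2
          (Filter.Eventually.of_forall fun _ => abs_nonneg _)
          (intervalIntegrable_of_integrable_Ω hi zero_mem_Ω two_pi_mem_Ω)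
      · rw [intervalIntegral.integral_symm, abs_neg,
          abs_of_nonneg (intervalIntegral.integral_nonneg hyx fun _ _ => abs_nonneg _)]
        exact intervalIntegral.integral_mono_interval hx.1 hyx hy.2
          (Filter.Eventually.of_forall fun _ => abs_nonneg _)
          (intervalIntegrable_of_integrable_Ω hi zero_mem_Ω two_pi_mem_Ω)
    have e2 := sq_integral_abs_le hf' zero_mem_Ω two_pi_mem_Ω two_pi_nonneg
    rw [← integral_Ω (fun x => f' x ^ 2), ← l2sq, sub_zero] at e2
    have e3 := pow_le_pow_left₀ (abs_nonneg _) e1 2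
    rw [sq_abs] at e3
    nlinarith [sq_nonneg (f x - 2 * f y)]
  have h2 : ∫ _ in Ω, (f x ^ 2 - 4 * Real.pi * l2sq f') ≤ ∫ y in Ω, 2 * f y ^ 2 := by
    refine setIntegral_mono_on ?_ (hf.integrable_sq.const_mul 2) measurableSet_Icc h1
    exact integrable_const (μ := μΩ) _
  rw [integral_const_mul, ← l2sq, integral_Ω, intervalIntegral.integral_const, smul_eq_mul] at h2
  have h3 := l2sq_nonneg f
  nlinarith

/-- The space derivatives of a smooth function on `[0, T] × Ω`. -/
lemma exists_isSmoothChain {T : ℝ} (hT : 0 < T) {g : ℝ → ℝ → ℝ}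
    (hg : ContDiffOn ℝ ∞ (fun p : ℝ × ℝ => g p.1 p.2) (Icc 0 T ×ˢ Ω)) :
    ∃ G : ℕ → ℝ → ℝ → ℝ, G 0 = g ∧
      (∀ j, ContinuousOn (fun p : ℝ × ℝ => G j p.1 p.2) (Icc 0 T ×ˢ Ω)) ∧
      ∀ t ∈ Icc 0 T, IsSmoothChain fun j => G j t := by
  set R := Icc 0 T ×ˢ Ω
  have hR : UniqueDiffOn ℝ R := (uniqueDiffOn_Icc hT).prod uniqueDiffOn_Ω
  -- Iterated derivatives in the direction (0, 1) within the rectangle, that is, in space at fixed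
  -- time.
  let H : ℕ → ℝ × ℝ → ℝ := fun j => Nat.rec (fun p => g p.1 p.2)
    (fun _ f p => fderivWithin ℝ f R p (0, 1)) j
  have hH : ∀ j, ContDiffOn ℝ ∞ (H j) R := by
    intro j
    induction j with
    | zero => exact hg
    | succ j ih => exact (ih.fderivWithin hR (by simp)).clm_apply contDiffOn_const
  have hslice : ∀ t ∈ Icc 0 T, MapsTo (fun x : ℝ => (t, x)) Ω R := fun t ht x hx => ⟨ht, hx⟩
  have hcont : ∀ j, ∀ t ∈ Icc 0 T, ContinuousOn (fun x => H j (t, x)) Ω := fun j t ht =>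
    (hH j).continuousOn.comp (by fun_prop) (hslice t ht)
  refine ⟨fun j t x => H j (t, x), rfl, fun j => (hH j).continuousOn, fun t ht =>
    ⟨fun j => hcont j t ht, fun j => .of_hasDerivWithinAt (fun x hx => ?_) (hcont (j + 1) t ht)⟩⟩
  have h1 : HasFDerivWithinAt (H j) (fderivWithin ℝ (H j) R (t, x)) R (t, x) :=
    ((hH j).differentiableOn (by simp) _ ⟨ht, hx⟩).hasFDerivWithinAt
  have h2 : HasDerivWithinAt (fun y : ℝ => (t, y)) ((0 : ℝ), (1 : ℝ)) Ω x :=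
    (hasDerivWithinAt_const x Ω t).prodMk (hasDerivWithinAt_id x Ω)
  exact h1.comp_hasDerivWithinAt x h2 (hslice t ht)

lemma exists_isSmoothChain_of_contDiffOn {α : ℝ → ℝ} (hα : ContDiffOn ℝ ∞ α Ω) :
    ∃ A : ℕ → ℝ → ℝ, A 0 = α ∧ IsSmoothChain A := by
  obtain ⟨G, h0, -, h2⟩ := exists_isSmoothChain one_pos (g := fun _ x => α x)
    (hα.comp contDiffOn_snd fun p hp => hp.2)
  exact ⟨fun j => G j 0, by simp only [h0], h2 0 ⟨le_rfl, zero_le_one⟩⟩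

lemma IsSmoothChain.exists_bound {A : ℕ → ℝ → ℝ} (hA : IsSmoothChain A) (m : ℕ) :
    ∃ M, 0 ≤ M ∧ ∀ j ≤ m, ∀ x ∈ Ω, |A j x| ≤ M := by
  choose C hC using fun j => isCompact_Ω.exists_bound_of_continuousOn (hA.continuousOn j)
  have hC0 : ∀ j, 0 ≤ C j := fun j => (norm_nonneg _).trans (hC j 0 zero_mem_Ω)
  refine ⟨∑ j ∈ Finset.range (m + 1), C j, Finset.sum_nonneg fun j _ => hC0 j, fun j hj x hx => ?_⟩
  exact (hC j x hx).trans (Finset.single_le_sum (fun i _ => hC0 i)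
    (Finset.mem_range.2 (Nat.lt_succ_of_le hj)))

lemma l2sq_leibniz_le {m : ℕ} {A U : ℕ → ℝ → ℝ} (hA : IsSmoothChain A) (hU : IsChain m U) {M : ℝ}
    (hM : ∀ j ≤ m, ∀ x ∈ Ω, |A j x| ≤ M) :
    l2sq (leibniz m A U) ≤
      (2 ^ m * M) ^ 2 * (m + 1) * ∑ j ∈ Finset.range (m + 1), l2sq (U j) := by
  have hint : ∀ j ∈ Finset.range (m + 1), Integrable (fun x => U j x ^ 2) μΩ := fun j hj =>
    (hU.memLp j (Nat.lt_succ_iff.1 (Finset.mem_range.1 hj))).integrable_sq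
  have e : ∑ j ∈ Finset.range (m + 1), l2sq (U j) =
      ∫ x in Ω, ∑ j ∈ Finset.range (m + 1), U j x ^ 2 := (integral_finsetSum _ hint).symm
  rw [e, ← integral_const_mul]
  refine setIntegral_mono_on (memLp_leibniz hA hU le_rfl).integrable_sq
    ((integrable_finsetSum _ hint).const_mul _) measurableSet_Icc fun x hx => ?_
  have h1 := abs_leibniz_le m A U x M fun i hi => hM i hi x hx
  have h2 := pow_le_pow_left₀ (abs_nonneg _) h1 2
  rw [sq_abs, mul_pow] at h2
  have h3 := sq_sum_le_card_mul_sum_sq (s := Finset.range (m + 1)) (f := fun i => |U i x|)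
  simp only [sq_abs, Finset.card_range, Nat.cast_add, Nat.cast_one] at h3
  calc leibniz m A U x ^ 2
      ≤ (2 ^ m * M) ^ 2 * (∑ i ∈ Finset.range (m + 1), |U i x|) ^ 2 := h2
    _ ≤ (2 ^ m * M) ^ 2 * ((m + 1) * ∑ i ∈ Finset.range (m + 1), U i x ^ 2) :=
        mul_le_mul_of_nonneg_left h3 (sq_nonneg _)
    _ = _ := by ring

/-- The exact solution is regular in space, and so is its time derivative, by the equation. -/
lemma IsSolution.exists_isChain {k : ℕ} (hk : 1 ≤ k) {T : ℝ} {α u₀ : ℝ → ℝ} {g u : ℝ → ℝ → ℝ}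
    (hu : IsSolution T α g u₀ u) {A : ℕ → ℝ → ℝ} (hA : IsSmoothChain A) (hA0 : A 0 = α)
    {G : ℕ → ℝ → ℝ → ℝ} (hG0 : G 0 = g) (hG : ∀ t ∈ Icc 0 T, IsSmoothChain fun j => G j t) {M : ℝ}
    (hM : ∀ j ≤ k + 2, ∀ x ∈ Ω, |A j x| ≤ M) {t : ℝ} (ht : t ∈ Icc 0 T)
    (hs : MemSobolev (k + 2) (u t)) :
    ∃ U W : ℕ → ℝ → ℝ, IsChain (k + 2) U ∧ U 0 = u t ∧ IsChain (k + 1) W ∧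
      (∀ x ∈ Ω, W 0 x = g t x - leibniz 1 A U x) ∧
      (∀ x ∈ Ω, derivWithin (fun s => u s x) (Icc 0 T) t = W 0 x) ∧
      ∀ B, 0 ≤ B → sobolevNorm (k + 2) (u t) ≤ ENNReal.ofReal B →
        sobolevNorm (k + 1) (g t) ≤ ENNReal.ofReal B →
        l2sq (W (k + 1)) ≤ 2 * (1 + (2 ^ (k + 2) * M) ^ 2 * (k + 3)) * B ^ 2 := by
  obtain ⟨U, hU, hU0⟩ := hs.exists_isChain (by omega)
    fun x hx => ((hu.differentiable_space t ht) x hx).continuousWithinAt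
  have hL := (IsChain.leibniz hA hU).shift
  have hGc := (hG t ht).isChain (k + 1)
  -- The derivatives of g - (α u)_x. One space derivative is spent on the flux, which is why u is
  -- required in H^(k+2).
  refine ⟨U, fun j x => G j t x - leibniz (j + 1) A U x, hU, hU0, hGc.sub hL,
    fun x hx => by simp [hG0], fun x hx => ?_, fun B hB hBu hBg => ?_⟩
  · have h1 : HasDerivWithinAt (fun y => α y * u t y) (leibniz 1 A U x) Ω x := by
      have := (IsChain.leibniz hA hU).hasDerivWithinAt (j := 0) (by omega) hx
      simpa only [leibniz, hA0, hU0] using this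
    have h2 := hu.equation t ht x hx
    rw [h1.derivWithin (uniqueDiffOn_Ω x hx)] at h2
    beta_reduce
    rw [hG0]
    linarith
  · rw [← hU0] at hBu
    have h1 := hU.sum_l2sq_le hB hBu
    have h2 := l2sq_leibniz_le hA hU hM
    have h3 : l2sq (G (k + 1) t) ≤ B ^ 2 := hGc.l2sq_le hB (by rw [hG0]; exact hBg) le_rfl
    have i1 := (hGc.memLp (k + 1) le_rfl).integrable_sq
    have i2 := (memLp_leibniz hA hU le_rfl).integrable_sq
    have h4 : l2sq (fun x => G (k + 1) t x - leibniz (k + 1 + 1) A U x) ≤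
        2 * l2sq (G (k + 1) t) + 2 * l2sq (leibniz (k + 2) A U) := by
      have e : 2 * l2sq (G (k + 1) t) + 2 * l2sq (leibniz (k + 2) A U) =
          ∫ x in Ω, (2 * G (k + 1) t x ^ 2 + 2 * leibniz (k + 2) A U x ^ 2) := by
        rw [l2sq, l2sq, ← integral_const_mul, ← integral_const_mul]
        exact (integral_add (i1.const_mul 2) (i2.const_mul 2)).symm
      rw [e]
      refine setIntegral_mono_on ((hGc.sub hL).memLp (k + 1) le_rfl).integrable_sq
        ((i1.const_mul 2).add (i2.const_mul 2)) measurableSet_Icc fun x _ => ?_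
      nlinarith [sq_nonneg (G (k + 1) t x + leibniz (k + 2) A U x)]
    have h5 : 0 ≤ (2 ^ (k + 2) * M) ^ 2 * ((k : ℝ) + 3) := by positivity
    have h6 := mul_le_mul_of_nonneg_left h1 h5
    push_cast at h2
    have h7 : (2 ^ (k + 2) * M) ^ 2 * ((k : ℝ) + 2 + 1) = (2 ^ (k + 2) * M) ^ 2 * ((k : ℝ) + 3) := by
      ring
    rw [h7] at h2
    have h8 : ∑ j ∈ Finset.range (k + 2 + 1), l2sq (U j) ≤ B ^ 2 := h1
    calc l2sq (fun x => G (k + 1) t x - leibniz (k + 1 + 1) A U x)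
        ≤ 2 * l2sq (G (k + 1) t) + 2 * l2sq (leibniz (k + 2) A U) := h4
      _ ≤ 2 * B ^ 2 + 2 * ((2 ^ (k + 2) * M) ^ 2 * (k + 3) * B ^ 2) := by linarith
      _ = _ := by ring

/-! ### Meshes -/

namespace Mesh

variable {N : ℕ} (M : Mesh N)

lemma node_mem (i : Fin (N + 1)) : M.node i ∈ Ω := by
  rw [Ω, ← M.first, ← M.last]
  exact ⟨M.strictMono.monotone (Fin.zero_le _), M.strictMono.monotone (Fin.le_last _)⟩

lemma left_mem (i : Fin N) : M.left i ∈ Ω := M.node_mem _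

lemma right_mem (i : Fin N) : M.right i ∈ Ω := M.node_mem _

lemma left_lt_right (i : Fin N) : M.left i < M.right i := M.strictMono i.castSucc_lt_succ

lemma length_pos (i : Fin N) : 0 < M.length i := sub_pos.2 (M.left_lt_right i)

lemma length_le_h (i : Fin N) : M.length i ≤ M.h :=
  le_ciSup (Set.finite_range M.length).bddAbove i

lemma h_pos [NeZero N] : 0 < M.h := (M.length_pos 0).trans_le (M.length_le_h 0)

lemma point_neg_one (i : Fin N) : M.point i (-1) = M.left i := by
  rw [point, length]
  ring

lemma point_one (i : Fin N) : M.point i 1 = M.right i := by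
  rw [point, length]
  ring

lemma point_mem (i : Fin N) {x : ℝ} (hx : x ∈ Icc (-1 : ℝ) 1) :
    M.point i x ∈ Icc (M.left i) (M.right i) := by
  have h := M.length_pos i
  rw [← M.point_neg_one, ← M.point_one, point, point, point]
  constructor
  · nlinarith [hx.1]
  · nlinarith [hx.2]

lemma point_mem_Ω (i : Fin N) {x : ℝ} (hx : x ∈ Icc (-1 : ℝ) 1) : M.point i x ∈ Ω :=
  Icc_subset_Ω (M.left_mem i) (M.right_mem i) (M.point_mem i hx)

lemma exists_point_eq (i : Fin N) {x : ℝ} (hx : x ∈ Icc (M.left i) (M.right i)) :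
    ∃ r ∈ Icc (-1 : ℝ) 1, M.point i r = x := by
  have h := M.length_pos i
  refine ⟨(x - (M.left i + M.right i) / 2) / (M.length i / 2), ⟨?_, ?_⟩, ?_⟩
  · rw [le_div_iff₀ (by positivity), length]
    linarith [hx.1]
  · rw [div_le_iff₀ (by positivity), length]
    linarith [hx.2]
  · rw [point]
    field_simp
    ring

lemma point_injective (i : Fin N) : Function.Injective (M.point i) := by
  intro x y hxy
  have h := M.length_pos i
  rw [point, point, add_left_inj] at hxy
  exact mul_left_cancel₀ (by positivity) hxy

lemma integral_point (i : Fin N) (f : ℝ → ℝ) (a b : ℝ) :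
    ∫ x in M.point i a..M.point i b, f x =
      M.length i / 2 * ∫ r in a..b, f (M.point i r) :=
  (intervalIntegral.mul_integral_comp_mul_add (f := f) (M.length i / 2)
    ((M.left i + M.right i) / 2)).symm

open Polynomial in
lemma exists_comp_point (i : Fin N) (p : ℝ[X]) :
    ∃ q : ℝ[X], q.natDegree ≤ p.natDegree ∧ ∀ x, q.eval x = p.eval (M.point i x) := by
  refine ⟨p.comp (C (M.length i / 2) * X + C ((M.left i + M.right i) / 2)), ?_, fun x => ?_⟩
  · refine natDegree_comp_le.trans ?_
    exact (Nat.mul_le_mul_left _ natDegree_linear_le).trans (by simp)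
  · simp [eval_comp, point]

lemma sum_sub (f : ℝ → ℝ) :
    ∑ i, (f (M.right i) - f (M.left i)) = f (2 * Real.pi) - f 0 := by
  have h1 := Fin.sum_univ_castSucc fun i => f (M.node i)
  have h2 := Fin.sum_univ_succ fun i => f (M.node i)
  rw [M.last] at h1
  rw [M.first] at h2
  rw [Finset.sum_sub_distrib]
  simp only [left, right]
  linarith

lemma sum_integral {f : ℝ → ℝ} (hf : Integrable f μΩ) :
    ∑ i, ∫ x in M.left i..M.right i, f x = ∫ x in Ω, f x := by
  rw [integral_Ω]
  have h := M.sum_sub fun x => ∫ y in (0 : ℝ)..x, f y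
  rw [intervalIntegral.integral_same, sub_zero] at h
  rw [← h]
  refine Finset.sum_congr rfl fun i _ => ?_
  rw [intervalIntegral.integral_interval_sub_left
    (intervalIntegrable_of_integrable_Ω hf zero_mem_Ω (M.right_mem i))
    (intervalIntegrable_of_integrable_Ω hf zero_mem_Ω (M.left_mem i))]

/-- After the last element the index wraps to 0, where the two points 0 and 2π are identified by the
periodicity of f. -/
lemma apply_left_add_one [NeZero N] {f : ℝ → ℝ} (hf : f 0 = f (2 * Real.pi)) (i : Fin N) :
    f (M.left (i + 1)) = f (M.right i) := by
  obtain ⟨n, rfl⟩ : ∃ n, N = n + 1 := ⟨N - 1, by have := NeZero.ne N; omega⟩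
  refine Fin.lastCases ?_ (fun j => ?_) i
  · have h0 : (Fin.last n + 1 : Fin (n + 1)) = 0 := by simp
    rw [h0, left, right, Fin.castSucc_zero, M.first, Fin.succ_last, M.last, hf]
  · have h1 : (j.castSucc + 1 : Fin (n + 1)) = j.succ := by simp
    rw [h1, left, right, ← Fin.succ_castSucc]

lemma apply_right_sub_one [NeZero N] {f : ℝ → ℝ} (hf : f 0 = f (2 * Real.pi)) (i : Fin N) :
    f (M.right (i - 1)) = f (M.left i) := by
  rw [← M.apply_left_add_one hf, sub_add_cancel]

lemma toFun_eq (v : Fin N → ℝ[X]) (i : Fin N) {x : ℝ} (hx : x ∈ Ico (M.left i) (M.right i)) :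
    M.toFun v x = (v i).eval x := by
  rw [toFun, Finset.sum_eq_single i]
  · rw [indicator_of_mem hx]
  · intro j _ hj
    refine indicator_of_notMem (fun hxj => ?_) _
    rcases lt_or_gt_of_ne hj with h | h
    · have : M.right j ≤ M.left i :=
        M.strictMono.monotone (Fin.succ_le_castSucc_iff.2 h)
      linarith [hx.1, hxj.2]
    · have : M.right i ≤ M.left j :=
        M.strictMono.monotone (Fin.succ_le_castSucc_iff.2 h)
      linarith [hx.2, hxj.1]
  · simp

lemma memLp_toFun (v : Fin N → ℝ[X]) : MemLp (M.toFun v) 2 μΩ := by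
  have : M.toFun v = fun x =>
      ∑ i, (Ico (M.left i) (M.right i)).indicator (fun y => (v i).eval y) x := rfl
  rw [this]
  exact memLp_finsetSum _ fun i _ =>
    (memLp_of_continuousOn (v i).continuous.continuousOn).indicator measurableSet_Ico

lemma abs_sub_le (i : Fin N) {x y : ℝ} (hx : x ∈ Icc (M.left i) (M.right i))
    (hy : y ∈ Icc (M.left i) (M.right i)) : |x - y| ≤ M.length i := by
  rw [abs_le, length]
  constructor <;> linarith [hx.1, hx.2, hy.1, hy.2]

end Mesh

lemma IsSmoothChain.abs_sub_le {A : ℕ → ℝ → ℝ} (hA : IsSmoothChain A) {L : ℝ}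
    (hL : ∀ x ∈ Ω, |A 1 x| ≤ L) {x y : ℝ} (hx : x ∈ Ω) (hy : y ∈ Ω) :
    |A 0 x - A 0 y| ≤ L * |x - y| := by
  rw [(hA.isPrimitive 0).sub_eq (integrable_of_memLp_two
    (memLp_of_continuousOn (hA.continuousOn 1))) hy hx, ← Real.norm_eq_abs]
  exact intervalIntegral.norm_integral_le_of_norm_le_const fun z hz =>
    hL z (uIcc_subset_Ω hy hx (uIoc_subset_uIcc hz))

/-- Where the velocity is not of one strict sign at the ends of an element, it is small. -/
lemma Mesh.abs_le_of_not_sign {N : ℕ} (M : Mesh N) (i : Fin N) {α : ℝ → ℝ} (hα : ContinuousOn α Ω)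
    {L : ℝ} (hL : ∀ x ∈ Ω, ∀ y ∈ Ω, |α x - α y| ≤ L * |x - y|) (hL0 : 0 ≤ L)
    (h1 : ¬(0 < α (M.left i) ∧ 0 < α (M.right i)))
    (h2 : ¬(α (M.left i) < 0 ∧ α (M.right i) < 0)) {x : ℝ} (hx : x ∈ Icc (M.left i) (M.right i)) :
    |α x| ≤ L * M.length i := by
  have hsub := Icc_subset_Ω (M.left_mem i) (M.right_mem i)
  have hle := (M.left_lt_right i).le
  obtain ⟨z, hz, hz0⟩ : ∃ z ∈ Icc (M.left i) (M.right i), α z = 0 := by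
    rcases le_total (α (M.left i)) 0 with hl | hl
    · have hr : 0 ≤ α (M.right i) ∨ α (M.left i) = 0 := by
        by_contra! h
        exact h2 ⟨lt_of_le_of_ne hl h.2, h.1⟩
      rcases hr with hr | hr
      · exact intermediate_value_Icc hle (hα.mono hsub) ⟨hl, hr⟩
      · exact ⟨_, ⟨le_rfl, hle⟩, hr⟩
    · have hr : α (M.right i) ≤ 0 ∨ α (M.left i) = 0 := by
        by_contra! h
        exact h1 ⟨lt_of_le_of_ne hl h.2.symm, h.1⟩
      rcases hr with hr | hr
      · exact intermediate_value_Icc' hle (hα.mono hsub) ⟨hr, hl⟩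
      · exact ⟨_, ⟨le_rfl, hle⟩, hr⟩
  have := hL x (hsub hx) z (hsub hz)
  rw [hz0, sub_zero] at this
  exact this.trans (mul_le_mul_of_nonneg_left (M.abs_sub_le i hx hz) hL0)

/-! ### Interpolation -/

/-- If the flux at the right end is upwinded from this element, the interpolant is exact there. The
next lemma is the mirror image. -/
lemma omitted_ne_last {N k : ℕ} (α : ℝ → ℝ) (M : Mesh N) (i : Fin N) (h : 0 < α (M.right i)) :
    omitted α M k i ≠ Fin.last (k + 1) := by
  rw [omitted]
  split_ifs with h1 h2
  · exact Fin.last_pos.ne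
  · exact absurd h2.2 (not_lt.2 h.le)
  · exact (Fin.castSucc_lt_last _).ne

lemma omitted_ne_zero {N k : ℕ} (hk : 1 ≤ k) (α : ℝ → ℝ) (M : Mesh N) (i : Fin N)
    (h : α (M.left i) < 0) : omitted α M k i ≠ 0 := by
  rw [omitted]
  split_ifs with h1 h2
  · exact absurd h1.1 (not_le.2 h)
  · exact Fin.last_pos.ne'
  · intro h0
    have := congrArg Fin.val h0
    simp at this
    omega

/-- If an inner point of an element is omitted, then the velocity is not of one strict sign at its
ends. -/
lemma not_sign_of_omitted {N k : ℕ} (α : ℝ → ℝ) (M : Mesh N) (i : Fin N)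
    (h0 : omitted α M k i ≠ 0) (h1 : omitted α M k i ≠ Fin.last (k + 1)) :
    ¬(0 < α (M.left i) ∧ 0 < α (M.right i)) ∧ ¬(α (M.left i) < 0 ∧ α (M.right i) < 0) := by
  rw [omitted] at h0 h1
  constructor
  · intro h
    rw [if_pos ⟨h.1.le, h.2⟩] at h0
    exact h0 rfl
  · intro h
    rw [if_neg (fun h' => absurd h'.2 (not_lt.2 h.2.le)), if_pos ⟨h.1.le, h.2⟩] at h1
    exact h1 rfl

/-- Interpolation on the reference element at all nodes of `s` but `s o`. -/
def refInterp {k : ℕ} (s : Fin (k + 2) → ℝ) (o : Fin (k + 2)) : (Fin (k + 2) → ℝ) →ₗ[ℝ] ℝ[X] :=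
  Lagrange.interpolate (Finset.univ.erase o) s

section refInterp

variable {k : ℕ} {s : Fin (k + 2) → ℝ} (o : Fin (k + 2)) (d : Fin (k + 2) → ℝ)

lemma card_univ_erase (o : Fin (k + 2)) : (Finset.univ.erase o).card = k + 1 := by
  rw [Finset.card_erase_of_mem (by simp)]
  simp

lemma natDegree_refInterp_le (hs : IsPartition s) : (refInterp s o d).natDegree ≤ k := by
  have h := Lagrange.degree_interpolate_lt d
    (hs.strictMono.injective.injOn (s := ↑(Finset.univ.erase o)))
  rw [card_univ_erase] at h
  refine Polynomial.natDegree_le_iff_degree_le.2 ?_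
  exact Order.le_of_lt_succ (by exact_mod_cast h)

lemma eval_refInterp (hs : IsPartition s) {j : Fin (k + 2)} (hj : j ≠ o) :
    (refInterp s o d).eval (s j) = d j :=
  Lagrange.eval_interpolate_at_node d hs.strictMono.injective.injOn (by simp [hj])

lemma refInterp_eval (hs : IsPartition s) {p : ℝ[X]} (hp : p.natDegree ≤ k) :
    refInterp s o (fun j => p.eval (s j)) = p := by
  symm
  refine Lagrange.eq_interpolate_of_eval_eq _ hs.strictMono.injective.injOn ?_ fun i _ => rfl
  rw [card_univ_erase]
  exact lt_of_le_of_lt Polynomial.degree_le_natDegree (by exact_mod_cast Nat.lt_succ_of_le hp)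

lemma refInterp_eq_zero (h : ∀ j, j ≠ o → d j = 0) : refInterp s o d = 0 :=
  (Lagrange.interpolate_eq_of_values_eq_on (v := s) d 0 fun j hj =>
    h j (Finset.ne_of_mem_erase hj)).trans (map_zero _)

/-- The interpolation error on one element. -/
lemma IsChain.abs_sub_refInterp_le {N : ℕ} (M : Mesh N) (i : Fin N) (hs : IsReference s) {K : ℝ}
    (hK : IsReferenceBound k K) {F : ℕ → ℝ → ℝ} (hF : IsChain (k + 1) F) {x : ℝ}
    (hx : x ∈ Icc (-1 : ℝ) 1) :
    |F 0 (M.point i x) - (refInterp s o fun j => F 0 (M.point i (s j))).eval x| ≤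
      (1 + K) * (M.length i ^ k * ∫ y in M.left i..M.right i, |F (k + 1) y|) := by
  obtain ⟨P, hP, hPb⟩ := hF.exists_taylor (M.left_mem i) (M.right_mem i) (M.left_lt_right i).le
  obtain ⟨Q, hQ, hQe⟩ := M.exists_comp_point i P
  set b := M.length i ^ k * ∫ y in M.left i..M.right i, |F (k + 1) y|
  have hb : ∀ r ∈ Icc (-1 : ℝ) 1, |F 0 (M.point i r) - Q.eval r| ≤ b := fun r hr => by
    rw [hQe]
    exact hPb _ (M.point_mem i hr)
  -- Interpolation reproduces the Taylor polynomial, so its error only sees F - Q.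
  have h1 : (refInterp s o fun j => F 0 (M.point i (s j))) =
      Q + refInterp s o fun j => F 0 (M.point i (s j)) - Q.eval (s j) := by
    conv_rhs => rw [← refInterp_eval o hs.1 (hQ.trans hP), ← map_add]
    rw [refInterp_eval o hs.1 (hQ.trans hP)]
    congr 1
    funext j
    simp
  have h2 : |(refInterp s o fun j => F 0 (M.point i (s j)) - Q.eval (s j)).eval x| ≤ K * b :=
    hK.interpolate_le s hs o _ b ((abs_nonneg _).trans (hb 1 (by norm_num)))
      (fun j _ => hb _ (hs.1.mem_Icc j)) x hx
  have h3 := hb x hx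
  rw [h1, Polynomial.eval_add]
  rw [abs_le] at *
  constructor <;> nlinarith [h2.1, h2.2, h3.1, h3.2]

/-- Differentiability in time is known only at each fixed point x. Interpolated polynomials are
finite combinations of nodal values with coefficients constant in time, so this suffices; the same
is done below for the quadratic form `refMass`. -/
lemma hasDerivWithinAt_eval_refInterp {v : ℝ → Fin (k + 2) → ℝ} {v' : Fin (k + 2) → ℝ} {S : Set ℝ}
    {t : ℝ} (h : ∀ j, HasDerivWithinAt (fun τ => v τ j) (v' j) S t) (x : ℝ) :
    HasDerivWithinAt (fun τ => (refInterp s o (v τ)).eval x) ((refInterp s o v').eval x) S t := by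
  simp only [refInterp, Lagrange.interpolate_apply, Polynomial.eval_finsetSum, Polynomial.eval_mul,
    Polynomial.eval_C]
  exact HasDerivWithinAt.fun_sum fun j _ => (h j).mul_const _

lemma refMass_refInterp (c : ℝ) (v w : Fin (k + 2) → ℝ) :
    refMass k c (refInterp s o v) (refInterp s o w) =
      ∑ i ∈ Finset.univ.erase o, ∑ j ∈ Finset.univ.erase o, v i * w j *
        refMass k c (Lagrange.basis (Finset.univ.erase o) s i)
          (Lagrange.basis (Finset.univ.erase o) s j) := by
  simp only [refMass, mul_add, Finset.sum_add_distrib]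
  congr 1
  · simp only [refInterp, Lagrange.interpolate_apply, Finset.sum_mul_sum, map_sum]
    refine Finset.sum_congr rfl fun i _ => Finset.sum_congr rfl fun j _ => ?_
    rw [show ∀ a b : ℝ, ∀ p q : ℝ[X], Polynomial.C a * p * (Polynomial.C b * q) =
      (a * b) • (p * q) from fun a b p q => by rw [Polynomial.smul_eq_C_mul, Polynomial.C_mul]; ring,
      map_smul, smul_eq_mul]
  · simp only [refInterp, Lagrange.interpolate_apply, Polynomial.finsetSum_coeff,
      Polynomial.coeff_C_mul]
    rw [mul_assoc, Finset.sum_mul_sum, Finset.mul_sum]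
    refine Finset.sum_congr rfl fun i _ => ?_
    rw [Finset.mul_sum]
    refine Finset.sum_congr rfl fun j _ => ?_
    ring

lemma hasDerivWithinAt_refMass (c : ℝ) {v : ℝ → Fin (k + 2) → ℝ} {v' : Fin (k + 2) → ℝ} {S : Set ℝ}
    {t : ℝ} (h : ∀ j, HasDerivWithinAt (fun τ => v τ j) (v' j) S t) :
    HasDerivWithinAt (fun τ => refMass k c (refInterp s o (v τ)) (refInterp s o (v τ)))
      (2 * refMass k c (refInterp s o v') (refInterp s o (v t))) S t := by
  have h1 : HasDerivWithinAt (fun τ => refMass k c (refInterp s o (v τ)) (refInterp s o (v τ)))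
      (refMass k c (refInterp s o v') (refInterp s o (v t)) +
        refMass k c (refInterp s o (v t)) (refInterp s o v')) S t := by
    simp only [refMass_refInterp, ← Finset.sum_add_distrib, ← add_mul]
    exact HasDerivWithinAt.fun_sum fun i _ => HasDerivWithinAt.fun_sum fun j _ =>
      ((h i).mul (h j)).mul_const _
  rw [refMass_comm k c (refInterp s o (v t)), ← two_mul] at h1
  exact h1

end refInterp

/-! ### The error equation on one element -/

section Error

variable {N k : ℕ} (α : ℝ → ℝ) (M : Mesh N) (s : Fin N → Fin (k + 2) → ℝ)

/-- The difference of numerical and exact solution at the points of the element `i`. -/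
def errNode (u : ℝ → ℝ → ℝ) (uh : ℝ → Fin N → ℝ[X]) (t : ℝ) (i : Fin N) (j : Fin (k + 2)) : ℝ :=
  (uh t i).eval (M.point i (s i j)) - u t (M.point i (s i j))

/-- The polynomial `u_h - I_h u` on the element `i`, transformed to the reference element. -/
def errPoly (u : ℝ → ℝ → ℝ) (uh : ℝ → Fin N → ℝ[X]) (t : ℝ) (i : Fin N) : ℝ[X] :=
  refInterp (s i) (omitted α M k i) (errNode M s u uh t i)

/-- The time derivative of `errPoly`. -/
def errPolyDeriv (T : ℝ) (u : ℝ → ℝ → ℝ) (uh : ℝ → Fin N → ℝ[X]) (t : ℝ) (i : Fin N) : ℝ[X] :=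
  refInterp (s i) (omitted α M k i) fun j =>
    derivWithin (fun τ => errNode M s u uh τ i j) (Icc 0 T) t

/-- The upwind value at the left end of the element `i` for polynomials on the reference element. -/
def refUpwindLeft [NeZero N] (p : Fin N → ℝ[X]) (i : Fin N) : ℝ :=
  if 0 < α (M.left i) then (p (i - 1)).eval 1 else (p i).eval (-1)

/-- The upwind value at the right end of the element `i` for polynomials on the reference
element. -/
def refUpwindRight [NeZero N] (p : Fin N → ℝ[X]) (i : Fin N) : ℝ :=
  if 0 < α (M.right i) then (p i).eval 1 else (p (i + 1)).eval (-1)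

/-- The flux `α v̂` of polynomials on the reference element. -/
def refFlux [NeZero N] (p : Fin N → ℝ[X]) (i : Fin N) (j : Fin (k + 2)) : ℝ :=
  α (M.point i (s i j)) *
    if j = 0 then refUpwindLeft α M p i
    else if j = Fin.last (k + 1) then refUpwindRight α M p i
    else (p i).eval (s i j)

variable {α M s}

/-- Interpolation is linear and leaves the polynomial u_h unchanged, so interpolating the nodal
values of u_h - u gives u_h - I_h u. -/
lemma eval_point_eq_errPoly_add {u : ℝ → ℝ → ℝ} {uh : ℝ → Fin N → ℝ[X]} {t : ℝ} {i : Fin N}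
    (hs : IsPartition (s i)) (hd : (uh t i).natDegree ≤ k) (x : ℝ) :
    (uh t i).eval (M.point i x) = (errPoly α M s u uh t i).eval x +
      (refInterp (s i) (omitted α M k i) fun j => u t (M.point i (s i j))).eval x := by
  obtain ⟨Q, hQ, hQe⟩ := M.exists_comp_point i (uh t i)
  rw [← hQe, ← Polynomial.eval_add, errPoly, ← map_add,
    ← refInterp_eval (omitted α M k i) hs (hQ.trans hd)]
  congr 2
  funext j
  simp [errNode, hQe]

lemma interp_at_point {u : ℝ → ℝ} {i : Fin N} (hs : IsPartition (s i)) {j : Fin (k + 2)}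
    (hj : j ≠ omitted α M k i) :
    (refInterp (s i) (omitted α M k i) fun j => u (M.point i (s i j))).eval (s i j) =
      u (M.point i (s i j)) :=
  eval_refInterp _ _ hs hj

lemma eval_right_eq {u : ℝ → ℝ → ℝ} {uh : ℝ → Fin N → ℝ[X]} {t : ℝ} {i : Fin N}
    (hs : IsPartition (s i)) (hd : (uh t i).natDegree ≤ k) (h : 0 < α (M.right i)) :
    (uh t i).eval (M.right i) = (errPoly α M s u uh t i).eval 1 + u t (M.right i) := by
  have h1 := eval_point_eq_errPoly_add (α := α) (M := M) (u := u) hs hd 1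
  have h2 := interp_at_point (α := α) (M := M) (u := u t) hs (omitted_ne_last α M i h).symm
  rw [hs.last] at h2
  rw [h2, M.point_one] at h1
  exact h1

lemma eval_left_eq (hk : 1 ≤ k) {u : ℝ → ℝ → ℝ} {uh : ℝ → Fin N → ℝ[X]} {t : ℝ} {i : Fin N}
    (hs : IsPartition (s i)) (hd : (uh t i).natDegree ≤ k) (h : α (M.left i) < 0) :
    (uh t i).eval (M.left i) = (errPoly α M s u uh t i).eval (-1) + u t (M.left i) := by
  have h1 := eval_point_eq_errPoly_add (α := α) (M := M) (u := u) hs hd (-1)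
  have h2 := interp_at_point (α := α) (M := M) (u := u t) hs (omitted_ne_zero hk α M i h).symm
  rw [hs.first] at h2
  rw [h2, M.point_neg_one] at h1
  exact h1

/-- The fluxes of the error and of `u_h - I_h u` agree up to higher order terms. -/
lemma abs_flux_sub_le [NeZero N] (hk : 1 ≤ k) (hper : α 0 = α (2 * Real.pi))
    (hαc : ContinuousOn α Ω) {L : ℝ} (hL : ∀ x ∈ Ω, ∀ y ∈ Ω, |α x - α y| ≤ L * |x - y|)
    (hL0 : 0 ≤ L) (hs : ∀ i, IsPartition (s i)) {u : ℝ → ℝ → ℝ} {uh : ℝ → Fin N → ℝ[X]} {t : ℝ}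
    (hd : ∀ i, (uh t i).natDegree ≤ k) (hup : u t 0 = u t (2 * Real.pi)) (i : Fin N) {b : ℝ}
    (hb : ∀ x ∈ Icc (-1 : ℝ) 1, |u t (M.point i x) -
      (refInterp (s i) (omitted α M k i) fun j => u t (M.point i (s i j))).eval x| ≤ b)
    (j : Fin (k + 2)) :
    |flux α M s (uh t) i j - α (M.point i (s i j)) * u t (M.point i (s i j)) -
      refFlux α M s (errPoly α M s u uh t) i j| ≤ L * M.length i * b := by
  have hb0 : 0 ≤ b := (abs_nonneg _).trans (hb 1 (by norm_num))
  have hrhs : 0 ≤ L * M.length i * b := by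
    have := (M.length_pos i).le
    positivity
  have hzero : ∀ {x : ℝ}, x = 0 → |x| ≤ L * M.length i * b := fun h => by
    rw [h, abs_zero]
    exact hrhs
  by_cases hj0 : j = 0
  · subst hj0
    apply hzero
    rw [flux, refFlux, if_pos rfl, if_pos rfl, (hs i).first, M.point_neg_one, upwindLeft,
      refUpwindLeft]
    by_cases hpos : 0 < α (M.left i)
    -- The upwind value comes from the left neighbour, whose right end carries positive velocity and
    -- is therefore one of its interpolation points. In the other case the velocity is zero, or
    -- negative and the same holds for this element at its left end.
    · have hr : α (M.right (i - 1)) = α (M.left i) := M.apply_right_sub_one hper i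
      have h1 := eval_right_eq (α := α) (M := M) (u := u) (hs (i - 1)) (hd (i - 1)) (by rw [hr]; exact hpos)
      rw [if_pos hpos, if_pos hpos, h1, M.apply_right_sub_one hup i]
      ring
    · rw [if_neg hpos, if_neg hpos]
      rcases (not_lt.1 hpos).eq_or_lt with h0 | hneg
      · rw [h0]
        ring
      · rw [eval_left_eq (u := u) hk (hs i) (hd i) hneg]
        ring
  · by_cases hjl : j = Fin.last (k + 1)
    · subst hjl
      apply hzero
      rw [flux, refFlux, if_neg hj0, if_pos rfl, if_neg hj0, if_pos rfl, (hs i).last, M.point_one,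
        upwindRight, refUpwindRight]
      by_cases hpos : 0 < α (M.right i)
      · rw [if_pos hpos, if_pos hpos, eval_right_eq (u := u) (hs i) (hd i) hpos]
        ring
      · rw [if_neg hpos, if_neg hpos]
        rcases (not_lt.1 hpos).eq_or_lt with h0 | hneg
        · rw [h0]
          ring
        · have hl : α (M.left (i + 1)) = α (M.right i) := M.apply_left_add_one hper i
          rw [eval_left_eq (α := α) (M := M) (u := u) hk (hs (i + 1)) (hd (i + 1)) (by rw [hl]; exact hneg),
            M.apply_left_add_one hup i]
          ring
    · rw [flux, refFlux, if_neg hj0, if_neg hjl, if_neg hj0, if_neg hjl,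
        eval_point_eq_errPoly_add (α := α) (u := u) (hs i) (hd i)]
      by_cases hjo : j = omitted α M k i
      · obtain ⟨h1, h2⟩ := not_sign_of_omitted α M i (hjo ▸ hj0) (hjo ▸ hjl)
        have hsj := (hs i).mem_Icc j
        have h3 := M.abs_le_of_not_sign i hαc hL hL0 h1 h2 (M.point_mem i hsj)
        have h4 := hb _ hsj
        rw [abs_sub_comm] at h4
        refine le_trans (le_of_eq ?_) (mul_le_mul h3 h4 (abs_nonneg _)
          ((abs_nonneg _).trans h3))
        rw [← abs_mul]
        congr 1
        ring
      · apply hzero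
        rw [interp_at_point (u := u t) (hs i) hjo]
        ring

/-- The error equation. -/
lemma IsSVSolution.error_eq [NeZero N] {T : ℝ} (hT : 0 < T) {g u : ℝ → ℝ → ℝ} {u₀ : ℝ → ℝ}
    {uh : ℝ → Fin N → ℝ[X]} (huh : IsSVSolution α M s T g uh) (hu : IsSolution T α g u₀ u)
    (hs : ∀ i, IsPartition (s i)) {t : ℝ} (ht : t ∈ Icc 0 T) {A U W : ℕ → ℝ → ℝ}
    (hA : IsSmoothChain A) (hA0 : A 0 = α) (hU : IsChain (k + 2) U) (hU0 : U 0 = u t)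
    (hW : IsChain (k + 1) W) (hgi : Integrable (g t) μΩ)
    (hW1 : ∀ x ∈ Ω, W 0 x = g t x - leibniz 1 A U x)
    (hW2 : ∀ x ∈ Ω, derivWithin (fun τ => u τ x) (Icc 0 T) t = W 0 x) (i : Fin N)
    (j : Fin (k + 1)) :
    M.length i / 2 *
        (∫ x in s i j.castSucc..s i j.succ, (errPolyDeriv α M s T u uh t i).eval x) +
        (flux α M s (uh t) i j.succ - α (M.point i (s i j.succ)) * u t (M.point i (s i j.succ))) -
        (flux α M s (uh t) i j.castSucc -
          α (M.point i (s i j.castSucc)) * u t (M.point i (s i j.castSucc))) =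
      M.length i / 2 * ∫ x in s i j.castSucc..s i j.succ, (W 0 (M.point i x) -
        (refInterp (s i) (omitted α M k i) fun j => W 0 (M.point i (s i j))).eval x) := by
  set a := s i j.castSucc
  set b := s i j.succ
  set q := refInterp (s i) (omitted α M k i) fun j => W 0 (M.point i (s i j))
  have ha : a ∈ Icc (-1 : ℝ) 1 := (hs i).mem_Icc _
  have hb : b ∈ Icc (-1 : ℝ) 1 := (hs i).mem_Icc _
  have hab : a ≤ b := (hs i).strictMono.monotone j.castSucc_lt_succ.le
  have hUD : UniqueDiffWithinAt ℝ (Icc 0 T) t := uniqueDiffOn_Icc hT t ht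
  -- At the nodes the time derivative of u_h is that of the error plus u_t, and u_t = W 0.
  have hnode : ∀ j', HasDerivWithinAt (fun τ => (uh τ i).eval (M.point i (s i j')))
      (derivWithin (fun τ => errNode M s u uh τ i j') (Icc 0 T) t + W 0 (M.point i (s i j')))
      (Icc 0 T) t := by
    intro j'
    have h1 := (huh.differentiable i (M.point i (s i j')) t ht).hasDerivWithinAt
    have hmem := M.point_mem_Ω i ((hs i).mem_Icc j')
    have h2 := (hu.differentiable_time _ hmem t ht).hasDerivWithinAt
    rw [hW2 _ hmem] at h2
    have h3 := (h1.sub h2).derivWithin hUD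
    have h4 : derivWithin (fun τ => errNode M s u uh τ i j') (Icc 0 T) t =
        derivWithin (fun τ => (uh τ i).eval (M.point i (s i j'))) (Icc 0 T) t -
          W 0 (M.point i (s i j')) := h3
    rw [h4, sub_add_cancel]
    exact h1
  -- Since u_h equals its own interpolant, so does its time derivative; hence (u_h)_t is the error
  -- part plus the interpolant of u_t.
  have hder : ∀ x, derivWithin (fun τ => (uh τ i).eval (M.point i x)) (Icc 0 T) t =
      (errPolyDeriv α M s T u uh t i).eval x + q.eval x := by
    intro x
    have h1 := hasDerivWithinAt_eval_refInterp (s := s i) (omitted α M k i) hnode x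
    have h2 : ∀ τ ∈ Icc 0 T, (uh τ i).eval (M.point i x) = (refInterp (s i) (omitted α M k i)
        fun j' => (uh τ i).eval (M.point i (s i j'))).eval x := by
      intro τ hτ
      obtain ⟨Q, hQ, hQe⟩ := M.exists_comp_point i (uh τ i)
      simp only [← hQe]
      rw [refInterp_eval _ (hs i) (hQ.trans (huh.natDegree_le τ hτ i))]
    rw [(h1.congr h2 (h2 t ht)).derivWithin hUD, errPolyDeriv, ← Polynomial.eval_add, ← map_add]
    rfl
  have hscheme := huh.scheme t ht i j
  rw [M.integral_point] at hscheme
  simp only [hder] at hscheme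
  -- The exact solution satisfies the same conservation law on the control volume; subtracting it
  -- leaves u_t minus its interpolant on the right.
  have hexact : ∫ x in M.point i a..M.point i b, W 0 x = (∫ x in M.point i a..M.point i b, g t x) -
      (α (M.point i b) * u t (M.point i b) - α (M.point i a) * u t (M.point i a)) := by
    have hma := M.point_mem_Ω i ha
    have hmb := M.point_mem_Ω i hb
    have hL := IsChain.leibniz hA hU
    have h0 : ∀ x, leibniz 0 A U x = α x * u t x := fun x => by rw [leibniz, hA0, hU0]
    have h1 : leibniz 0 A U (M.point i b) - leibniz 0 A U (M.point i a) =
        ∫ x in M.point i a..M.point i b, leibniz 1 A U x :=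
      (hL.isPrimitive 0 (by omega)).sub_eq (hL.integrable (by omega)) hma hmb
    rw [h0, h0] at h1
    have h2 : ∫ x in M.point i a..M.point i b, W 0 x =
        ∫ x in M.point i a..M.point i b, (g t x - leibniz 1 A U x) :=
      intervalIntegral.integral_congr fun x hx => hW1 x (uIcc_subset_Ω hma hmb hx)
    rw [h2, intervalIntegral.integral_sub (intervalIntegrable_of_integrable_Ω hgi hma hmb)
      (intervalIntegrable_of_integrable_Ω (hL.integrable (j := 1) (by omega)) hma hmb)]
    rw [h1]
  rw [M.integral_point i (W 0)] at hexact
  have hWi : IntervalIntegrable (fun x => W 0 (M.point i x)) volume a b := by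
    refine ContinuousOn.intervalIntegrable ?_
    have hc : Continuous (M.point i) := by
      unfold Mesh.point
      fun_prop
    refine (hW.continuousOn (Nat.succ_pos k)).comp hc.continuousOn fun x hx => ?_
    rw [uIcc_of_le hab] at hx
    exact M.point_mem_Ω i ⟨ha.1.trans hx.1, hx.2.trans hb.2⟩
  rw [intervalIntegral.integral_sub hWi (q.continuous.intervalIntegrable _ _)]
  rw [intervalIntegral.integral_add
    ((errPolyDeriv α M s T u uh t i).continuous.intervalIntegrable _ _)
    (q.continuous.intervalIntegrable _ _)] at hscheme
  linear_combination hscheme - hexact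

end Error

/-! ### The energy estimate -/

lemma Admissible.isReference {N k : ℕ} {α : ℝ → ℝ} {M : Mesh N} {s : Fin N → Fin (k + 2) → ℝ}
    {m : Method} (h : Admissible α M s m) (i : Fin N) : IsReference (s i) := by
  cases m with
  | lsv => exact ⟨(h i).1, Or.inl (h i).2⟩
  | rsv => exact ⟨(h i).1, Or.inr (h i).2.2.2⟩

/-- The velocity is not of one strict sign at the ends of the element `i`. -/
def NotSign {N : ℕ} (α : ℝ → ℝ) (M : Mesh N) (i : Fin N) : Prop :=
  ¬(0 < α (M.left i) ∧ 0 < α (M.right i)) ∧ ¬(α (M.left i) < 0 ∧ α (M.right i) < 0)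

/-- Where both end velocities have one strict sign, the prescribed Radau family puts its end weight
at the outflow end, where the flux takes the inner trace. On all other elements the family is
arbitrary, but the velocity is small. -/
lemma Admissible.exists_weights {N k : ℕ} (hk : 1 ≤ k) {α : ℝ → ℝ} {M : Mesh N}
    {s : Fin N → Fin (k + 2) → ℝ} {m : Method} (h : Admissible α M s m) {K : ℝ}
    (hK : IsReferenceBound k K) (i : Fin N) :
    ∃ (A : Fin (k + 2) → ℝ) (c : ℝ), IsQuadrature (s i) A c ∧ (∀ j, |A j| ≤ K) ∧
      (A 0 = 0 ∨ α (M.left i) ≤ 0 ∨ NotSign α M i) ∧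
      (A (Fin.last (k + 1)) = 0 ∨ 0 < α (M.right i) ∨ NotSign α M i) := by
  refine exists_isQuadrature_of_reference hk hK (h.isReference i).1 _ _ ?_
  cases m with
  | lsv => exact Or.inl (h i).2
  | rsv =>
    obtain ⟨-, h1, h2, h3⟩ := h i
    by_cases hp : 0 < α (M.left i) ∧ 0 < α (M.right i)
    · exact Or.inr (Or.inl ⟨h1 hp.1 hp.2, Or.inl hp.2⟩)
    · by_cases hn : α (M.left i) < 0 ∧ α (M.right i) < 0
      · exact Or.inr (Or.inr ⟨h2 hn.1 hn.2, Or.inl hn.1.le⟩)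
      · rcases h3 with h3 | h3
        · exact Or.inr (Or.inl ⟨h3, Or.inr ⟨hp, hn⟩⟩)
        · exact Or.inr (Or.inr ⟨h3, Or.inr ⟨hp, hn⟩⟩)

section Energy

variable {N k : ℕ} {α : ℝ → ℝ} {M : Mesh N} {s : Fin N → Fin (k + 2) → ℝ}

/-- The upwind fluxes dissipate energy. -/
lemma sum_interface_le [NeZero N] (hper : α 0 = α (2 * Real.pi)) (p : Fin N → ℝ[X]) :
    ∑ i, (α (M.left i) * (refUpwindLeft α M p i * (p i).eval (-1) - (p i).eval (-1) ^ 2 / 2) -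
      α (M.right i) * (refUpwindRight α M p i * (p i).eval 1 - (p i).eval 1 ^ 2 / 2)) ≤ 0 := by
  -- The left-end terms are shifted by one element, so that both traces at an interface meet; there
  -- they combine to -|α|/2 times the squared jump.
  rw [Finset.sum_sub_distrib, ← Equiv.sum_comp (Equiv.addRight (1 : Fin N)),
    ← Finset.sum_sub_distrib]
  refine Finset.sum_nonpos fun i _ => ?_
  simp only [Equiv.coe_addRight, refUpwindLeft, refUpwindRight, M.apply_left_add_one hper,
    add_sub_cancel_right]
  split_ifs with h
  · nlinarith [mul_nonneg h.le (sq_nonneg ((p i).eval 1 - (p (i + 1)).eval (-1)))]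
  · nlinarith [mul_nonneg (neg_nonneg.2 (not_lt.1 h))
      (sq_nonneg ((p i).eval 1 - (p (i + 1)).eval (-1)))]

lemma refUpwindLeft_sq_le [NeZero N] {K : ℝ} (hK : IsInverseBound k K) {p : Fin N → ℝ[X]}
    (hp : ∀ i, (p i).natDegree ≤ k) (i : Fin N) :
    refUpwindLeft α M p i ^ 2 ≤
      K * (refIntegral (p i * p i) + refIntegral (p (i - 1) * p (i - 1))) := by
  have hK1 := hK.1
  have n1 := refIntegral_sq_nonneg (p i)
  have n2 := refIntegral_sq_nonneg (p (i - 1))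
  rw [refUpwindLeft]
  split_ifs
  · have := (hK.2 _ (hp (i - 1)) 1 (by norm_num)).1
    nlinarith
  · have := (hK.2 _ (hp i) (-1) (by norm_num)).1
    nlinarith

lemma refUpwindRight_sq_le [NeZero N] {K : ℝ} (hK : IsInverseBound k K) {p : Fin N → ℝ[X]}
    (hp : ∀ i, (p i).natDegree ≤ k) (i : Fin N) :
    refUpwindRight α M p i ^ 2 ≤
      K * (refIntegral (p i * p i) + refIntegral (p (i + 1) * p (i + 1))) := by
  have hK1 := hK.1
  have n1 := refIntegral_sq_nonneg (p i)
  have n2 := refIntegral_sq_nonneg (p (i + 1))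
  rw [refUpwindRight]
  split_ifs
  · have := (hK.2 _ (hp i) 1 (by norm_num)).1
    nlinarith
  · have := (hK.2 _ (hp (i + 1)) (-1) (by norm_num)).1
    nlinarith

lemma Mesh.ShapeRegular.nonneg [NeZero N] {σ : ℝ} (h : M.ShapeRegular σ) : 0 ≤ σ := by
  by_contra! hneg
  have h1 := h 0
  have h2 := mul_neg_of_neg_of_pos hneg (M.length_pos 0)
  linarith [M.h_pos]

/-- The upwind traces may belong to a neighbouring element; shape regularity lets its length replace
that of the element itself, and each neighbour is counted once per side. -/
lemma sum_length_mul_upwind_le [NeZero N] {σ : ℝ} (hσ : M.ShapeRegular σ) {K : ℝ}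
    (hK : IsInverseBound k K) {p : Fin N → ℝ[X]} (hp : ∀ i, (p i).natDegree ≤ k) :
    ∑ i, M.length i * (refIntegral (p i * p i) + refUpwindLeft α M p i ^ 2 +
      refUpwindRight α M p i ^ 2) ≤
      (1 + 2 * K + 2 * K * σ) * ∑ i, M.length i * refIntegral (p i * p i) := by
  set n : Fin N → ℝ := fun i => refIntegral (p i * p i) with hn
  have hn0 : ∀ i, 0 ≤ n i := fun i => refIntegral_sq_nonneg (p i)
  have hK1 := hK.1
  have hls : ∀ i j, M.length i ≤ σ * M.length j := fun i j => (M.length_le_h i).trans (hσ j)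
  have h1 : ∑ i, M.length (i - 1) * n (i - 1) = ∑ i, M.length i * n i :=
    Equiv.sum_comp (Equiv.subRight (1 : Fin N)) fun i => M.length i * n i
  have h2 : ∑ i, M.length (i + 1) * n (i + 1) = ∑ i, M.length i * n i :=
    Equiv.sum_comp (Equiv.addRight (1 : Fin N)) fun i => M.length i * n i
  calc ∑ i, M.length i * (n i + refUpwindLeft α M p i ^ 2 + refUpwindRight α M p i ^ 2)
      ≤ ∑ i, ((1 + 2 * K) * (M.length i * n i) + K * σ * (M.length (i - 1) * n (i - 1)) +
          K * σ * (M.length (i + 1) * n (i + 1))) := by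
        refine Finset.sum_le_sum fun i _ => ?_
        have e1 := refUpwindLeft_sq_le (α := α) (M := M) hK hp i
        have e2 := refUpwindRight_sq_le (α := α) (M := M) hK hp i
        have hl := (M.length_pos i).le
        have e3 : M.length i * n (i - 1) ≤ σ * M.length (i - 1) * n (i - 1) :=
          mul_le_mul_of_nonneg_right (hls i (i - 1)) (hn0 _)
        have e4 : M.length i * n (i + 1) ≤ σ * M.length (i + 1) * n (i + 1) :=
          mul_le_mul_of_nonneg_right (hls i (i + 1)) (hn0 _)
        have e5 := mul_le_mul_of_nonneg_left (add_le_add e1 e2) hl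
        have e6 := mul_le_mul_of_nonneg_left (add_le_add e3 e4) (zero_le_one.trans hK1)
        simp only [hn] at e5 e6 ⊢
        linarith
    _ = _ := by
        rw [Finset.sum_add_distrib, Finset.sum_add_distrib, ← Finset.mul_sum, ← Finset.mul_sum,
          ← Finset.mul_sum, h1, h2]
        ring

/-- The energy of the error. -/
def errEnergy (α : ℝ → ℝ) (M : Mesh N) (s : Fin N → Fin (k + 2) → ℝ) (c : Fin N → ℝ)
    (u : ℝ → ℝ → ℝ) (uh : ℝ → Fin N → ℝ[X]) (t : ℝ) : ℝ :=
  ∑ i, M.length i / 2 * refMass k (c i) (errPoly α M s u uh t i) (errPoly α M s u uh t i)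

lemma sum_length_le_errEnergy {c : Fin N → ℝ} (hc : ∀ i, 0 ≤ c i) (u : ℝ → ℝ → ℝ)
    (uh : ℝ → Fin N → ℝ[X]) (t : ℝ) :
    ∑ i, M.length i * refIntegral (errPoly α M s u uh t i * errPoly α M s u uh t i) ≤
      2 * errEnergy α M s c u uh t := by
  rw [errEnergy, Finset.mul_sum]
  refine Finset.sum_le_sum fun i _ => ?_
  have := mul_le_mul_of_nonneg_left
    (refIntegral_le_refMass k (hc i) (errPoly α M s u uh t i)) (M.length_pos i).le
  linarith

/-- Interpolation error of a function with `k + 1` derivatives on one element, squared. -/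
lemma length_mul_sq_le {F : ℝ → ℝ} (hF : MemLp F 2 μΩ) (i : Fin N) :
    M.length i * (M.length i ^ k * ∫ y in M.left i..M.right i, |F y|) ^ 2 ≤
      M.h ^ (2 * k + 2) * ∫ y in M.left i..M.right i, F y ^ 2 := by
  have hl := (M.length_pos i).le
  have h1 := sq_integral_abs_le hF (M.left_mem i) (M.right_mem i) (M.left_lt_right i).le
  have h2 : 0 ≤ ∫ y in M.left i..M.right i, F y ^ 2 :=
    intervalIntegral.integral_nonneg (M.left_lt_right i).le fun _ _ => sq_nonneg _
  calc M.length i * (M.length i ^ k * ∫ y in M.left i..M.right i, |F y|) ^ 2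
      = M.length i ^ (2 * k + 1) * (∫ y in M.left i..M.right i, |F y|) ^ 2 := by ring
    _ ≤ M.length i ^ (2 * k + 1) * (M.length i * ∫ y in M.left i..M.right i, F y ^ 2) := by
        exact mul_le_mul_of_nonneg_left h1 (by positivity)
    _ = M.length i ^ (2 * k + 2) * ∫ y in M.left i..M.right i, F y ^ 2 := by ring
    _ ≤ _ := mul_le_mul_of_nonneg_right (pow_le_pow_left₀ hl (M.length_le_h i) _) h2

/-- The growth of the energy: `K` bounds the constants of the reference element, `L` the derivative
of the velocity, and `σ` is the shape regularity. -/
lemma sum_refMass_errPolyDeriv_le [NeZero N] (hk : 1 ≤ k) (hper : α 0 = α (2 * Real.pi))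
    {A : ℕ → ℝ → ℝ} (hA : IsSmoothChain A) (hA0 : A 0 = α) {K L σ : ℝ}
    (hK : IsReferenceBound k K) (hL0 : 0 ≤ L) (hL : ∀ x ∈ Ω, |A 1 x| ≤ L)
    (hσ : M.ShapeRegular σ) {m : Method} (hadm : Admissible α M s m)
    {w : Fin N → Fin (k + 2) → ℝ} {c : Fin N → ℝ} (hq : ∀ i, IsQuadrature (s i) (w i) (c i))
    (hw : ∀ i j, |w i j| ≤ K) (hwl : ∀ i, w i 0 = 0 ∨ α (M.left i) ≤ 0 ∨ NotSign α M i)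
    (hwr : ∀ i, w i (Fin.last (k + 1)) = 0 ∨ 0 < α (M.right i) ∨ NotSign α M i)
    {T : ℝ} (hT : 0 < T) {g u : ℝ → ℝ → ℝ} {u₀ : ℝ → ℝ} {uh : ℝ → Fin N → ℝ[X]}
    (huh : IsSVSolution α M s T g uh) (hu : IsSolution T α g u₀ u) {t : ℝ} (ht : t ∈ Icc 0 T)
    {U W : ℕ → ℝ → ℝ} (hU : IsChain (k + 2) U) (hU0 : U 0 = u t)
    (hW : IsChain (k + 1) W) (hgi : Integrable (g t) μΩ)
    (hW1 : ∀ x ∈ Ω, W 0 x = g t x - leibniz 1 A U x)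
    (hW2 : ∀ x ∈ Ω, derivWithin (fun τ => u τ x) (Icc 0 T) t = W 0 x) :
    ∑ i, M.length i / 2 *
        refMass k (c i) (errPolyDeriv α M s T u uh t i) (errPoly α M s u uh t i) ≤
      2 * ((k + 7) * K ^ 2 * L * (1 + 2 * K + 2 * K * σ) +
          (k + 1) * (1 + (k + 2) * K) ^ 2 * K) * errEnergy α M s c u uh t +
        (k + 1) * (1 + (k + 2) * K) ^ 2 * K * (2 * (1 + K) ^ 2) * M.h ^ (2 * k + 2) *
          (l2sq (W (k + 1)) + 4 * L ^ 2 * l2sq (U (k + 1))) := by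
  set p : Fin N → ℝ[X] := fun i => errPoly α M s u uh t i with hp
  set n : Fin N → ℝ := fun i => refIntegral (p i * p i) with hn
  set C := (k + 1) * (1 + (k + 2) * K) ^ 2 * K with hC
  have hK1 := hK.inverse.1
  have hC0 : 0 ≤ C := by positivity
  have hU' : IsChain (k + 1) U := hU.mono (by omega)
  have hs : ∀ i, IsPartition (s i) := fun i => (hadm.isReference i).1
  have hpd : ∀ i, (p i).natDegree ≤ k := fun i => natDegree_refInterp_le _ _ (hs i)
  have hlip : ∀ x ∈ Ω, ∀ y ∈ Ω, |α x - α y| ≤ L * |x - y| := by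
    intro x hx y hy
    rw [← hA0]
    exact hA.abs_sub_le hL hx hy
  have hαc : ContinuousOn α Ω := hA0 ▸ hA.continuousOn 0
  set eU : Fin N → ℝ := fun i =>
    M.length i ^ k * ∫ y in M.left i..M.right i, |U (k + 1) y| with heU
  set eW : Fin N → ℝ := fun i =>
    M.length i ^ k * ∫ y in M.left i..M.right i, |W (k + 1) y| with heW
  -- Three contributions: interface terms that dissipate after summation, the variation of the
  -- velocity over the element, and the consistency residuals.
  have helem : ∀ i, M.length i / 2 *
      refMass k (c i) (errPolyDeriv α M s T u uh t i) (p i) ≤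
      (α (M.left i) * (refUpwindLeft α M p i * (p i).eval (-1) - (p i).eval (-1) ^ 2 / 2) -
        α (M.right i) * (refUpwindRight α M p i * (p i).eval 1 - (p i).eval 1 ^ 2 / 2)) +
      (k + 7) * K ^ 2 * (L * M.length i) *
        (n i + refUpwindLeft α M p i ^ 2 + refUpwindRight α M p i ^ 2) +
      C * M.length i * (n i + ((1 + K) * eW i + 2 * L * ((1 + K) * eU i)) ^ 2) := by
    intro i
    have hl := (M.length_pos i).le
    have hleft : M.point i (s i 0) = M.left i := by rw [(hs i).first, M.point_neg_one]
    have hright : M.point i (s i (Fin.last (k + 1))) = M.right i := by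
      rw [(hs i).last, M.point_one]
    have hpt : ∀ j, M.point i (s i j) ∈ Icc (M.left i) (M.right i) := fun j =>
      M.point_mem i ((hs i).mem_Icc j)
    have hsmall : NotSign α M i → ∀ j, |α (M.point i (s i j))| ≤ L * M.length i := fun h j =>
      M.abs_le_of_not_sign i hαc hlip hL0 h.1 h.2 (hpt j)
    have hbU : ∀ x ∈ Icc (-1 : ℝ) 1, |u t (M.point i x) - (refInterp (s i) (omitted α M k i)
        fun j => u t (M.point i (s i j))).eval x| ≤ (1 + K) * eU i := by
      rw [← hU0]
      exact fun x hx => hU'.abs_sub_refInterp_le _ M i (hadm.isReference i) hK hx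
    have hbW : ∀ x ∈ Icc (-1 : ℝ) 1, |W 0 (M.point i x) - (refInterp (s i) (omitted α M k i)
        fun j => W 0 (M.point i (s i j))).eval x| ≤ (1 + K) * eW i :=
      fun x hx => hW.abs_sub_refInterp_le _ M i (hadm.isReference i) hK hx
    have hflux := abs_flux_sub_le hk hper hαc hlip hL0 hs (huh.natDegree_le t ht)
      (hu.periodic t ht) i hbU
    have hsub := Icc_subset_Ω (M.left_mem i) (M.right_mem i)
    have key := (hq i).energy_le hk (hs i) hK.inverse (hw i) (hpd i)
      (natDegree_refInterp_le (omitted α M k i) (fun j =>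
        derivWithin (fun τ => errNode M s u uh τ i j) (Icc 0 T) t) (hs i))
      (fun j => α (M.point i (s i j))) (refUpwindLeft α M p i) (refUpwindRight α M p i)
      (L * M.length i)
      (fun j j' => (hlip _ (hsub (hpt j)) _ (hsub (hpt j'))).trans
        (mul_le_mul_of_nonneg_left (M.abs_sub_le i (hpt j) (hpt j')) hL0))
      (by
        rcases hwl i with h | h | h
        · exact Or.inl h
        · refine Or.inr (Or.inl ?_)
          rw [refUpwindLeft, if_neg (not_lt.2 h)]
          ring
        · exact Or.inr (Or.inr (hsmall h 0)))
      (by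
        rcases hwr i with h | h | h
        · exact Or.inl h
        · refine Or.inr (Or.inl ?_)
          rw [refUpwindRight, if_pos h]
          ring
        · exact Or.inr (Or.inr (hsmall h _)))
      (refFlux α M s p i) (fun j => rfl) (h := M.length i)
      -- Relative to the length of the element, the residual is the interpolation error of u_t plus,
      -- for each of the two ends of a control volume, L times that of u.
      (R := (1 + K) * eW i + 2 * L * ((1 + K) * eU i)) hl
      (fun j => M.length i / 2 *
        (∫ x in s i j.castSucc..s i j.succ, (errPolyDeriv α M s T u uh t i).eval x) +
          refFlux α M s p i j.succ - refFlux α M s p i j.castSucc)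
      (by
        intro j
        have h1 := huh.error_eq hT hu hs ht hA hA0 hU hU0 hW hgi hW1 hW2 i j
        have h2 := hflux j.succ
        have h3 := hflux j.castSucc
        have hmc := (hs i).mem_Icc j.castSucc
        have hms := (hs i).mem_Icc j.succ
        have h4 : |∫ x in s i j.castSucc..s i j.succ, (W 0 (M.point i x) -
            (refInterp (s i) (omitted α M k i) fun j => W 0 (M.point i (s i j))).eval x)| ≤
            (1 + K) * eW i * 2 := by
          rw [← Real.norm_eq_abs]
          refine (intervalIntegral.norm_integral_le_of_norm_le_const
            (C := (1 + K) * eW i) fun x hx => ?_).trans ?_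
          · rw [uIoc_of_le ((hs i).strictMono.monotone j.castSucc_lt_succ.le)] at hx
            exact hbW x ⟨hmc.1.trans hx.1.le, hx.2.trans hms.2⟩
          · refine mul_le_mul_of_nonneg_left ?_ ((abs_nonneg _).trans (hbW 1 (by norm_num)))
            rw [abs_le]
            constructor <;> linarith [hmc.1, hmc.2, hms.1, hms.2]
        have h5 := abs_le.1 h4
        have h6 := abs_le.1 h2
        have h7 := abs_le.1 h3
        have h8 := mul_le_mul_of_nonneg_left h5.1 hl
        have h9 := mul_le_mul_of_nonneg_left h5.2 hl
        rw [abs_le]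
        constructor <;> linarith)
      (fun j => rfl)
    simp only [hleft, hright] at key
    exact key
  have hsumU : ∑ i, M.length i * eU i ^ 2 ≤ M.h ^ (2 * k + 2) * l2sq (U (k + 1)) := by
    rw [l2sq, ← M.sum_integral (hU'.memLp (k + 1) le_rfl).integrable_sq, Finset.mul_sum]
    exact Finset.sum_le_sum fun i _ => length_mul_sq_le (hU'.memLp (k + 1) le_rfl) i
  have hsumW : ∑ i, M.length i * eW i ^ 2 ≤ M.h ^ (2 * k + 2) * l2sq (W (k + 1)) := by
    rw [l2sq, ← M.sum_integral (hW.memLp (k + 1) le_rfl).integrable_sq, Finset.mul_sum]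
    exact Finset.sum_le_sum fun i _ => length_mul_sq_le (hW.memLp (k + 1) le_rfl) i
  have hup := sum_length_mul_upwind_le (α := α) hσ hK.inverse hpd
  have hen := sum_length_le_errEnergy (α := α) (M := M) (s := s) (fun i => (hq i).nonneg) u uh t
  have hint := sum_interface_le (M := M) hper p
  have hσ0 := hσ.nonneg
  have hR : ∑ i, M.length i * ((1 + K) * eW i + 2 * L * ((1 + K) * eU i)) ^ 2 ≤
      2 * (1 + K) ^ 2 * (M.h ^ (2 * k + 2) * l2sq (W (k + 1)) +
        4 * L ^ 2 * (M.h ^ (2 * k + 2) * l2sq (U (k + 1)))) := by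
    calc ∑ i, M.length i * ((1 + K) * eW i + 2 * L * ((1 + K) * eU i)) ^ 2
        ≤ ∑ i, 2 * (1 + K) ^ 2 * (M.length i * eW i ^ 2 +
            4 * L ^ 2 * (M.length i * eU i ^ 2)) := by
          refine Finset.sum_le_sum fun i _ => ?_
          have e1 : ((1 + K) * eW i + 2 * L * ((1 + K) * eU i)) ^ 2 ≤
              2 * (1 + K) ^ 2 * (eW i ^ 2 + 4 * L ^ 2 * eU i ^ 2) := by
            nlinarith [mul_nonneg (sq_nonneg (1 + K)) (sq_nonneg (eW i - 2 * L * eU i))]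
          have e2 := mul_le_mul_of_nonneg_left e1 (M.length_pos i).le
          linarith
      _ = 2 * (1 + K) ^ 2 * (∑ i, M.length i * eW i ^ 2 +
            4 * L ^ 2 * ∑ i, M.length i * eU i ^ 2) := by
          rw [← Finset.mul_sum, Finset.sum_add_distrib, ← Finset.mul_sum]
      _ ≤ _ := by
          refine mul_le_mul_of_nonneg_left (add_le_add hsumW ?_) (by positivity)
          exact mul_le_mul_of_nonneg_left hsumU (by positivity)
  set S := ∑ i, M.length i * n i with hS
  have htotal := Finset.sum_le_sum fun i (_ : i ∈ Finset.univ) => helem i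
  rw [Finset.sum_add_distrib, Finset.sum_add_distrib] at htotal
  have t1 : ∑ i, (k + 7) * K ^ 2 * (L * M.length i) *
      (n i + refUpwindLeft α M p i ^ 2 + refUpwindRight α M p i ^ 2) ≤
      (k + 7) * K ^ 2 * L * ((1 + 2 * K + 2 * K * σ) * S) := by
    have e : ∀ i, (k + 7) * K ^ 2 * (L * M.length i) *
      (n i + refUpwindLeft α M p i ^ 2 + refUpwindRight α M p i ^ 2) =
      (k + 7) * K ^ 2 * L * (M.length i *
        (n i + refUpwindLeft α M p i ^ 2 + refUpwindRight α M p i ^ 2)) := fun i => by ring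
    simp only [e]
    rw [← Finset.mul_sum]
    exact mul_le_mul_of_nonneg_left hup (by positivity)
  have t2 : ∑ i, C * M.length i * (n i + ((1 + K) * eW i + 2 * L * ((1 + K) * eU i)) ^ 2) =
      C * S + C * ∑ i, M.length i * ((1 + K) * eW i + 2 * L * ((1 + K) * eU i)) ^ 2 := by
    rw [hS, Finset.mul_sum, Finset.mul_sum, ← Finset.sum_add_distrib]
    exact Finset.sum_congr rfl fun i _ => by ring
  rw [t2] at htotal
  have t3 := mul_le_mul_of_nonneg_left hR hC0
  have t4 : ((k + 7) * K ^ 2 * L * (1 + 2 * K + 2 * K * σ) + C) * S ≤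
      ((k + 7) * K ^ 2 * L * (1 + 2 * K + 2 * K * σ) + C) *
        (2 * errEnergy α M s c u uh t) :=
    mul_le_mul_of_nonneg_left hen (by positivity)
  linarith

end Energy

/-! ### The error estimate -/

section Estimate

variable {N k : ℕ} {α : ℝ → ℝ} {M : Mesh N} {s : Fin N → Fin (k + 2) → ℝ}

lemma hasDerivWithinAt_errEnergy [NeZero N] {T : ℝ} {g u : ℝ → ℝ → ℝ} {u₀ : ℝ → ℝ}
    {uh : ℝ → Fin N → ℝ[X]} (huh : IsSVSolution α M s T g uh) (hu : IsSolution T α g u₀ u)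
    (hs : ∀ i, IsPartition (s i)) (c : Fin N → ℝ) {t : ℝ} (ht : t ∈ Icc 0 T) :
    HasDerivWithinAt (errEnergy α M s c u uh)
      (2 * ∑ i, M.length i / 2 *
        refMass k (c i) (errPolyDeriv α M s T u uh t i) (errPoly α M s u uh t i)) (Icc 0 T) t := by
  have h : ∀ i, HasDerivWithinAt (fun τ => M.length i / 2 *
      refMass k (c i) (errPoly α M s u uh τ i) (errPoly α M s u uh τ i))
      (M.length i / 2 *
        (2 * refMass k (c i) (errPolyDeriv α M s T u uh t i) (errPoly α M s u uh t i)))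
      (Icc 0 T) t := by
    intro i
    refine (hasDerivWithinAt_refMass (s := s i) (omitted α M k i) (c i)
      (v := fun τ => errNode M s u uh τ i) fun j => ?_).const_mul _
    have h1 := (huh.differentiable i (M.point i (s i j)) t ht).sub
      (hu.differentiable_time _ (M.point_mem_Ω i ((hs i).mem_Icc j)) t ht)
    exact h1.hasDerivWithinAt
  have h2 := HasDerivWithinAt.fun_sum fun i (_ : i ∈ Finset.univ) => h i
  rw [Finset.mul_sum]
  simp only [mul_left_comm (2 : ℝ)]
  exact h2

/-- Starting from I_h u₀ makes all nodal errors vanish except at the omitted node, which `errPoly`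
does not see. -/
lemma errEnergy_zero {T : ℝ} {g u : ℝ → ℝ → ℝ} {u₀ : ℝ → ℝ} {uh : ℝ → Fin N → ℝ[X]}
    (hu : IsSolution T α g u₀ u) (hs : ∀ i, IsPartition (s i)) (c : Fin N → ℝ)
    (h0 : uh 0 = interpolant α M s u₀) : errEnergy α M s c u uh 0 = 0 := by
  have h : ∀ i, errPoly α M s u uh 0 i = 0 := by
    intro i
    refine refInterp_eq_zero _ _ fun j hj => ?_
    have h1 : (interpolant α M s u₀ i).eval (M.point i (s i j)) = u₀ (M.point i (s i j)) :=
      Lagrange.eval_interpolate_at_node (fun j => u₀ (M.point i (s i j)))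
        (v := fun j => M.point i (s i j))
        (((M.point_injective i).comp (hs i).strictMono.injective).injOn) (by simp [hj])
    rw [errNode, h0, h1, hu.initial _ (M.point_mem_Ω i ((hs i).mem_Icc j)), sub_self]
  simp [errEnergy, h, refMass]

/-- The error is split at I_h u: the polynomial part is bounded by the energy, the rest is the
interpolation error. -/
lemma l2sq_error_le {K : ℝ} (hK : IsReferenceBound k K) (hs : ∀ i, IsReference (s i))
    {c : Fin N → ℝ} (hc : ∀ i, 0 ≤ c i) {u : ℝ → ℝ → ℝ} {uh : ℝ → Fin N → ℝ[X]} {t : ℝ}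
    (hd : ∀ i, (uh t i).natDegree ≤ k) {U : ℕ → ℝ → ℝ} (hU : IsChain (k + 1) U) (hU0 : U 0 = u t) :
    l2sq (fun x => u t x - M.toFun (uh t) x) ≤
      4 * K * errEnergy α M s c u uh t +
        2 * (1 + K) ^ 2 * M.h ^ (2 * k + 2) * l2sq (U (k + 1)) := by
  set n : Fin N → ℝ := fun i =>
    refIntegral (errPoly α M s u uh t i * errPoly α M s u uh t i)
  set eU : Fin N → ℝ := fun i =>
    M.length i ^ k * ∫ y in M.left i..M.right i, |U (k + 1) y|
  have hK1 := hK.inverse.1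
  have hmem : MemLp (fun x => u t x - M.toFun (uh t) x) 2 μΩ := by
    rw [← hU0]
    exact (hU.memLp 0 (Nat.zero_le _)).sub (M.memLp_toFun _)
  have hUm := hU.memLp (k + 1) le_rfl
  have helem : ∀ i, ∫ x in M.left i..M.right i, (u t x - M.toFun (uh t) x) ^ 2 ≤
      2 * K * (M.length i * n i) + 2 * (1 + K) ^ 2 * (M.length i * eU i ^ 2) := by
    intro i
    have h1 : ∫ x in M.left i..M.right i, (u t x - M.toFun (uh t) x) ^ 2 ≤
        ∫ _ in M.left i..M.right i, (2 * K * n i + 2 * (1 + K) ^ 2 * eU i ^ 2) := by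
      refine intervalIntegral.integral_mono_on_of_le_Ioo (M.left_lt_right i).le
        (intervalIntegrable_of_integrable_Ω hmem.integrable_sq (M.left_mem i) (M.right_mem i))
        intervalIntegrable_const fun x hx => ?_
      obtain ⟨r, hr, hrx⟩ := M.exists_point_eq i (Ioo_subset_Icc_self hx)
      rw [M.toFun_eq _ i ⟨hx.1.le, hx.2⟩, ← hrx,
        eval_point_eq_errPoly_add (α := α) (u := u) (hs i).1 (hd i)]
      have h2 := hU.abs_sub_refInterp_le (omitted α M k i) M i (hs i) hK hr
      rw [hU0] at h2
      have h3 := (hK.inverse.2 _ (natDegree_refInterp_le (omitted α M k i)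
        (errNode M s u uh t i) (hs i).1) r hr).1
      have h4 := pow_le_pow_left₀ (abs_nonneg _) h2 2
      rw [sq_abs] at h4
      have h5 : ∀ a b d : ℝ, (a - (b + d)) ^ 2 ≤ 2 * b ^ 2 + 2 * (a - d) ^ 2 := fun a b d => by
        nlinarith [sq_nonneg (a - d + b)]
      refine (h5 _ _ _).trans ?_
      have h6 : (errPoly α M s u uh t i).eval r ^ 2 ≤ K * n i := h3
      rw [mul_pow] at h4
      linarith
    rw [intervalIntegral.integral_const, smul_eq_mul] at h1
    refine h1.trans (le_of_eq ?_)
    rw [Mesh.length]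
    ring
  have hsumU : ∑ i, M.length i * eU i ^ 2 ≤ M.h ^ (2 * k + 2) * l2sq (U (k + 1)) := by
    rw [l2sq, ← M.sum_integral hUm.integrable_sq, Finset.mul_sum]
    exact Finset.sum_le_sum fun i _ => length_mul_sq_le hUm i
  have hen := sum_length_le_errEnergy (α := α) (M := M) (s := s) hc u uh t
  rw [l2sq, ← M.sum_integral hmem.integrable_sq]
  refine (Finset.sum_le_sum fun i _ => helem i).trans ?_
  rw [Finset.sum_add_distrib, ← Finset.mul_sum, ← Finset.mul_sum]
  have e1 := mul_le_mul_of_nonneg_left hen (by positivity : 0 ≤ 2 * K)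
  have e2 := mul_le_mul_of_nonneg_left hsumU (by positivity : 0 ≤ 2 * (1 + K) ^ 2)
  linarith

end Estimate

/-- Gronwall's inequality. The condition a ≥ 1 excludes its degenerate case and gives b / a ≤ b. The
derivative bound is needed only before t. -/
lemma le_mul_exp_of_deriv_le {f f' : ℝ → ℝ} {T a b : ℝ} (ha : 1 ≤ a) (hb : 0 ≤ b) {t : ℝ}
    (ht : t ∈ Icc 0 T) (hf : ∀ τ ∈ Icc 0 t, HasDerivWithinAt f (f' τ) (Icc 0 T) τ) (h0 : f 0 = 0)
    (hle : ∀ τ ∈ Ico 0 t, f' τ ≤ a * f τ + b) : f t ≤ b * Real.exp (a * T) := by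
  have hsub : Icc 0 t ⊆ Icc 0 T := Icc_subset_Icc_right ht.2
  have h := le_gronwallBound_of_liminf_deriv_right_le (f := f) (f' := f') (δ := 0) (K := a) (ε := b)
    (a := 0) (b := t) (fun τ hτ => ((hf τ hτ).mono hsub).continuousWithinAt) (by
      intro τ hτ r hr
      have h1 : HasDerivWithinAt f (f' τ) (Ici τ) τ :=
        (hf τ ⟨hτ.1, hτ.2.le⟩).mono_of_mem_nhdsWithin
          (Icc_mem_nhdsGE_of_mem ⟨hτ.1, hτ.2.trans_le ht.2⟩)
      have h2 := h1.liminf_right_slope_le hr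
      simpa [slope_def_field, div_eq_inv_mul] using h2) h0.le hle t ⟨ht.1, le_rfl⟩
  rw [gronwallBound_of_K_ne_0 (by linarith)] at h
  simp only [sub_zero, zero_mul, zero_add] at h
  have h1 : Real.exp (a * t) ≤ Real.exp (a * T) :=
    Real.exp_le_exp.2 (mul_le_mul_of_nonneg_left ht.2 (by linarith))
  have h2 : b / a ≤ b := div_le_self hb ha
  have h3 : 1 ≤ Real.exp (a * t) := Real.one_le_exp (mul_nonneg (by linarith) ht.1)
  calc f t ≤ b / a * (Real.exp (a * t) - 1) := h
    _ ≤ b * (Real.exp (a * t) - 1) := mul_le_mul_of_nonneg_right h2 (by linarith)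
    _ ≤ b * Real.exp (a * T) := mul_le_mul_of_nonneg_left (by linarith) hb

/-- The error estimate in terms of a common bound of the exact solution and the source. -/
theorem exists_error_bound (k : ℕ) (hk : 1 ≤ k) (T : ℝ) (hT : 0 < T) (σ : ℝ) (α : ℝ → ℝ)
    (hα : ContDiffOn ℝ ∞ α Ω) (hper : α 0 = α (2 * Real.pi)) :
    ∃ C : ℝ, 0 < C ∧ ∀ g : ℝ → ℝ → ℝ,
      ContDiffOn ℝ ∞ (fun p : ℝ × ℝ => g p.1 p.2) (Icc 0 T ×ˢ Ω) → ∀ t ∈ Icc 0 T,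
      ∀ (m : Method) (N : ℕ) [NeZero N] (M : Mesh N) (s : Fin N → Fin (k + 2) → ℝ)
        (u₀ : ℝ → ℝ) (u : ℝ → ℝ → ℝ) (uh : ℝ → Fin N → ℝ[X]),
        M.ShapeRegular σ → Admissible α M s m → IsSolution T α g u₀ u →
        (∀ τ ∈ Icc 0 T, MemSobolev (k + 2) (u τ)) → IsSVSolution α M s T g uh →
        uh 0 = interpolant α M s u₀ → ∀ B : ℝ, 0 ≤ B →
        (∀ τ ∈ Icc 0 t, sobolevNorm (k + 2) (u τ) ≤ ENNReal.ofReal B) →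
        (∀ τ ∈ Ico 0 t, sobolevNorm (k + 1) (g τ) ≤ ENNReal.ofReal B) →
        eLpNorm (fun x => u t x - M.toFun (uh t) x) 2 μΩ ≤
          ENNReal.ofReal (C * M.h ^ (k + 1) * B) := by
  obtain ⟨K, hK⟩ := exists_isReferenceBound k
  obtain ⟨A, hA0, hA⟩ := exists_isSmoothChain_of_contDiffOn hα
  obtain ⟨L, hL0, hL⟩ := hA.exists_bound (k + 2)
  have hK1 := hK.inverse.1
  set c₁ := 2 * ((k + 7) * K ^ 2 * L * (1 + 2 * K + 2 * K * |σ|) +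
    (k + 1) * (1 + (k + 2) * K) ^ 2 * K) with hc₁
  set c₂ := (k + 1) * (1 + (k + 2) * K) ^ 2 * K * (2 * (1 + K) ^ 2) with hc₂
  set c₃ := 2 * (1 + (2 ^ (k + 2) * L) ^ 2 * (k + 3)) + 4 * L ^ 2 with hc₃
  -- The derivative of the energy is twice the sum estimated above; the 1 is added only to have a ≥
  -- 1.
  set a := 2 * c₁ + 1 with ha
  set c₄ := 4 * K * (2 * c₂ * c₃ * Real.exp (a * T)) + 2 * (1 + K) ^ 2 with hc₄
  have hc₁0 : 0 ≤ c₁ := by positivity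
  have hc₂0 : 0 ≤ c₂ := by positivity
  have hc₃0 : 0 ≤ c₃ := by positivity
  have hc₄0 : 0 < c₄ := by positivity
  refine ⟨Real.sqrt c₄, Real.sqrt_pos.2 hc₄0, ?_⟩
  intro g hg t ht m N _ M s u₀ u uh hσ hadm hu hsob huh h0 B hB hBu hBg
  obtain ⟨G, hG0, hGc, hG⟩ := exists_isSmoothChain hT hg
  have hs : ∀ i, IsPartition (s i) := fun i => (hadm.isReference i).1
  -- The constants are fixed before any mesh is given, so nonnegativity of σ is not yet available
  -- and |σ| is used.
  have hσ' : M.ShapeRegular |σ| := fun i =>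
    (hσ i).trans (mul_le_mul_of_nonneg_right (le_abs_self σ) (M.length_pos i).le)
  choose w c hq hw hwl hwr using hadm.exists_weights hk hK
  have hh := M.h_pos
  have hE0 : ∀ τ, 0 ≤ errEnergy α M s c u uh τ := fun τ => by
    have := sum_length_le_errEnergy (α := α) (M := M) (s := s) (fun i => (hq i).nonneg) u uh τ
    have h1 : 0 ≤ ∑ i, M.length i *
        refIntegral (errPoly α M s u uh τ i * errPoly α M s u uh τ i) :=
      Finset.sum_nonneg fun i _ => mul_nonneg (M.length_pos i).le (refIntegral_sq_nonneg _)
    linarith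
  have hE : errEnergy α M s c u uh t ≤
      2 * c₂ * c₃ * M.h ^ (2 * k + 2) * B ^ 2 * Real.exp (a * T) := by
    refine le_mul_exp_of_deriv_le (a := a) (by rw [ha]; linarith) (by positivity) ht
      (fun τ hτ => hasDerivWithinAt_errEnergy huh hu hs c ⟨hτ.1, hτ.2.trans ht.2⟩)
      (errEnergy_zero hu hs c h0) fun τ hτ => ?_
    have hτT : τ ∈ Icc 0 T := ⟨hτ.1, hτ.2.le.trans ht.2⟩
    obtain ⟨U, W, hU, hU0, hW, hW1, hW2, hWb⟩ :=
      hu.exists_isChain hk hA hA0 hG0 hG hL hτT (hsob τ hτT)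
    have hgi : Integrable (g τ) μΩ := by
      have := ((hG τ hτT).isChain 0).integrable le_rfl
      rwa [hG0] at this
    have h1 := sum_refMass_errPolyDeriv_le hk hper hA hA0 hK hL0 (hL 1 (by omega)) hσ' hadm hq hw
      hwl hwr hT huh hu hτT hU hU0 hW hgi hW1 hW2
    have h2 := hWb B hB (hBu τ ⟨hτ.1, hτ.2.le⟩) (hBg τ hτ)
    have h3 : l2sq (U (k + 1)) ≤ B ^ 2 :=
      hU.l2sq_le hB (by rw [hU0]; exact hBu τ ⟨hτ.1, hτ.2.le⟩) (by omega)
    have h4 : l2sq (W (k + 1)) + 4 * L ^ 2 * l2sq (U (k + 1)) ≤ c₃ * B ^ 2 := by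
      have := mul_le_mul_of_nonneg_left h3 (by positivity : 0 ≤ 4 * L ^ 2)
      rw [hc₃]
      linarith
    have h5 := mul_le_mul_of_nonneg_left h4 (by positivity : 0 ≤ c₂ * M.h ^ (2 * k + 2))
    have h6 := hE0 τ
    rw [ha]
    linarith
  obtain ⟨U, W, hU, hU0, -⟩ := hu.exists_isChain hk hA hA0 hG0 hG hL ht (hsob t ht)
  have hfin := l2sq_error_le (α := α) (M := M) hK (hadm.isReference)
    (fun i => (hq i).nonneg) (huh.natDegree_le t ht) (hU.mono (by omega)) hU0
  have h3 : l2sq (U (k + 1)) ≤ B ^ 2 :=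
    hU.l2sq_le hB (by rw [hU0]; exact hBu t ⟨ht.1, le_rfl⟩) (by omega)
  have hmem : MemLp (fun x => u t x - M.toFun (uh t) x) 2 μΩ := by
    rw [← hU0]
    exact (hU.memLp 0 (Nat.zero_le _)).sub (M.memLp_toFun _)
  rw [eLpNorm_two_eq hmem]
  refine ENNReal.ofReal_le_ofReal (Real.sqrt_le_iff.2 ⟨by positivity, ?_⟩)
  have h4 : (Real.sqrt c₄ * M.h ^ (k + 1) * B) ^ 2 = c₄ * M.h ^ (2 * k + 2) * B ^ 2 := by
    rw [mul_pow, mul_pow, Real.sq_sqrt hc₄0.le]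
    ring
  rw [h4]
  have e1 := mul_le_mul_of_nonneg_left hE (by positivity : 0 ≤ 4 * K)
  have e2 := mul_le_mul_of_nonneg_left h3
    (by positivity : 0 ≤ 2 * (1 + K) ^ 2 * M.h ^ (2 * k + 2))
  rw [hc₄]
  linarith

/-! ### The source term -/

lemma exists_sobolevNorm_le (m : ℕ) {T : ℝ} (hT : 0 < T) {g : ℝ → ℝ → ℝ}
    (hg : ContDiffOn ℝ ∞ (fun p : ℝ × ℝ => g p.1 p.2) (Icc 0 T ×ˢ Ω)) :
    ∃ S : ℝ, 0 ≤ S ∧ ∀ t ∈ Icc 0 T, sobolevNorm m (g t) ≤ ENNReal.ofReal S := by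
  obtain ⟨G, hG0, hGc, hG⟩ := exists_isSmoothChain hT hg
  choose C hC using fun j =>
    (isCompact_Icc.prod isCompact_Ω).exists_bound_of_continuousOn (hGc j)
  refine ⟨_, Real.sqrt_nonneg (∑ j ∈ Finset.range (m + 1), 2 * Real.pi * C j ^ 2),
    fun t ht => ?_⟩
  have hc := (hG t ht).isChain m
  have h1 := hc.sobolevNorm_eq
  rw [hG0] at h1
  rw [h1]
  refine ENNReal.ofReal_le_ofReal (Real.sqrt_le_sqrt (Finset.sum_le_sum fun j hj => ?_))
  have hjm := Nat.lt_succ_iff.1 (Finset.mem_range.1 hj)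
  have h2 : l2sq (G j t) ≤ ∫ _ in Ω, C j ^ 2 := by
    refine setIntegral_mono_on (hc.memLp j hjm).integrable_sq ?_ measurableSet_Icc fun x hx => ?_
    · exact integrable_const (μ := μΩ) _
    · have := hC j (t, x) ⟨ht, hx⟩
      rw [← sq_abs]
      exact pow_le_pow_left₀ (abs_nonneg _) this 2
  rw [integral_Ω, intervalIntegral.integral_const, sub_zero, smul_eq_mul] at h2
  exact h2

lemma sobolevNorm_eq_zero (m : ℕ) {f : ℝ → ℝ} (hf : ∀ x ∈ Ω, f x = 0) : sobolevNorm m f = 0 := by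
  have hz : ∀ u : ℝ → ℝ, (∀ x ∈ Ω, u x = 0) → l2sq u = 0 := fun u hu => by
    rw [l2sq, setIntegral_congr_fun (s := Ω) measurableSet_Icc (g := fun _ => (0 : ℝ)) fun x hx => by
      simp [hu x hx]]
    simp
  have hc : IsChain m fun j => if j = 0 then f else fun _ => 0 := by
    refine ⟨fun j _ x hx => ?_, fun j _ => ?_⟩
    · by_cases h : j = 0
      · simp [h, hf x hx, hf 0 zero_mem_Ω]
      · simp [h]
    · by_cases h : j = 0
      · simp only [h, if_true]
        exact memLp_of_continuousOn (continuousOn_const.congr hf)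
      · simp [h]
  have h1 := hc.sobolevNorm_eq
  simp only [if_true] at h1
  rw [h1, Finset.sum_eq_zero fun j _ => ?_]
  · simp
  · by_cases h : j = 0
    · simp only [h, if_true]
      exact hz f hf
    · simp only [h, if_false]
      exact hz _ fun _ _ => rfl

/-- The factor 4 is a rounding of √(4π + 1). -/
lemma IsChain.abs_le_of_sobolevNorm_le {m : ℕ} {F : ℕ → ℝ → ℝ} (h : IsChain m F) {B : ℝ}
    (hB : 0 ≤ B) (hle : sobolevNorm m (F 0) ≤ ENNReal.ofReal B) {j : ℕ} (hj : j < m) {x : ℝ}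
    (hx : x ∈ Ω) : |F j x| ≤ 4 * B := by
  have h1 := (h.isPrimitive j hj).sq_le (h.memLp j hj.le) (h.memLp (j + 1) hj) hx
  have h2 := h.l2sq_le hB hle hj.le
  have h3 := h.l2sq_le hB hle (Nat.succ_le_of_lt hj)
  have hpi := Real.pi_lt_d2
  have hpi0 := Real.pi_pos
  refine abs_le_of_sq_le_sq ?_ (by positivity)
  have h4 := mul_le_mul_of_nonneg_left h3 (by positivity : 0 ≤ 4 * Real.pi)
  nlinarith [sq_nonneg B]

/-- A solution cannot be small if the source does not vanish. -/
lemma exists_pos_le_of_source_ne_zero {k : ℕ} (hk : 1 ≤ k) {T : ℝ} (hT : 0 < T) {α : ℝ → ℝ}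
    (hα : ContDiffOn ℝ ∞ α Ω) {g : ℝ → ℝ → ℝ}
    (hg : ContDiffOn ℝ ∞ (fun p : ℝ × ℝ => g p.1 p.2) (Icc 0 T ×ˢ Ω)) {t : ℝ} (ht : t ∈ Icc 0 T)
    {τ₀ : ℝ} (hτ₀ : τ₀ ∈ Ico 0 t) {x₀ : ℝ} (hx₀ : x₀ ∈ Ω) (hne : g τ₀ x₀ ≠ 0) :
    ∃ c : ℝ, 0 < c ∧ ∀ (u₀ : ℝ → ℝ) (u : ℝ → ℝ → ℝ), IsSolution T α g u₀ u →
      (∀ τ ∈ Icc 0 T, MemSobolev (k + 2) (u τ)) → ∀ B : ℝ, 0 ≤ B →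
      (∀ τ ∈ Icc 0 t, sobolevNorm (k + 2) (u τ) ≤ ENNReal.ofReal B) → c ≤ B := by
  obtain ⟨A, hA0, hA⟩ := exists_isSmoothChain_of_contDiffOn hα
  obtain ⟨L, hL0, hL⟩ := hA.exists_bound (k + 2)
  obtain ⟨G, hG0, -, hG⟩ := exists_isSmoothChain hT hg
  set γ := |g τ₀ x₀| / 2 with hγ
  have hγ0 : 0 < γ := by positivity
  have hcont : ContinuousOn (fun τ => |g τ x₀|) (Icc 0 T) := by
    have h1 : ContinuousOn (fun τ => g τ x₀) (Icc 0 T) :=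
      hg.continuousOn.comp (f := fun τ : ℝ => (τ, x₀)) (by fun_prop) fun τ hτ => ⟨hτ, hx₀⟩
    exact h1.abs
  have hτ₀T : τ₀ ∈ Icc 0 T := ⟨hτ₀.1, hτ₀.2.le.trans ht.2⟩
  obtain ⟨δ, hδ, hball⟩ := Metric.continuousWithinAt_iff.1 (hcont τ₀ hτ₀T) γ hγ0
  -- On [τ₀, τ₁] the source at x₀ stays at least γ in modulus, half its value at τ₀. The interval is
  -- nondegenerate because τ₀ < t.
  set τ₁ := min t (τ₀ + δ / 2)
  have hlt : τ₀ < τ₁ := lt_min hτ₀.2 (by linarith)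
  have hτ₁t : τ₁ ≤ t := min_le_left _ _
  have hτ₁δ : τ₁ ≤ τ₀ + δ / 2 := min_le_right _ _
  have hgγ : ∀ τ ∈ Icc τ₀ τ₁, γ ≤ |g τ x₀| := by
    intro τ hτ
    have h1 := hball (x := τ) ⟨hτ₀.1.trans hτ.1, (hτ.2.trans hτ₁t).trans ht.2⟩ (by
      rw [Real.dist_eq, abs_of_nonneg (by linarith [hτ.1])]
      linarith [hτ.2])
    rw [Real.dist_eq] at h1
    have h2 := (abs_lt.1 h1).1
    rw [hγ] at h2 ⊢
    linarith
  set d := τ₁ - τ₀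
  have hd : 0 < d := sub_pos.2 hlt
  -- A norm bound B on u forces |u_t| ≥ γ - 8 L B at x₀, whereas u changes there by at most 8 B over
  -- time d. The mean value theorem gives γ d ≤ (8 + 8 L d) B.
  refine ⟨γ * d / (8 + 8 * L * d), by positivity, fun u₀ u hu hsob B hB hBu => ?_⟩
  have hbound : ∀ τ ∈ Icc τ₀ τ₁, |u τ x₀| ≤ 4 * B ∧
      γ - 8 * L * B ≤ |derivWithin (fun s => u s x₀) (Icc 0 T) τ| := by
    intro τ hτ
    have hτt : τ ∈ Icc 0 t := ⟨hτ₀.1.trans hτ.1, hτ.2.trans hτ₁t⟩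
    have hτT : τ ∈ Icc 0 T := ⟨hτt.1, hτt.2.trans ht.2⟩
    obtain ⟨U, W, hU, hU0, -, hW1, hW2, -⟩ :=
      hu.exists_isChain hk hA hA0 hG0 hG hL hτT (hsob τ hτT)
    have hBU : sobolevNorm (k + 2) (U 0) ≤ ENNReal.ofReal B := hU0 ▸ hBu τ hτt
    have b0 := hU.abs_le_of_sobolevNorm_le hB hBU (j := 0) (by omega) hx₀
    have b1 := hU.abs_le_of_sobolevNorm_le hB hBU (j := 1) (by omega) hx₀
    refine ⟨by rw [← hU0]; exact b0, ?_⟩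
    rw [hW2 x₀ hx₀, hW1 x₀ hx₀]
    have b2 : |leibniz 1 A U x₀| ≤ 8 * L * B := by
      have e1 := mul_le_mul (hL 1 (by omega) x₀ hx₀) b0 (abs_nonneg _) hL0
      have e2 := mul_le_mul (hL 0 (by omega) x₀ hx₀) b1 (abs_nonneg _) hL0
      have e3 := abs_add_le (A 1 x₀ * U 0 x₀) (A 0 x₀ * U 1 x₀)
      rw [abs_mul, abs_mul] at e3
      calc |leibniz 1 A U x₀| = |A 1 x₀ * U 0 x₀ + A 0 x₀ * U 1 x₀| := rfl
        _ ≤ 8 * L * B := by linarith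
    have b3 := hgγ τ hτ
    have b4 := abs_sub_abs_le_abs_sub (g τ x₀) (leibniz 1 A U x₀)
    linarith
  have hsub : Icc τ₀ τ₁ ⊆ Icc 0 T := Icc_subset_Icc hτ₀.1 (hτ₁t.trans ht.2)
  have hdiff := hu.differentiable_time x₀ hx₀
  obtain ⟨τ, hτ, hslope⟩ := exists_hasDerivAt_eq_slope (fun s => u s x₀)
    (derivWithin (fun s => u s x₀) (Icc 0 T)) hlt (hdiff.continuousOn.mono hsub) fun τ hτ => by
      have hmem : Icc 0 T ∈ nhds τ :=
        Icc_mem_nhds (hτ₀.1.trans_lt hτ.1) (hτ.2.trans_le (hτ₁t.trans ht.2))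
      exact (hdiff τ (mem_of_mem_nhds hmem)).hasDerivWithinAt.hasDerivAt hmem
  have h1 := (hbound τ (Ioo_subset_Icc_self hτ)).2
  have h2 := (hbound τ₀ ⟨le_rfl, hlt.le⟩).1
  have h3 := (hbound τ₁ ⟨hlt.le, le_rfl⟩).1
  have h4 : |u τ₁ x₀ - u τ₀ x₀| ≤ 8 * B := by
    have := abs_sub (u τ₁ x₀) (u τ₀ x₀)
    linarith
  rw [hslope, abs_div, abs_of_pos hd, le_div_iff₀ hd] at h1
  rw [div_le_iff₀ (by positivity)]
  nlinarith

lemma ofReal_mul_toReal_le {c m : ℝ} (hc : 0 ≤ c) {x : ℝ≥0∞} (hx : x ≠ ⊤) (hm : m = x.toReal) :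
    ENNReal.ofReal (c * m) ≤ ENNReal.ofReal c * x := by
  rw [hm, ENNReal.ofReal_mul hc, ENNReal.ofReal_toReal hx]

end SpectralVolume

end

/-! ### Absorbing the source, and the two estimates -/

theorem theorem4p1 (k : ℕ) (hk : 1 ≤ k) (T : ℝ) (hT : 0 < T) (σ : ℝ)
    (α : ℝ → ℝ) (hα : ContDiffOn ℝ ∞ α SpectralVolume.Ω) (hα_per : α 0 = α (2 * Real.pi)) :
    -- the estimate, with a constant independent of the mesh and of the solution
    (∀ g : ℝ → ℝ → ℝ,
      ContDiffOn ℝ ∞ (fun p : ℝ × ℝ => g p.1 p.2) (Icc 0 T ×ˢ SpectralVolume.Ω) →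
      ∀ t ∈ Icc 0 T, ∃ C : ℝ, 0 < C ∧ SpectralVolume.ErrorBound k T σ α g t C 0) ∧
    -- one constant for all `g` and `t`, with the norm of `g` as an extra term; in particular one
    -- constant for all `t` in the estimate without extra term if `g = 0`
    (∃ C : ℝ, 0 < C ∧ ∀ g : ℝ → ℝ → ℝ,
      ContDiffOn ℝ ∞ (fun p : ℝ × ℝ => g p.1 p.2) (Icc 0 T ×ˢ SpectralVolume.Ω) →
      ∀ t ∈ Icc 0 T, SpectralVolume.ErrorBound k T σ α g t C
        (⨆ τ ∈ Icc 0 t, SpectralVolume.sobolevNorm (k + 1) (g τ))) := by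
  obtain ⟨C, hC, hbound⟩ := SpectralVolume.exists_error_bound k hk T hT σ α hα hα_per
  have htop : ∀ (c : ℝ), 0 < c → ENNReal.ofReal c * ⊤ = ⊤ := fun c hc =>
    ENNReal.mul_top (ENNReal.ofReal_pos.2 hc).ne'
  refine ⟨fun g hg t ht => ?_, C, hC, fun g hg t ht => ?_⟩
  · obtain ⟨S, hS0, hS⟩ := SpectralVolume.exists_sobolevNorm_le (k + 1) hT hg
    obtain ⟨a, ha, hap⟩ : ∃ a : ℝ, 1 ≤ a ∧ ∀ (u₀ : ℝ → ℝ) (u : ℝ → ℝ → ℝ),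
        SpectralVolume.IsSolution T α g u₀ u →
        (∀ τ ∈ Icc 0 T, SpectralVolume.MemSobolev (k + 2) (u τ)) → ∀ B : ℝ, 0 ≤ B →
        (∀ τ ∈ Icc 0 t, SpectralVolume.sobolevNorm (k + 2) (u τ) ≤ ENNReal.ofReal B) →
        ∀ τ ∈ Ico 0 t, SpectralVolume.sobolevNorm (k + 1) (g τ) ≤ ENNReal.ofReal (a * B) := by
      -- If g is nonzero somewhere before t, then B ≥ c > 0 and the bound S of the source norm is at
      -- most (S / c) B. The time t itself is excluded: for t = 0 the source at t says nothing about
      -- the size of u on [0, t].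
      by_cases h : ∃ τ ∈ Ico 0 t, ∃ x ∈ SpectralVolume.Ω, g τ x ≠ 0
      · obtain ⟨τ₀, hτ₀, x₀, hx₀, hne⟩ := h
        obtain ⟨c, hc, hcB⟩ := SpectralVolume.exists_pos_le_of_source_ne_zero hk hT hα hg ht hτ₀
          hx₀ hne
        refine ⟨1 + S / c, by have : 0 ≤ S / c := by positivity
                              linarith, fun u₀ u hu hsob B hB hBu τ hτ => ?_⟩
        refine (hS τ ⟨hτ.1, hτ.2.le.trans ht.2⟩).trans (ENNReal.ofReal_le_ofReal ?_)
        have h1 : S / c * c ≤ S / c * B :=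
          mul_le_mul_of_nonneg_left (hcB u₀ u hu hsob B hB hBu) (by positivity)
        rw [div_mul_cancel₀ _ hc.ne'] at h1
        linarith
      · push Not at h
        refine ⟨1, le_rfl, fun u₀ u _ _ B _ _ τ hτ => ?_⟩
        rw [SpectralVolume.sobolevNorm_eq_zero _ (h τ hτ)]
        exact zero_le
    have ha0 : 0 < a := by linarith
    refine ⟨C * a, by positivity, ?_⟩
    intro m N _ M s u₀ u uh hσ hadm hu hsob huh h0
    have hh : 0 < M.h ^ (k + 1) := pow_pos M.h_pos _
    rw [add_zero]
    set X := ⨆ τ ∈ Icc 0 t, SpectralVolume.sobolevNorm (k + 2) (u τ) with hX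
    -- No regularity in time of the Sobolev norm is assumed, so the supremum may be infinite; then
    -- the right side is infinite as well, its factor being positive.
    by_cases hXt : X = ⊤
    · rw [hXt, htop _ (by positivity)]
      exact le_top
    have hle : ∀ τ ∈ Icc 0 t, SpectralVolume.sobolevNorm (k + 2) (u τ) ≤
        ENNReal.ofReal X.toReal := fun τ hτ => by
      rw [ENNReal.ofReal_toReal hXt]
      exact le_iSup₂ (f := fun τ _ => SpectralVolume.sobolevNorm (k + 2) (u τ)) τ hτ
    have hX0 : 0 ≤ X.toReal := ENNReal.toReal_nonneg
    have key := hbound g hg t ht m N M s u₀ u uh hσ hadm hu hsob huh h0 (a * X.toReal)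
      (by positivity)
      (fun τ hτ => (hle τ hτ).trans (ENNReal.ofReal_le_ofReal (le_mul_of_one_le_left hX0 ha)))
      (hap u₀ u hu hsob _ hX0 hle)
    refine key.trans ?_
    rw [show C * M.h ^ (k + 1) * (a * X.toReal) = C * a * M.h ^ (k + 1) * X.toReal by ring]
    exact SpectralVolume.ofReal_mul_toReal_le (by positivity) hXt rfl
  · intro m N _ M s u₀ u uh hσ hadm hu hsob huh h0
    have hh : 0 < M.h ^ (k + 1) := pow_pos M.h_pos _
    set X := ⨆ τ ∈ Icc 0 t, SpectralVolume.sobolevNorm (k + 2) (u τ) with hX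
    set Y := ⨆ τ ∈ Icc 0 t, SpectralVolume.sobolevNorm (k + 1) (g τ) with hY
    by_cases hXt : X + Y = ⊤
    · rw [hXt, htop _ (by positivity)]
      exact le_top
    have key := hbound g hg t ht m N M s u₀ u uh hσ hadm hu hsob huh h0 (X + Y).toReal
      ENNReal.toReal_nonneg (fun τ hτ => ?_) (fun τ hτ => ?_)
    · exact key.trans (SpectralVolume.ofReal_mul_toReal_le (by positivity) hXt rfl)
    · rw [ENNReal.ofReal_toReal hXt]
      exact (le_iSup₂ (f := fun τ _ => SpectralVolume.sobolevNorm (k + 2) (u τ)) τ hτ).trans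
        le_self_add
    · rw [ENNReal.ofReal_toReal hXt]
      exact (le_iSup₂ (f := fun τ _ => SpectralVolume.sobolevNorm (k + 1) (g τ)) τ
        ⟨hτ.1, hτ.2.le⟩).trans le_add_self
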